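/- **Setting.** Let $\Lambda=\mathbb{Z}_L^D$ be the cubic lattice of linear size $L\ge 1$ with periodic boundary conditions and the $\ell_\infty$-distance, each site carrying finitely many qubits. A *cube (box) of linear size (width) $w$* is a translate of $\{0,\dots,w-1\}^D$; an *elementary cube* is a translate of $\{0,1\}^D$. Let $H=-\sum_{a=1}^{M}G_a$ be a code Hamiltonian: the $G_a$ are pairwise commuting multi-qubit Pauli operators, each acting nontrivially only on qubits at the vertices of an elementary cube assigned to it. Pauli operators are considered up to phase. The *weight* of a Pauli operator is the number of qubits on which it acts nontrivially; a *stabilizer* is a product of the $G_a$; the *defects* created by a Pauli operator $E$ (its syndrome) are the terms $G_a$ anticommuting with $E$, each located at its elementary cube; a *logical operator* is a Pauli operator that creates no defects and is not a stabilizer; the *code distance* is the minimal weight of a logical operator. The diameter of, and distances between, sets of defects are those of the unions of their elementary cubes. Let $L_{tqo}\le L/2$ be a non-negative integer. A set (cluster) of defects is *neutral* if it is exactly the set of defects created by some Pauli operator whose support is enclosed by a cube of linear size $L_{tqo}$; otherwise it is *charged*. Consider the following conditions. * *TQO1*: a Pauli operator that creates no defects and whose support is enclosed by a cube of linear size $L_{tqo}$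 is a stabilizer. * *TQO2*: every neutral cluster $S$ can be created by a Pauli operator supported on the $1$-neighbourhood of a smallest cube enclosing $S$. * *No-strings rule with constant $\alpha\ge1$*: whenever a Pauli operator with support enclosed by a cube of linear size $L_{tqo}$ creates only defects contained in the union of two boxes of width $w$, and the cluster of those defects that are contained in one of the boxes is charged, the distance between the boxes is at most $\alpha w$. **Theorem.** (1) For every $D$ and every $\alpha\ge 1$ there are constants $\gamma>1$ and $c>0$ such that the following holds for all $L$, all $L_{tqo}\le L/2$ and all code Hamiltonians as above satisfying TQO1, TQO2 and the no-strings rule with constant $\alpha$. Let $E$ be a Pauli operator creating a neutral cluster of defects $S$, and let $S'\subseteq S$ be a charged cluster of diameter $r$ such that no defect of $S\setminus S'$ lies within distance $R\ge0$ of $S'$. If $r+2R<L_{tqo}$, then the weight of $E$ is at least $cR^\gamma$. (2) There are constants $\gamma>1$ and $c>0$ such that for every $L\ge1$ the code distance of the cubic code on $\mathbb{Z}_L^3$ is at least $cL^\gamma$. Here the cubic code has two qubits per site, and with $f=1+x+y+z$ and $g=1+xy+yz+zx$ its terms are all lattice translates of two operators: a product of $\sigma^x$ on the first qubits at the sites given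 by the monomials of $f$ and on the second qubits at those of $g$; and a product of $\sigma^z$ on the first qubits at the sites given by the monomials of $\bar g$ and on the second qubits at those of $\bar f$ (the bar replaces $x,y,z$ by their inverses, exponents are read modulo $L$, and coincident factors multiply). -/

import Mathlib

/-! Pauli operators and code Hamiltonians on a periodic cubic lattice. -/

namespace PauliCode

/-- The `D`-dimensional cubic lattice of linear size `L` with periodic boundary conditions. -/
abbrev Site (D L : ℕ) : Type := Fin D → ZMod L

/-- The `ℓ_∞`-distance on the periodic lattice; on each coordinate circle the distance of `a` and
`b` is the least absolute value of an integer representing `a - b`. -/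
def siteDist {D L : ℕ} (u v : Site D L) : ℕ :=
  Finset.univ.sup fun i => ((u i - v i).valMinAbs).natAbs

/-- The cube (box) of linear size `w` (that is, with `w` sites per side) and lowest corner `x`.
An elementary cube, whose vertices are `x + {0,1}^D`, is `cube x 2`. -/
def cube {D L : ℕ} (x : Site D L) (w : ℕ) : Set (Site D L) :=
  {u | ∀ i, (u i - x i).val < w}

/-- The `r`-neighbourhood of a region. -/
def nbhd {D L : ℕ} (r : ℕ) (A : Set (Site D L)) : Set (Site D L) :=
  {u | ∃ v ∈ A, siteDist u v ≤ r}

/-- A region is enclosed by some cube of linear size `w`. -/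
def EnclosedBy {D L : ℕ} (w : ℕ) (A : Set (Site D L)) : Prop :=
  ∃ x, A ⊆ cube x w

/-- `cube x w` is a smallest cube enclosing the region `A`. -/
def IsSmallestCube {D L : ℕ} (x : Site D L) (w : ℕ) (A : Set (Site D L)) : Prop :=
  A ⊆ cube x w ∧ ∀ w', EnclosedBy w' A → w ≤ w'

/-- Multi-qubit Pauli operators on the qubits `Q`, up to an overall phase: at each qubit,
`(0,0), (1,0), (0,1), (1,1)` stand for `I, X, Z, Y`, and addition is multiplication of operators. -/
abbrev Pauli (Q : Type) : Type := Q → ZMod 2 × ZMod 2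

/-- The weight: the number of non-identity tensor factors. -/
def Pauli.weight {Q : Type} [Fintype Q] (E : Pauli Q) : ℕ := hammingNorm E

/-- The commutator form: `0` if the two Pauli operators commute and `1` if they anticommute. -/
def Pauli.comm {Q : Type} [Fintype Q] (E F : Pauli Q) : ZMod 2 :=
  ∑ q, ((E q).1 * (F q).2 + (E q).2 * (F q).1)

/-- A code Hamiltonian `H = - ∑ a, G_a` on the periodic lattice: qubits `Q` placed on the sites,
pairwise commuting Pauli terms `G_a`, each acting nontrivially only on qubits located at vertices
of an elementary cube, the one with lowest corner `corner a`. -/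
structure CodeHamiltonian (D L : ℕ) (Q ι : Type) [Fintype Q] where
  site : Q → Site D L
  gen : ι → Pauli Q
  corner : ι → Site D L
  comm_gen : ∀ a b, (gen a).comm (gen b) = 0
  gen_local : ∀ a q, gen a q ≠ 0 → site q ∈ cube (corner a) 2

namespace CodeHamiltonian

variable {D L : ℕ} {Q ι : Type} [Fintype Q] (H : CodeHamiltonian D L Q ι)

/-- The set of sites on which a Pauli operator acts nontrivially. -/
def supp (E : Pauli Q) : Set (Site D L) := {u | ∃ q, H.site q = u ∧ E q ≠ 0}

/-- `E` is a stabilizer (up to phase): a product of terms of the Hamiltonian. -/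
def IsStabilizer (E : Pauli Q) : Prop := E ∈ Submodule.span (ZMod 2) (Set.range H.gen)

/-- The syndrome caused by `E`: the set of defects (flipped terms) that `E` creates from the
vacuum. -/
def syndrome (E : Pauli Q) : Set ι := {a | (H.gen a).comm E = 1}

/-- A logical operator creates no defects and is not a stabilizer. -/
def IsLogical (E : Pauli Q) : Prop := H.syndrome E = ∅ ∧ ¬ H.IsStabilizer E

/-- The code distance: the minimal weight of a logical operator. -/
noncomputable def codeDistance : ℕ := sInf {n | ∃ E, H.IsLogical E ∧ E.weight = n}

/-- The elementary cube occupied by the defect `a`. -/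
def cell (a : ι) : Set (Site D L) := cube (H.corner a) 2

/-- The union of the elementary cubes occupied by a cluster of defects. -/
def region (S : Set ι) : Set (Site D L) := {u | ∃ a ∈ S, u ∈ H.cell a}

/-- A cluster of defects is neutral if it can be created from the vacuum, without any other
defects, by a Pauli operator whose support is enclosed by a cube of linear size `ℓ`
(the length scale of topological order). -/
def Neutral (ℓ : ℕ) (S : Set ι) : Prop :=
  ∃ E : Pauli Q, EnclosedBy ℓ (H.supp E) ∧ H.syndrome E = S

/-- A cluster of defects is charged if it is not neutral. -/
def Charged (ℓ : ℕ) (S : Set ι) : Prop := ¬ H.Neutral ℓ S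

/-- First topological order condition. -/
def TQO1 (ℓ : ℕ) : Prop :=
  ∀ E : Pauli Q, H.syndrome E = ∅ → EnclosedBy ℓ (H.supp E) → H.IsStabilizer E

/-- Second topological order condition: a neutral cluster can be created on the
`1`-neighbourhood of its smallest enclosing cube. -/
def TQO2 (ℓ : ℕ) : Prop :=
  ∀ S : Set ι, H.Neutral ℓ S →
    ∃ (x : Site D L) (w : ℕ), IsSmallestCube x w (H.region S) ∧
      ∃ E : Pauli Q, H.supp E ⊆ nbhd 1 (cube x w) ∧ H.syndrome E = S

/-- The no-strings rule with constant `α`. A string segment is a Pauli operator with local support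
(enclosed by a cube of linear size `ℓ`) all of whose defects are contained in the union of two
boxes of width `w`; if the charge contained in one of the boxes is nontrivial, then the distance
between the boxes is at most `α w`. -/
def NoStrings (ℓ : ℕ) (α : ℝ) : Prop :=
  ∀ (P : Pauli Q) (w : ℕ) (x y : Site D L),
    EnclosedBy ℓ (H.supp P) →
    (∀ a ∈ H.syndrome P, H.cell a ⊆ cube x w ∨ H.cell a ⊆ cube y w) →
    H.Charged ℓ {a | a ∈ H.syndrome P ∧ H.cell a ⊆ cube x w} →
    ∃ u ∈ cube x w, ∃ v ∈ cube y w, (siteDist u v : ℝ) ≤ α * w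

end CodeHamiltonian

/-! ### The cubic code -/

/-- The exponents of `f = 1 + x + y + z`. -/
def fExp (L : ℕ) : Fin 4 → Site 3 L := ![![0, 0, 0], ![1, 0, 0], ![0, 1, 0], ![0, 0, 1]]

/-- The exponents of `g = 1 + xy + yz + zx`. -/
def gExp (L : ℕ) : Fin 4 → Site 3 L := ![![0, 0, 0], ![1, 1, 0], ![0, 1, 1], ![1, 0, 1]]

/-- The coefficients of the sum of the four monomials with exponents `e` in the group algebra over
`𝔽₂` of the group of lattice sites. -/
def coeffs {L : ℕ} (e : Fin 4 → Site 3 L) (v : Site 3 L) : ZMod 2 :=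
  ∑ k, if e k = v then 1 else 0

/-- The terms of the cubic code, with two qubits on each site. The term `(u, false)` is the
translate to `u` of the operator with `X`-part `(f, g)`; the term `(u, true)` is the translate to
`u` of the operator with `Z`-part `(ḡ, f̄)`, where the bar inverts `x, y, z`. -/
def cubicGen (L : ℕ) : Site 3 L × Bool → Pauli (Site 3 L × Fin 2)
  | (u, false), (v, 0) => (coeffs (fExp L) (v - u), 0)
  | (u, false), (v, 1) => (coeffs (gExp L) (v - u), 0)
  | (u, true), (v, 0) => (0, coeffs (gExp L) (u - v))
  | (u, true), (v, 1) => (0, coeffs (fExp L) (u - v))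

/-- The lowest corner of the elementary cube on which a term of the cubic code acts. -/
def cubicCorner (L : ℕ) : Site 3 L × Bool → Site 3 L
  | (u, false) => u
  | (u, true) => u - 1

theorem sum_coeffs_swap {L : ℕ} [NeZero L] (e e' : Fin 4 → Site 3 L) (u t : Site 3 L) :
    ∑ v, coeffs e (v - u) * coeffs e' (t - v) = ∑ v, coeffs e' (v - u) * coeffs e (t - v) := by
  rw [← Equiv.sum_comp (Equiv.subLeft (u + t))]
  refine Finset.sum_congr rfl fun v _ => ?_
  simp only [Equiv.subLeft_apply]
  rw [mul_comm]
  congr 2 <;> abel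

theorem cubicGen_comm (L : ℕ) [NeZero L] (a b : Site 3 L × Bool) :
    (cubicGen L a).comm (cubicGen L b) = 0 := by
  obtain ⟨u, s⟩ := a
  obtain ⟨t, s'⟩ := b
  have h2 : ∀ z : ZMod 2, z + z = 0 := by decide
  cases s <;> cases s' <;>
    simp only [Pauli.comm, Fintype.sum_prod_type, Fin.sum_univ_two, cubicGen, mul_zero, zero_mul,
      add_zero, zero_add, Finset.sum_const_zero, Finset.sum_add_distrib]
  · rw [sum_coeffs_swap, h2]
  · simp only [mul_comm (coeffs _ (u - _))]
    rw [sum_coeffs_swap, h2]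

theorem coeffs_ne_zero {L : ℕ} {e : Fin 4 → Site 3 L} {v : Site 3 L} (h : coeffs e v ≠ 0) :
    ∃ k, e k = v := by
  by_contra hk
  push Not at hk
  exact h (Finset.sum_eq_zero fun k _ => if_neg (hk k))

theorem exp_zero_or_one (L : ℕ) (k : Fin 4) (i : Fin 3) :
    (fExp L k i = 0 ∨ fExp L k i = 1) ∧ (gExp L k i = 0 ∨ gExp L k i = 1) := by
  fin_cases k <;> fin_cases i <;> simp [fExp, gExp]

theorem val_lt_two {L : ℕ} [NeZero L] {z : ZMod L} (h : z = 0 ∨ z = 1) : z.val < 2 := by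
  rcases h with rfl | rfl
  · simp
  · rw [ZMod.val_one_eq_one_mod]
    exact lt_of_le_of_lt (Nat.mod_le _ _) one_lt_two

theorem cubicGen_local (L : ℕ) [NeZero L] (a : Site 3 L × Bool) (q : Site 3 L × Fin 2)
    (h : cubicGen L a q ≠ 0) : q.1 ∈ cube (cubicCorner L a) 2 := by
  obtain ⟨u, s⟩ := a
  obtain ⟨v, j⟩ := q
  intro i
  apply val_lt_two
  have key : ∀ e : Fin 4 → Site 3 L, (∀ k i, e k i = 0 ∨ e k i = 1) → ∀ x : Site 3 L,
      coeffs e x ≠ 0 → x i = 0 ∨ x i = 1 := by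
    intro e he x hx
    obtain ⟨k, rfl⟩ := coeffs_ne_zero hx
    exact he k i
  have keyf := key _ fun k i => (exp_zero_or_one L k i).1
  have keyg := key _ fun k i => (exp_zero_or_one L k i).2
  have flip : (u i - v i = 0 ∨ u i - v i = 1) → v i - (u i - 1) = 0 ∨ v i - (u i - 1) = 1 := by
    rintro (h | h)
    · right; linear_combination -h
    · left; linear_combination -h
  cases s
  · fin_cases j
    · exact keyf _ fun h0 => h (Prod.ext h0 rfl)
    · exact keyg _ fun h0 => h (Prod.ext h0 rfl)
  · fin_cases j
    · exact flip (keyg _ fun h0 => h (Prod.ext rfl h0))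
    · exact flip (keyf _ fun h0 => h (Prod.ext rfl h0))

/-- The cubic code on the periodic three-dimensional lattice of linear size `L`. -/
def cubicCode (L : ℕ) [NeZero L] : CodeHamiltonian 3 L (Site 3 L × Fin 2) (Site 3 L × Bool) where
  site := Prod.fst
  gen := cubicGen L
  corner := cubicCorner L
  comm_gen := cubicGen_comm L
  gen_local := cubicGen_local L

end PauliCode

open PauliCode

/-! Both parts rest on the property `Barrier`: an operator whose defects avoid the heights strictly
between 0 and T, and whose support there costs less than (T/u)^(1+s), creates a neutral cluster at
height at most 0. Supports are covered by balls. A site costs 1, and a ball of radius w ≥ u costs a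
large multiple of (w/u)^(1+s), so operators added for repair can be counted together with the
original one.

`barrier` is a strong induction on T. For small T, counting finds two adjacent empty heights and the
operator is cut there. For larger T it is cut at a typical height t, and the defects created by the
cut are coarse-grained through the scales u q^n. Clumps closer than the scale are merged. Isolated
neutral clumps are removed by local operators. Isolated charged clumps stay, but by induction each
is surrounded by support of cost growing like the power 1+s of the scale, so they are few. The
concave potential ∑ m^σ of the diameters does not grow under merging, and averaging over t bounds
both the potential and the cost of the repairs (`Slab.sum_bounds_le`). At a final scale Θ comparable
to T, the surviving charged clumps are more than 202 Θ apart, and each uses cost 100 (Θ/u)^(1+s) in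
a one-sided slice of height about 100 Θ. A cost density below twice the critical one therefore
leaves at most one charged clump (`Slab.CutScale.exists_cut`).

In the induction step (`barrier_step`), if the upper or the lower two thirds of the heights are
cheap, the barrier for 2T/3 applies. Otherwise each outer third holds little more than a third of
the total cost, and both can be cut. The repaired middle piece is then a string segment with two
small distant clusters, so each cluster can be created locally. Adding such an operator to the
innermost piece creates the inner cluster alone. As s is tiny, all losses of the form (T/Θ)^s are
close to 1.

Part (1) uses the distance to S' as height. TQO2 and the no-strings rule supply `StringFree`. For
the cubic code, `StringFree` is algebra: clusters are polynomials, neutral ones lie in the ideal (f,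
g), and on a line of the zero set of (f, g) over 𝔽₄ the variables x, y, z become linear polynomials
with distinct roots. Multiplicities of roots then show that nonzero charges far apart cannot cancel.
For the distance bound, a cheap operator without defects is cut along the three coordinates. At
total cost below 99 (Θ/u)^(1+s) no charged clump is left, so all pieces are free of defects. They
fit in a cube of size L - 1 and are stabilizers because f and g have only trivial syzygies. -/

namespace PauliCode

/-! ### Periodic distance and Lipschitz heights. -/

section Metric
variable {D L : ℕ}

theorem siteDist_le_iff {u v : Site D L} {n : ℕ} :
    siteDist u v ≤ n ↔ ∀ i, ((u i - v i).valMinAbs).natAbs ≤ n := by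
  simp [siteDist, Finset.sup_le_iff]

@[simp] theorem siteDist_self (u : Site D L) : siteDist u u = 0 := by
  rw [← Nat.le_zero, siteDist_le_iff]; simp

theorem siteDist_comm (u v : Site D L) : siteDist u v = siteDist v u := by
  unfold siteDist
  congr 1; funext i
  rw [← neg_sub, ZMod.natAbs_valMinAbs_neg]

theorem siteDist_triangle (u v w : Site D L) : siteDist u w ≤ siteDist u v + siteDist v w := by
  rw [siteDist_le_iff]
  intro i
  have h1 := siteDist_le_iff.1 (le_refl (siteDist u v)) i
  have h2 := siteDist_le_iff.1 (le_refl (siteDist v w)) i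
  have h3 := ZMod.natAbs_valMinAbs_add_le (u i - v i) (v i - w i)
  rw [sub_add_sub_cancel] at h3
  exact h3.trans ((Int.natAbs_add_le _ _).trans (add_le_add h1 h2))

/-- Functions on the lattice that change by at most the distance. -/
def Lip (h : Site D L → ℤ) : Prop := ∀ u v, |h u - h v| ≤ siteDist u v

/-- The distance from a site to a region. -/
noncomputable def distTo (U : Set (Site D L)) (u : Site D L) : ℕ :=
  sInf {n | ∃ v ∈ U, siteDist u v = n}

theorem exists_distTo {U : Set (Site D L)} (hU : U.Nonempty) (u : Site D L) :
    ∃ v ∈ U, siteDist u v = distTo U u := by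
  obtain ⟨v, hv⟩ := hU
  exact Nat.sInf_mem (s := {n | ∃ v ∈ U, siteDist u v = n}) ⟨_, v, hv, rfl⟩

theorem distTo_le {U : Set (Site D L)} {u v : Site D L} (hv : v ∈ U) :
    distTo U u ≤ siteDist u v := Nat.sInf_le ⟨v, hv, rfl⟩

theorem distTo_eq_zero {U : Set (Site D L)} {u : Site D L} (hu : u ∈ U) : distTo U u = 0 := by
  simpa using distTo_le (u := u) hu

theorem lip_distTo {U : Set (Site D L)} (hU : U.Nonempty) :
    Lip fun u => (distTo U u : ℤ) := by
  have key : ∀ u v, distTo U u ≤ distTo U v + siteDist u v := by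
    intro u v
    obtain ⟨w, hw, hvw⟩ := exists_distTo hU v
    have := siteDist_triangle u v w
    have := distTo_le (u := u) hw
    omega
  intro u v
  have h1 := key u v
  have h2 := key v u
  rw [siteDist_comm v u] at h2
  rw [abs_le]
  constructor <;> push_cast <;> omega

theorem Lip.sub_const {h : Site D L → ℤ} (hh : Lip h) (c : ℤ) : Lip fun u => h u - c := by
  intro u v
  simpa using hh u v

theorem siteDist_le_of_mem_cube {x u : Site D L} {w : ℕ} [NeZero L] (hu : u ∈ cube x (w + 1)) :
    siteDist u x ≤ w := by
  rw [siteDist_le_iff]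
  intro i
  have := hu i
  have h2 := ZMod.valMinAbs_natAbs_eq_min (u i - x i)
  omega

end Metric

/-! ### Syndromes over 𝔽₂, restriction of operators, and string-freeness. -/

namespace CodeHamiltonian
variable {D L : ℕ} {Q ι : Type} [Fintype Q] (H : CodeHamiltonian D L Q ι)

/-- The syndrome as a vector over `𝔽₂`. -/
def syn (E : Pauli Q) : ι → ZMod 2 := fun a => (H.gen a).comm E

theorem zmod_ne_zero_iff (z : ZMod 2) : z ≠ 0 ↔ z = 1 := by revert z; decide

theorem mem_syndrome {E : Pauli Q} {a : ι} : a ∈ H.syndrome E ↔ H.syn E a ≠ 0 := by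
  rw [zmod_ne_zero_iff]; rfl

theorem syn_add (E F : Pauli Q) : H.syn (E + F) = H.syn E + H.syn F := by
  funext a
  simp only [syn, Pauli.comm, Pi.add_apply, ← Finset.sum_add_distrib]
  refine Finset.sum_congr rfl fun q _ => ?_
  simp only [Prod.fst_add, Prod.snd_add]; ring

@[simp] theorem syn_zero : H.syn 0 = 0 := by
  funext a; simp [syn, Pauli.comm]

omit [Fintype Q] in
theorem pauli_add_self (E : Pauli Q) : E + E = 0 := by
  have h2 : ∀ z : ZMod 2, z + z = 0 := by decide
  funext q; exact Prod.ext (h2 _) (h2 _)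

theorem clus_add_self (c : ι → ZMod 2) : c + c = 0 := by
  have h2 : ∀ z : ZMod 2, z + z = 0 := by decide
  funext q; exact h2 _

theorem siteDist_corner_le [NeZero L] {a : ι} {q : Q} (h : H.gen a q ≠ 0) :
    siteDist (H.site q) (H.corner a) ≤ 1 :=
  siteDist_le_of_mem_cube (H.gen_local a q h)

theorem syn_congr [NeZero L] {E F : Pauli Q} {a : ι}
    (h : ∀ q, siteDist (H.site q) (H.corner a) ≤ 1 → E q = F q) : H.syn E a = H.syn F a := by
  unfold syn Pauli.comm
  refine Finset.sum_congr rfl fun q _ => ?_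
  by_cases hq : H.gen a q = 0
  · simp [hq]
  · rw [h q (H.siteDist_corner_le hq)]

theorem syn_eq_zero [NeZero L] {E : Pauli Q} {a : ι}
    (h : ∀ q, siteDist (H.site q) (H.corner a) ≤ 1 → E q = 0) : H.syn E a = 0 := by
  have := H.syn_congr (F := 0) h
  simpa using this

theorem exists_supp_of_syn_ne_zero [NeZero L] {E : Pauli Q} {a : ι} (h : H.syn E a ≠ 0) :
    ∃ v ∈ H.supp E, siteDist v (H.corner a) ≤ 1 := by
  by_contra hc
  push Not at hc
  refine h (H.syn_eq_zero fun q hq => ?_)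
  by_contra hq0
  have := hc (H.site q) ⟨q, rfl, hq0⟩
  omega

theorem mem_supp {E : Pauli Q} {q : Q} (h : E q ≠ 0) : H.site q ∈ H.supp E := ⟨q, rfl, h⟩

theorem supp_add_subset (E F : Pauli Q) : H.supp (E + F) ⊆ H.supp E ∪ H.supp F := by
  rintro u ⟨q, rfl, hq⟩
  by_cases hE : E q = 0
  · exact Or.inr ⟨q, rfl, by simpa [hE] using hq⟩
  · exact Or.inl ⟨q, rfl, hE⟩

@[simp] theorem supp_zero : H.supp 0 = ∅ := by
  ext u; simp [supp]

open Classical in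
/-- The restriction of a Pauli operator to the qubits located in a region. -/
noncomputable def restr (A : Set (Site D L)) (E : Pauli Q) : Pauli Q :=
  fun q => if H.site q ∈ A then E q else 0

theorem restr_of_mem {A : Set (Site D L)} {E : Pauli Q} {q : Q} (h : H.site q ∈ A) :
    H.restr A E q = E q := if_pos h

theorem restr_of_notMem {A : Set (Site D L)} {E : Pauli Q} {q : Q} (h : H.site q ∉ A) :
    H.restr A E q = 0 := if_neg h

theorem supp_restr (A : Set (Site D L)) (E : Pauli Q) : H.supp (H.restr A E) = A ∩ H.supp E := by
  ext u
  constructor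
  · rintro ⟨q, rfl, hq⟩
    by_cases h : H.site q ∈ A
    · rw [H.restr_of_mem h] at hq
      exact ⟨h, q, rfl, hq⟩
    · exact absurd (H.restr_of_notMem h) hq
  · rintro ⟨h, q, rfl, hq⟩
    exact ⟨q, rfl, by rwa [H.restr_of_mem h]⟩

theorem restr_add_compl (A : Set (Site D L)) (E : Pauli Q) :
    H.restr A E + H.restr Aᶜ E = E := by
  funext q
  by_cases h : H.site q ∈ A
  · have h' : H.site q ∉ Aᶜ := by simpa using h
    simp [H.restr_of_mem h, H.restr_of_notMem h']
  · have h' : H.site q ∈ Aᶜ := h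
    simp [H.restr_of_mem h', H.restr_of_notMem h]

/-- A cluster created by an operator enclosed by a cube of linear size `ℓ`. -/
def Neut (ℓ : ℕ) (c : ι → ZMod 2) : Prop :=
  ∃ P : Pauli Q, EnclosedBy ℓ (H.supp P) ∧ H.syn P = c

/-- The diameter of the set of corners of a cluster is at most `δ`. -/
def DiamLE (c : ι → ZMod 2) (δ : ℕ) : Prop :=
  ∀ a b, c a ≠ 0 → c b ≠ 0 → siteDist (H.corner a) (H.corner b) ≤ δ

/-- A quantitative form of the second topological order condition and the no-strings rule: if an
enclosed operator creates two clusters of diameter at most `δ` further apart than `K (δ + 1)`, then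
each of them can be created in its own neighbourhood. -/
def StringFree (ℓ K : ℕ) : Prop :=
  ∀ (P : Pauli Q) (c₁ c₂ : ι → ZMod 2) (δ : ℕ), EnclosedBy ℓ (H.supp P) → H.syn P = c₁ + c₂ →
    H.DiamLE c₁ δ → H.DiamLE c₂ δ →
    (∀ a b, c₁ a ≠ 0 → c₂ b ≠ 0 → K * (δ + 1) < siteDist (H.corner a) (H.corner b)) →
    ∃ O : Pauli Q, H.syn O = c₁ ∧
      ∀ u ∈ H.supp O, ∃ a, c₁ a ≠ 0 ∧ siteDist u (H.corner a) ≤ K * (δ + 1)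

/-- With an empty second cluster the separation condition is vacuous, so string-freeness contains
the local creation of neutral clusters. -/
theorem StringFree.create {H : CodeHamiltonian D L Q ι} {ℓ K : ℕ} (hs : H.StringFree ℓ K)
    {c : ι → ZMod 2} {δ : ℕ} (hc : H.Neut ℓ c) (hd : H.DiamLE c δ) :
    ∃ O : Pauli Q, H.syn O = c ∧
      ∀ u ∈ H.supp O, ∃ a, c a ≠ 0 ∧ siteDist u (H.corner a) ≤ K * (δ + 1) := by
  obtain ⟨P, hP, hPc⟩ := hc
  exact hs P c 0 δ hP (by rw [hPc, add_zero]) hd (fun a b h => absurd rfl h)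
    (fun a b _ h => absurd rfl h)

end CodeHamiltonian
end PauliCode

/-! ### Costs of covers by balls, the barrier property and its base case. -/

namespace PauliCode

theorem exists_level_avoiding {β : Type*} (T : Finset ℤ) (s : Finset β) (lo hi : β → ℤ)
    (h : ∑ b ∈ s, ((Finset.Icc (lo b) (hi b)).card : ℝ) < T.card) :
    ∃ t ∈ T, ∀ b ∈ s, t < lo b ∨ hi b < t := by
  classical
  by_contra hc
  push Not at hc
  have hsub : T ⊆ s.biUnion fun b => Finset.Icc (lo b) (hi b) := by
    intro t ht
    obtain ⟨b, hb, h1, h2⟩ := hc t ht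
    exact Finset.mem_biUnion.2 ⟨b, hb, Finset.mem_Icc.2 ⟨h1, h2⟩⟩
  have h1 := (Finset.card_le_card hsub).trans Finset.card_biUnion_le
  have h2 : (T.card : ℝ) ≤ ∑ b ∈ s, ((Finset.Icc (lo b) (hi b)).card : ℝ) := by exact_mod_cast h1
  linarith

/-- The cost of a box relative to that of a site; boxes of positive radius have radius at least
the unit of length. -/
noncomputable def costFactor : ℝ := 10 ^ 6

/-- The cost of a ball of radius `w`; a single site costs `1`. -/
noncomputable def boxCost (u : ℕ) (s : ℝ) (w : ℕ) : ℝ :=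
  if w = 0 then 1 else costFactor * ((w : ℝ) / u) ^ (1 + s)

theorem boxCost_zero (u : ℕ) (s : ℝ) : boxCost u s 0 = 1 := if_pos rfl

theorem boxCost_nonneg (u : ℕ) (s : ℝ) (w : ℕ) : 0 ≤ boxCost u s w := by
  unfold boxCost costFactor
  split_ifs
  · norm_num
  · positivity

theorem rpow_one_add {x s : ℝ} (hx : 0 ≤ x) (hs : 0 < s) : x ^ (1 + s) = x * x ^ s := by
  rcases hx.eq_or_lt with rfl | h
  · rw [Real.zero_rpow (by linarith), zero_mul]
  · rw [Real.rpow_add h, Real.rpow_one]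

theorem boxCost_of_le {u : ℕ} {s : ℝ} {w : ℕ} (hu : 1 ≤ u) (hw : u ≤ w) :
    boxCost u s w = costFactor * ((w : ℝ) / u) ^ (1 + s) := if_neg (by omega)

/-- Since s > 0 and w ≥ u, the cost is at least linear in the radius. Large balls therefore block
few heights per unit of cost. -/
theorem le_boxCost {u : ℕ} {s : ℝ} {w : ℕ} (hs : 0 < s) (hu : 1 ≤ u) (hw : u ≤ w) :
    (w : ℝ) ≤ u / costFactor * boxCost u s w := by
  have hu' : (0 : ℝ) < u := by exact_mod_cast hu
  have hw' : (u : ℝ) ≤ w := by exact_mod_cast hw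
  have h1 : (1 : ℝ) ≤ (w : ℝ) / u := by rw [le_div_iff₀ hu']; linarith
  rw [boxCost_of_le hu hw, rpow_one_add (by positivity) hs]
  have h2 : (1 : ℝ) ≤ ((w : ℝ) / u) ^ s := Real.one_le_rpow h1 hs.le
  have hc : costFactor ≠ 0 := by norm_num [costFactor]
  have : (u : ℝ) / costFactor * (costFactor * (w / u * ((w : ℝ) / u) ^ s))
      = w * ((w : ℝ) / u) ^ s := by
    field_simp
  rw [this]
  exact le_mul_of_one_le_right (by positivity) h2

section Cover
variable {D L : ℕ}

/-- The radii of a family of balls are zero or at least the unit of length. -/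
def Sized (u : ℕ) (B : Finset (Site D L × ℕ)) : Prop := ∀ b ∈ B, b.2 = 0 ∨ u ≤ b.2

/-- A family of balls covers a region. -/
def Covers (B : Finset (Site D L × ℕ)) (A : Set (Site D L)) : Prop :=
  ∀ v ∈ A, ∃ b ∈ B, siteDist v b.1 ≤ b.2

/-- The total cost of a family of balls. -/
noncomputable def cost (u : ℕ) (s : ℝ) (B : Finset (Site D L × ℕ)) : ℝ :=
  ∑ b ∈ B, boxCost u s b.2

theorem cost_nonneg (u : ℕ) (s : ℝ) (B : Finset (Site D L × ℕ)) : 0 ≤ cost u s B :=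
  Finset.sum_nonneg fun _ _ => boxCost_nonneg _ _ _

theorem cost_mono {u : ℕ} {s : ℝ} {B B' : Finset (Site D L × ℕ)} (h : B ⊆ B') :
    cost u s B ≤ cost u s B' :=
  Finset.sum_le_sum_of_subset_of_nonneg h fun _ _ _ => boxCost_nonneg _ _ _

open Classical in
theorem cost_union_le (u : ℕ) (s : ℝ) (B B' : Finset (Site D L × ℕ)) :
    cost u s (B ∪ B') ≤ cost u s B + cost u s B' := by
  unfold cost
  rw [← Finset.sum_union_inter]
  linarith [Finset.sum_nonneg fun b (_ : b ∈ B ∩ B') => boxCost_nonneg u s b.2]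

end Cover

namespace CodeHamiltonian
variable {D L : ℕ} {Q ι : Type} [Fintype Q] (H : CodeHamiltonian D L Q ι)

open Classical in
/-- The part of a cluster at height at most `t`. -/
noncomputable def below (h : Site D L → ℤ) (t : ℤ) (c : ι → ZMod 2) : ι → ZMod 2 :=
  fun a => if h (H.corner a) ≤ t then c a else 0

/-- An operator whose defects below height `T` have height at most `0` and which is covered cheaply
between these heights creates a neutral cluster at height at most `0`. -/
def Barrier (ℓ u : ℕ) (s : ℝ) (T : ℕ) : Prop :=
  ∀ (F : Pauli Q) (B : Finset (Site D L × ℕ)) (h : Site D L → ℤ), Lip h → Sized u B →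
    EnclosedBy ℓ {v | h v ≤ T} →
    (∀ a, H.syn F a ≠ 0 → h (H.corner a) ≤ 0 ∨ T ≤ h (H.corner a)) →
    Covers B {v | v ∈ H.supp F ∧ 0 ≤ h v ∧ h v ≤ T} →
    cost u s B < ((T : ℝ) / u) ^ (1 + s) →
    ∃ P : Pauli Q, H.supp P ⊆ {v | h v ≤ T} ∧ H.syn P = H.below h 0 (H.syn F)

theorem Lip.abs_le {h : Site D L → ℤ} (hh : Lip h) {u v : Site D L} {n : ℕ}
    (hd : siteDist u v ≤ n) : h u ≤ h v + n ∧ h v ≤ h u + n := by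
  have h1 := hh u v
  rw [_root_.abs_le] at h1
  have : (siteDist u v : ℤ) ≤ n := by exact_mod_cast hd
  constructor <;> linarith [h1.1, h1.2]

/-- Here T/u is bounded by a multiple of the number of available heights per unit of cost, so some
pair of adjacent heights t, t + 1 carries no support. Truncating the operator at t creates no new
defects. -/
theorem barrier_of_small [NeZero L] {ℓ u : ℕ} {s : ℝ} {T : ℕ} (hs : 0 < s) (hu : 10 ≤ u)
    (hT : ((T : ℝ) / u) ^ s ≤ 2) : H.Barrier ℓ u s T := by
  intro F B h hh hB henc hF hcov hcost
  have hu0 : (0 : ℝ) < u := by exact_mod_cast (by omega : 0 < u)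
  have hTpos : 0 < T := by
    rcases Nat.eq_zero_or_pos T with rfl | h
    · have := cost_nonneg u s B
      rw [Nat.cast_zero, zero_div, Real.zero_rpow (by linarith)] at hcost
      linarith
    · exact h
  have hT0 : (0 : ℝ) < T := by exact_mod_cast hTpos
  -- A ball of radius w spoils the 2w + 2 values of t for which t or t + 1 is a height of the ball.
  -- In total this is less than (2 + 4u/10⁶)(2T/u) = T (4/u + 8/10⁶), which is less than T for u ≥
  -- 10.
  obtain ⟨t, ht, hav⟩ := exists_level_avoiding (Finset.Ico (0 : ℤ) T) B
    (fun b => h b.1 - b.2 - 1) (fun b => h b.1 + b.2) (by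
      have hterm : ∀ b ∈ B, ((Finset.Icc (h b.1 - (b.2 : ℤ) - 1) (h b.1 + b.2)).card : ℝ)
          ≤ (2 + 4 * u / costFactor) * boxCost u s b.2 := by
        intro b hb
        have hcard : ((Finset.Icc (h b.1 - (b.2 : ℤ) - 1) (h b.1 + b.2)).card : ℝ)
            = 2 * b.2 + 2 := by
          rw [Int.card_Icc]
          have : (h b.1 + (b.2 : ℤ) + 1 - (h b.1 - b.2 - 1)).toNat = 2 * b.2 + 2 := by omega
          rw [this]; push_cast; ring
        rw [hcard]
        rcases hB b hb with h0 | h1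
        · rw [h0, boxCost_zero]
          have : 0 ≤ 4 * (u : ℝ) / costFactor := by unfold costFactor; positivity
          push_cast; linarith
        · have h2 := le_boxCost hs (by omega) h1
          have h3 := boxCost_nonneg u s b.2
          have h4 : (1 : ℝ) ≤ b.2 := by exact_mod_cast (by omega : 1 ≤ b.2)
          have : (2 + 4 * u / costFactor) * boxCost u s b.2
            = 2 * boxCost u s b.2 + 4 * (u / costFactor * boxCost u s b.2) := by ring
          rw [this]; linarith
      refine (Finset.sum_le_sum hterm).trans_lt ?_
      rw [← Finset.mul_sum, Int.card_Ico]
      have e1 : (((T : ℤ) - 0).toNat : ℝ) = T := by simp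
      rw [e1]
      have hpos : 0 < 2 + 4 * (u : ℝ) / costFactor := by unfold costFactor; positivity
      refine (mul_lt_mul_of_pos_left hcost hpos).trans_le ?_
      rw [rpow_one_add (by positivity) hs]
      have : (T : ℝ) / u * ((T : ℝ) / u) ^ s ≤ T / u * 2 :=
        mul_le_mul_of_nonneg_left hT (by positivity)
      refine (mul_le_mul_of_nonneg_left this hpos.le).trans ?_
      have hu10 : (10 : ℝ) ≤ u := by exact_mod_cast hu
      unfold costFactor
      have : (2 + 4 * (u : ℝ) / 10 ^ 6) * (T / u * 2) = T * (4 / u + 8 / 10 ^ 6) := by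
        field_simp
        try ring
      rw [this]
      have : (4 : ℝ) / u ≤ 4 / 10 := by gcongr
      nlinarith)
  rw [Finset.mem_Ico] at ht
  -- Two empty heights are needed: the qubits of one term have heights within 1 of its corner, so no
  -- term meets the support both below t and above t + 1.
  have hgap : ∀ v ∈ H.supp F, h v ≠ t ∧ h v ≠ t + 1 := by
    intro v hv
    by_contra hc
    have hr : 0 ≤ h v ∧ h v ≤ T := by
      by_cases h1 : h v = t
      · omega
      · by_cases h2 : h v = t + 1
        · omega
        · exact absurd ⟨h1, h2⟩ hc
    obtain ⟨b, hb, hvb⟩ := hcov v ⟨hv, hr⟩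
    have := Lip.abs_le hh hvb
    have := hav b hb
    by_cases h1 : h v = t
    · omega
    · by_cases h2 : h v = t + 1
      · omega
      · exact absurd ⟨h1, h2⟩ hc
  refine ⟨H.restr {v | h v ≤ t} F, ?_, ?_⟩
  · rw [supp_restr]
    intro v hv
    have : h v ≤ t := hv.1
    show h v ≤ T
    omega
  · funext a
    have hloc : ∀ q, siteDist (H.site q) (H.corner a) ≤ 1 → h (H.site q) ≤ h (H.corner a) + 1 ∧
        h (H.corner a) ≤ h (H.site q) + 1 := fun q hq => by
      have := Lip.abs_le hh hq; exact_mod_cast this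
    unfold below
    split_ifs with ha
    · refine H.syn_congr fun q hq => ?_
      by_cases hm : h (H.site q) ≤ t
      · exact H.restr_of_mem hm
      · rw [H.restr_of_notMem hm]
        by_contra hq0
        have := hgap _ (H.mem_supp (Ne.symm hq0))
        have := hloc q hq
        omega
    · by_cases hat : h (H.corner a) ≤ t
      · have : H.syn F a = 0 := by
          by_contra h0
          have := hF a h0
          omega
        rw [← this]
        refine H.syn_congr fun q hq => ?_
        by_cases hm : h (H.site q) ≤ t
        · exact H.restr_of_mem hm
        · rw [H.restr_of_notMem hm]
          by_contra hq0
          have := hgap _ (H.mem_supp (Ne.symm hq0))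
          have := hloc q hq
          omega
      · refine H.syn_eq_zero fun q hq => ?_
        by_cases hm : h (H.site q) ≤ t
        · rw [H.restr_of_mem hm]
          by_contra hq0
          have := hgap _ (H.mem_supp hq0)
          have := hloc q hq
          omega
        · exact H.restr_of_notMem hm

end CodeHamiltonian
end PauliCode

/-! ### Clumps of defects and the concave potential. -/

namespace PauliCode

/-- With x = b/a ≤ 1, Bernoulli gives (1 + kx)^σ ≤ 1 + σkx ≤ 1 + x ≤ 1 + x^σ. The small exponent
absorbs the gap between merged clumps. -/
theorem rpow_add_mul_le {a b k σ : ℝ} (hb : 0 < b) (hba : b ≤ a) (hk : 0 ≤ k) (hσ : 0 < σ)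
    (hσ1 : σ ≤ 1) (hkσ : σ * k ≤ 1) : (a + k * b) ^ σ ≤ a ^ σ + b ^ σ := by
  have ha : 0 < a := hb.trans_le hba
  have hx0 : 0 < b / a := div_pos hb ha
  have hx1 : b / a ≤ 1 := (div_le_one ha).2 hba
  have e1 : a + k * b = a * (1 + k * (b / a)) := by field_simp
  have e2 : a ^ σ + b ^ σ = a ^ σ * (1 + (b / a) ^ σ) := by
    rw [mul_add, mul_one, ← Real.mul_rpow ha.le hx0.le, mul_div_cancel₀ _ ha.ne']
  rw [e1, e2, Real.mul_rpow ha.le (by positivity)]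
  refine mul_le_mul_of_nonneg_left ?_ (by positivity)
  have hkx : 0 ≤ k * (b / a) := by positivity
  have h1 : (1 + k * (b / a)) ^ σ ≤ 1 + σ * (k * (b / a)) :=
    rpow_one_add_le_one_add_mul_self (by linarith) hσ.le hσ1
  have h2 : b / a ≤ (b / a) ^ σ := by
    simpa using Real.rpow_le_rpow_of_exponent_ge hx0 hx1 hσ1
  have h3 : σ * (k * (b / a)) ≤ b / a := by
    calc σ * (k * (b / a)) = (σ * k) * (b / a) := by ring
      _ ≤ 1 * (b / a) := mul_le_mul_of_nonneg_right hkσ hx0.le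
      _ = b / a := one_mul _
  linarith

-- No element of B touches two members of the family, so the sums run over disjoint parts of B. The
-- members are compared through decompositions of the multiset, which also treats repeated members
-- as distinct.
open Classical in
theorem sum_touch_le {β γ : Type*} (touch : β → γ → Prop) (w : β → ℝ) (hw : ∀ b, 0 ≤ w b)
    (G : Multiset γ) : ∀ B : Finset β,
    (∀ g g' rest, G = g ::ₘ g' ::ₘ rest → ∀ b ∈ B, ¬(touch b g ∧ touch b g')) →
    (G.map fun g => ∑ b ∈ B.filter (touch · g), w b).sum ≤ ∑ b ∈ B, w b := by
  induction G using Multiset.induction_on with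
  | empty => intro B _; simpa using Finset.sum_nonneg fun b _ => hw b
  | cons g G ih =>
    intro B hB
    rw [Multiset.map_cons, Multiset.sum_cons, ← Finset.sum_filter_add_sum_filter_not B (touch · g)]
    refine add_le_add le_rfl ?_
    have key : (G.map fun g' => ∑ b ∈ B.filter (touch · g'), w b)
        = G.map fun g' => ∑ b ∈ (B.filter fun b => ¬ touch b g).filter (touch · g'), w b := by
      refine Multiset.map_congr rfl fun g' hg' => ?_
      obtain ⟨rest, hrest⟩ := Multiset.exists_cons_of_mem hg'
      congr 1
      rw [Finset.filter_filter]
      refine Finset.filter_congr fun b hb => ?_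
      have := hB g g' rest (by rw [hrest]) b hb
      tauto
    rw [key]
    refine ih _ fun g₁ g₂ rest h b hb => ?_
    exact hB g₁ g₂ (g ::ₘ rest) (by
      rw [h, Multiset.cons_swap, Multiset.cons_swap g g₂]) b (Finset.mem_filter.1 hb).1

/-- A cluster together with a region containing it and a bound on the diameter of the region. -/
structure Clump (D L : ℕ) (ι : Type) where
  c : ι → ZMod 2
  U : Set (Site D L)
  m : ℕ

namespace Clump
variable {D L : ℕ} {ι : Type}

/-- The union of two clumps at distance at most `r`. -/
def merge (r : ℕ) (a b : Clump D L ι) : Clump D L ι := ⟨a.c + b.c, a.U ∪ b.U, a.m + b.m + r⟩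

/-- The clumps of a family are pairwise further apart than `r`. -/
def Sep (r : ℕ) (G : Multiset (Clump D L ι)) : Prop :=
  ∀ a b rest, G = a ::ₘ b ::ₘ rest → ∀ v ∈ a.U, ∀ w ∈ b.U, r < siteDist v w

/-- Each merger lowers the number of clumps by one, so merging clumps that are too close terminates.
-/
theorem exists_sep (r : ℕ) (Inv : Multiset (Clump D L ι) → Prop)
    (hInv : ∀ a b rest, Inv (a ::ₘ b ::ₘ rest) → (∃ v ∈ a.U, ∃ w ∈ b.U, siteDist v w ≤ r) →
      Inv (merge r a b ::ₘ rest)) (G : Multiset (Clump D L ι)) (hG : Inv G) :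
    ∃ G', Inv G' ∧ Sep r G' := by
  induction hn : Multiset.card G using Nat.strong_induction_on generalizing G with
  | _ n ih =>
    by_cases hs : Sep r G
    · exact ⟨G, hG, hs⟩
    · unfold Sep at hs
      push Not at hs
      obtain ⟨a, b, rest, hGe, v, hv, w, hw, hvw⟩ := hs
      subst hGe
      refine ih _ ?_ (merge r a b ::ₘ rest) (hInv a b rest hG ⟨v, hv, w, hw, hvw⟩) rfl
      rw [← hn]; simp

/-- The truncated potential of a family of clumps. -/
noncomputable def pot (σ : ℝ) (z : ℕ) (G : Multiset (Clump D L ι)) : ℝ :=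
  (G.map fun g => if g.m < z then (g.m : ℝ) ^ σ else 0).sum

theorem pot_cons (σ : ℝ) (z : ℕ) (g : Clump D L ι) (G : Multiset (Clump D L ι)) :
    pot σ z (g ::ₘ G) = (if g.m < z then (g.m : ℝ) ^ σ else 0) + pot σ z G := by
  simp [pot]

theorem pot_add (σ : ℝ) (z : ℕ) (G G' : Multiset (Clump D L ι)) :
    pot σ z (G + G') = pot σ z G + pot σ z G' := by
  simp [pot]

theorem pot_term_nonneg (σ : ℝ) (z : ℕ) (g : Clump D L ι) :
    0 ≤ if g.m < z then (g.m : ℝ) ^ σ else 0 := by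
  split_ifs
  · positivity
  · exact le_rfl

theorem pot_nonneg (σ : ℝ) (z : ℕ) (G : Multiset (Clump D L ι)) : 0 ≤ pot σ z G := by
  refine Multiset.sum_nonneg fun x hx => ?_
  obtain ⟨g, _, rfl⟩ := Multiset.mem_map.1 hx
  exact pot_term_nonneg σ z g

/-- Both diameters are at least θ, so the gap qθ is at most q times the smaller one, and
`rpow_add_mul_le` applies with k = q + 1. -/
theorem pot_merge_le {q θ : ℕ} {σ : ℝ} (hθ : 0 < θ) (hσ : 0 < σ) (hσq : σ * (q + 1) ≤ 1) (z : ℕ)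
    {a b : Clump D L ι} (ha : θ ≤ a.m) (hb : θ ≤ b.m) (G : Multiset (Clump D L ι)) :
    pot σ z (merge (q * θ) a b ::ₘ G) ≤ pot σ z (a ::ₘ b ::ₘ G) := by
  rw [pot_cons, pot_cons, pot_cons, ← add_assoc]
  refine add_le_add ?_ le_rfl
  -- The truncation at z is harmless: a merged clump below z has both its parts below z.
  by_cases hz : (merge (q * θ) a b).m < z
  · have hz' : a.m + b.m + q * θ < z := hz
    rw [if_pos hz, if_pos (by omega), if_pos (by omega)]
    have hσ1 : σ ≤ 1 := by
      have : (0 : ℝ) ≤ σ * q := by positivity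
      linarith
    have key : ∀ x y : ℕ, θ ≤ y → y ≤ x →
        (((x + y + q * θ : ℕ) : ℝ)) ^ σ ≤ (x : ℝ) ^ σ + (y : ℝ) ^ σ := by
      intro x y hy hyx
      have hy0 : (0 : ℝ) < y := by exact_mod_cast hθ.trans_le hy
      have hyx' : (y : ℝ) ≤ x := by exact_mod_cast hyx
      refine le_trans ?_ (rpow_add_mul_le hy0 hyx' (by positivity : (0 : ℝ) ≤ q + 1) hσ hσ1 hσq)
      refine Real.rpow_le_rpow (by positivity) ?_ hσ.le
      have : (θ : ℝ) ≤ y := by exact_mod_cast hy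
      have : (q : ℝ) * θ ≤ q * y := by gcongr
      push_cast; linarith
    show (((a.m + b.m + q * θ : ℕ) : ℝ)) ^ σ ≤ _
    rcases le_total b.m a.m with h | h
    · exact key _ _ hb h
    · rw [add_comm a.m b.m, add_comm ((a.m : ℝ) ^ σ)]
      exact key _ _ ha h
  · rw [if_neg hz]
    exact add_nonneg (pot_term_nonneg σ z a) (pot_term_nonneg σ z b)

end Clump
end PauliCode

/-! ### Cutting an operator in a slab; isolated charged clumps are expensive. -/

namespace PauliCode
open CodeHamiltonian

variable {D L : ℕ} {Q ι : Type} [Fintype Q]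

/-- An operator without defects in the range `a < h < a + N` of a height function, covered there
by balls. -/
structure Slab (H : CodeHamiltonian D L Q ι) where
  F : Pauli Q
  B : Finset (Site D L × ℕ)
  h : Site D L → ℤ
  a : ℤ
  N : ℕ
  ℓ : ℕ
  K : ℕ
  u : ℕ
  q : ℕ
  E : ℕ
  s : ℝ
  lip : Lip h
  sized : Sized u B
  covers : Covers B {v | v ∈ H.supp F ∧ a ≤ h v ∧ h v ≤ a + N}
  nodef : ∀ x, H.syn F x ≠ 0 → h (H.corner x) ≤ a ∨ a + N ≤ h (H.corner x)
  enc : ∀ S : Set (Site D L), (∀ v ∈ S, a ≤ h v ∧ h v ≤ a + N) →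
    (∀ v ∈ S, ∀ w ∈ S, siteDist v w ≤ E) → EnclosedBy ℓ S
  free : H.StringFree ℓ K
  s_pos : 0 < s
  s_le : s ≤ 1
  le_u : 100 ≤ u
  le_q : 4 * (2 * K + 1) ≤ q
  dvd_q : 4 ∣ q

namespace Slab
variable {H : CodeHamiltonian D L Q ι} (S : Slab H)

/-- The exponent of the potential. -/
noncomputable def σ : ℝ := 1 / (S.q + 2)

/-- The part of the operator above height `t`. -/
noncomputable def upper (t : ℤ) : Pauli Q := H.restr {v | t < S.h v} S.F

/-- The defects created at height `t` by cutting the operator. -/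
noncomputable def cutClus (t : ℤ) : ι → ZMod 2 := H.below S.h (t + 1) (H.syn (S.upper t))

/-- The radius assigned to a ball of the cover. -/
def rad (b : Site D L × ℕ) : ℕ := 30 * b.2 + S.u

open Classical in
/-- The balls of the cover near height `t`. -/
noncomputable def near (t : ℤ) : Finset (Site D L × ℕ) :=
  S.B.filter fun b => |S.h b.1 - t| ≤ 10 * b.2 + 10

open Classical in
/-- The small balls of the cover within `θ` of height `t`. -/
noncomputable def window (θ : ℕ) (t : ℤ) : Finset (Site D L × ℕ) :=
  S.B.filter fun b => 12 * b.2 ≤ θ ∧ |S.h b.1 - t| ≤ θ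

/-- The potential of the balls near height `t` of radius less than `z`. -/
noncomputable def vsum (z : ℕ) (t : ℤ) : ℝ :=
  ∑ b ∈ S.near t, if S.rad b < z then (S.rad b : ℝ) ^ S.σ else 0

variable [NeZero L]

/-- Above height t + 1 the upper part agrees with the full operator near each term, and the full
operator has no defects inside the slab. -/
theorem syn_upper {t : ℤ} (hat : S.a ≤ t) {x : ι} (hx : S.h (H.corner x) < S.a + S.N) :
    H.syn (S.upper t) x = S.cutClus t x := by
  unfold cutClus below
  split_ifs with h1
  · rfl
  · have h2 : H.syn S.F x = 0 := by
      by_contra h0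
      have := S.nodef x h0
      omega
    rw [← h2]
    refine H.syn_congr fun q hq => H.restr_of_mem ?_
    have := Lip.abs_le S.lip hq
    show t < S.h (H.site q)
    push_cast at this
    omega

/-- A term violated by the upper part has a qubit above t within distance 1 of its corner, which
keeps the defects of the cut within two adjacent heights and next to the support. -/
theorem cutClus_ne_zero {t : ℤ} {x : ι} (hx : S.cutClus t x ≠ 0) :
    t ≤ S.h (H.corner x) ∧ S.h (H.corner x) ≤ t + 1 ∧
      ∃ v ∈ H.supp S.F, t < S.h v ∧ siteDist v (H.corner x) ≤ 1 := by
  unfold cutClus below at hx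
  split_ifs at hx with h1
  · obtain ⟨v, hv, hvx⟩ := H.exists_supp_of_syn_ne_zero hx
    rw [upper, supp_restr] at hv
    have := Lip.abs_le S.lip hvx
    have hv1 : t < S.h v := hv.1
    push_cast at this
    exact ⟨by omega, h1, v, hv.2, hv1, hvx⟩
  · exact absurd rfl hx

/-- The clump contains its cluster, which is a part of the cut, and lies near height `t`. -/
structure GoodClump (t : ℤ) (g : Clump D L ι) : Prop where
  mem : ∀ x, g.c x ≠ 0 → H.corner x ∈ g.U
  cut : ∀ x, g.c x ≠ 0 → S.cutClus t x ≠ 0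
  diam : ∀ v ∈ g.U, ∀ w ∈ g.U, siteDist v w ≤ g.m
  height : ∀ v ∈ g.U, 2 * |S.h v - t| ≤ g.m
  nonempty : g.U.Nonempty

theorem GoodClump.near_supp {S : Slab H} {t : ℤ} {g : Clump D L ι} (hg : S.GoodClump t g) (x : ι)
    (hx : g.c x ≠ 0) : ∃ v ∈ H.supp S.F, siteDist v (H.corner x) ≤ 1 := by
  obtain ⟨-, -, v, hv, -, h⟩ := S.cutClus_ne_zero (hg.cut x hx)
  exact ⟨v, hv, h⟩

omit [NeZero L] in
theorem GoodClump.merge {S : Slab H} {t : ℤ} {g g' : Clump D L ι} {r : ℕ} (hg : S.GoodClump t g)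
    (hg' : S.GoodClump t g') (h : ∃ v ∈ g.U, ∃ w ∈ g'.U, siteDist v w ≤ r) :
    S.GoodClump t (Clump.merge r g g') := by
  have hor : ∀ x, (Clump.merge r g g').c x ≠ 0 → g.c x ≠ 0 ∨ g'.c x ≠ 0 := by
    intro x hx
    by_contra hc
    push Not at hc
    exact hx (by show g.c x + g'.c x = 0; rw [hc.1, hc.2, add_zero])
  refine ⟨?_, ?_, ?_, ?_, ?_⟩
  · intro x hx
    exact (hor x hx).imp (hg.mem x) (hg'.mem x)
  · intro x hx
    exact (hor x hx).elim (hg.cut x) (hg'.cut x)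
  · obtain ⟨v₀, hv₀, w₀, hw₀, h0⟩ := h
    have key : ∀ v ∈ g.U, ∀ w ∈ g'.U, siteDist v w ≤ g.m + g'.m + r := by
      intro v hv w hw
      have h1 := siteDist_triangle v v₀ w
      have h2 := siteDist_triangle v₀ w₀ w
      have h3 := hg.diam v hv v₀ hv₀
      have h4 := hg'.diam w₀ hw₀ w hw
      omega
    show ∀ v ∈ g.U ∪ g'.U, ∀ w ∈ g.U ∪ g'.U, siteDist v w ≤ g.m + g'.m + r
    rintro v (hv | hv) w (hw | hw)
    · have := hg.diam v hv w hw; omega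
    · exact key v hv w hw
    · rw [siteDist_comm]; exact key w hw v hv
    · have := hg'.diam v hv w hw; omega
  · show ∀ v ∈ g.U ∪ g'.U, 2 * |S.h v - t| ≤ ((g.m + g'.m + r : ℕ) : ℤ)
    rintro v (hv | hv)
    · have := hg.height v hv; push_cast; linarith [Int.natCast_nonneg g'.m, Int.natCast_nonneg r]
    · have := hg'.height v hv; push_cast; linarith [Int.natCast_nonneg g.m, Int.natCast_nonneg r]
  · exact hg.nonempty.mono Set.subset_union_left

omit [NeZero L] in
theorem GoodClump.diamLE {S : Slab H} {t : ℤ} {g : Clump D L ι} (hg : S.GoodClump t g) :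
    H.DiamLE g.c g.m := fun x y hx hy => hg.diam _ (hg.mem x hx) _ (hg.mem y hy)

omit [NeZero L] in
theorem GoodClump.height_of_distTo {S : Slab H} {t : ℤ} {g : Clump D L ι} (hg : S.GoodClump t g)
    {v : Site D L} {n : ℕ} (hv : distTo g.U v ≤ n) : 2 * |S.h v - t| ≤ g.m + 2 * n := by
  obtain ⟨w, hw, hvw⟩ := exists_distTo hg.nonempty v
  have h1 := hg.height w hw
  have h2 := S.lip v w
  have h3 : |S.h v - t| ≤ |S.h v - S.h w| + |S.h w - t| := abs_sub_le _ _ _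
  have h4 : (siteDist v w : ℤ) ≤ n := by exact_mod_cast hvw ▸ hv
  linarith

omit [Fintype Q] [NeZero L] in
theorem sum_clusters_apply (G : Multiset (Clump D L ι)) (x : ι) :
    (G.map Clump.c).sum x = (G.map fun g => g.c x).sum := by
  induction G using Multiset.induction_on with
  | empty => simp
  | cons g G ih => simp [ih]

/-- A charged clump isolated from the others is crossed at high cost. -/
theorem charged_cost {t : ℤ} {G : Multiset (Clump D L ι)} {O : Pauli Q} {g : Clump D L ι}
    {rest : Multiset (Clump D L ι)} {r T : ℕ} {Bg : Finset (Site D L × ℕ)}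
    (hsum : (G.map Clump.c).sum + H.syn O = S.cutClus t) (hGe : G = g ::ₘ rest)
    (hgood : ∀ g ∈ G, S.GoodClump t g)
    (hsep : Clump.Sep r G) (hT : T ≤ r) (hbar : H.Barrier S.ℓ S.u S.s T) (hch : ¬ H.Neut S.ℓ g.c)
    (hta : S.a + S.E ≤ t) (htN : t + S.E ≤ S.a + S.N) (hE : g.m + 2 * T < S.E)
    (hsz : Sized S.u Bg)
    (hcov : ∀ v ∈ H.supp (S.upper t + O), distTo g.U v ≤ T → ∃ b ∈ Bg, siteDist v b.1 ≤ b.2) :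
    ((T : ℝ) / S.u) ^ (1 + S.s) ≤ cost S.u S.s Bg := by
  by_contra hlt
  push Not at hlt
  have hg := hgood g (by rw [hGe]; exact Multiset.mem_cons_self _ _)
  have hrange : ∀ v, distTo g.U v ≤ T → S.a ≤ S.h v ∧ S.h v < S.a + S.N := by
    intro v hv
    have := hg.height_of_distTo hv
    have h2 : |S.h v - t| < S.E := by omega
    rw [abs_lt] at h2
    omega
  have hdiam : ∀ v, distTo g.U v ≤ T → ∀ w, distTo g.U w ≤ T → siteDist v w ≤ S.E := by
    intro v hv w hw
    obtain ⟨v', hv', e1⟩ := exists_distTo hg.nonempty v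
    obtain ⟨w', hw', e2⟩ := exists_distTo hg.nonempty w
    have h1 := siteDist_triangle v v' w
    have h2 := siteDist_triangle v' w' w
    have h3 := hg.diam v' hv' w' hw'
    rw [siteDist_comm] at e2
    omega
  have henc : EnclosedBy S.ℓ {v : Site D L | (distTo g.U v : ℤ) ≤ T} := by
    refine S.enc _ (fun v hv => ?_) (fun v hv w hw => ?_)
    · have hv' : distTo g.U v ≤ T := by exact_mod_cast hv
      have := hrange v hv'
      omega
    · have hv' : distTo g.U v ≤ T := by exact_mod_cast hv
      have hw' : distTo g.U w ≤ T := by exact_mod_cast hw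
      exact hdiam v hv' w hw'
  -- Inside the slab the repaired upper part creates the sum of the clumps, since the repair cancels
  -- modulo 2. The other clumps are further than r ≥ T away, so only g is seen here.
  have hsyn : ∀ x, distTo g.U (H.corner x) ≤ T → H.syn (S.upper t + O) x = g.c x := by
    intro x hx
    have h1 := S.syn_upper (by omega : S.a ≤ t) (hrange _ hx).2
    have h2 : H.syn (S.upper t + O) = H.syn (S.upper t) + H.syn O := H.syn_add _ _
    rw [h2, Pi.add_apply, h1, ← hsum, hGe, Multiset.map_cons, Multiset.sum_cons]
    have h3 : (rest.map Clump.c).sum x = 0 := by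
      rw [sum_clusters_apply]
      refine Multiset.sum_eq_zero fun y hy => ?_
      obtain ⟨g', hg', rfl⟩ := Multiset.mem_map.1 hy
      by_contra h0
      obtain ⟨rest', hr'⟩ := Multiset.exists_cons_of_mem hg'
      have hx' := (hgood g' (by rw [hGe]; exact Multiset.mem_cons_of_mem hg')).mem x h0
      obtain ⟨v, hv, e1⟩ := exists_distTo hg.nonempty (H.corner x)
      have := hsep g g' rest' (by rw [hGe, hr']) v hv _ hx'
      rw [siteDist_comm] at this
      omega
    have h4 : ∀ y z : ZMod 2, y + z + z = y := by decide
    simp only [Pi.add_apply, h3, add_zero]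
    exact h4 _ _
  -- The barrier is used with the distance to the clump as height. Its defects at height 0 form the
  -- clump, and there are none at heights between 1 and T.
  obtain ⟨P, hP, hPs⟩ := hbar (S.upper t + O) Bg (fun v => (distTo g.U v : ℤ))
    (lip_distTo hg.nonempty) hsz henc (by
      intro x hx
      by_cases hd : distTo g.U (H.corner x) ≤ T
      · rw [hsyn x hd] at hx
        left
        have := distTo_eq_zero (hg.mem x hx)
        simp [this]
      · right
        have : T ≤ distTo g.U (H.corner x) := by omega
        exact_mod_cast this)
    (by
      rintro v ⟨hv, -, hv2⟩
      exact hcov v hv (by exact_mod_cast hv2)) hlt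
  refine hch ⟨P, ?_, ?_⟩
  · obtain ⟨x, hx⟩ := henc
    exact ⟨x, hP.trans hx⟩
  · rw [hPs]
    funext x
    unfold below
    split_ifs with h0
    · have h1 : (distTo g.U (H.corner x) : ℤ) ≤ 0 := h0
      exact hsyn x (by omega)
    · by_contra hc
      have := distTo_eq_zero (hg.mem x (Ne.symm hc))
      simp [this] at h0

end Slab
end PauliCode

/-! ### Dropping neutral clumps and counting charged ones at one scale. -/

namespace PauliCode
open CodeHamiltonian

variable {D L : ℕ} {Q ι : Type} [Fintype Q]

theorem card_mul_le_sum {γ : Type*} (C : Multiset γ) (f : γ → ℝ) (x : ℝ) :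
    (∀ g ∈ C, x ≤ f g) → (Multiset.card C : ℝ) * x ≤ (C.map f).sum := by
  induction C using Multiset.induction_on with
  | empty => simp
  | cons g C ih =>
    intro h
    have h1 := h g (Multiset.mem_cons_self _ _)
    have h2 := ih fun g hg => h g (Multiset.mem_cons_of_mem hg)
    rw [Multiset.card_cons, Multiset.map_cons, Multiset.sum_cons]
    push_cast; linarith

namespace Slab
variable {H : CodeHamiltonian D L Q ι} (S : Slab H)

/-- The ratio between the radius of a ball in which a neutral clump can be created and the diameter
of the clump. -/
def spread : ℕ := 2 * S.K + 1

theorem σ_pos : 0 < S.σ := by unfold σ; positivity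

theorem σ_mul_le : S.σ * (S.q + 1) ≤ 1 := by
  unfold σ
  rw [one_div, inv_mul_le_iff₀ (by positivity)]; linarith

theorem σ_le_one : S.σ ≤ 1 := by
  have h1 := S.σ_mul_le
  have h2 := S.σ_pos
  have : 0 ≤ S.σ * S.q := by positivity
  linarith

/-- The state of the coarse-graining of the cut at height `t` after the length scale `θ` has been
reached: a family `G` of clumps, and an operator `O`, covered by the balls `Dr`, that creates the
clumps dropped so far. -/
structure State (t : ℤ) (θ : ℕ) (G : Multiset (Clump D L ι)) (O : Pauli Q)
    (Dr : Finset (Site D L × ℕ)) (X Y : ℝ) : Prop where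
  sum : (G.map Clump.c).sum + H.syn O = S.cutClus t
  good : ∀ g ∈ G, S.GoodClump t g
  le_m : ∀ g ∈ G, θ ≤ g.m
  balls : ∀ b ∈ S.near t, S.rad b < θ ∨
    ∃ g ∈ G, S.rad b ≤ g.m ∧ ∀ v, siteDist v b.1 ≤ b.2 → v ∈ g.U
  covers : Covers Dr (H.supp O)
  dropped : ∀ b ∈ Dr, S.u ≤ b.2 ∧ b.2 ≤ S.spread * θ
  cost_le : cost S.u S.s Dr ≤ Y
  height : ∀ v ∈ H.supp O, |S.h v - t| ≤ S.spread * θ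
  near_supp : ∀ v ∈ H.supp O, ∃ w ∈ H.supp S.F, siteDist v w ≤ S.spread * θ
  pot_le : ∀ z, Clump.pot S.σ z G ≤ S.vsum z t + X

variable {S}

/-- String-freeness creates a clump within K(m + 1) of its defects, hence within K(m + 1) + m of any
of its points. For m ≥ 1 this is at most (2K + 1) m. -/
theorem spread_bound {m θ : ℕ} (hm : 1 ≤ m) (hmθ : m ≤ θ) :
    S.K * (m + 1) + m ≤ S.spread * m ∧ S.spread * m ≤ S.spread * θ ∧
      S.K * (m + 1) + 1 ≤ S.spread * m := by
  have e : S.spread * m = 2 * (S.K * m) + m := by unfold spread; ring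
  have h1 : S.K ≤ S.K * m := Nat.le_mul_of_pos_right _ hm
  rw [e, mul_add, mul_one]
  refine ⟨by omega, ?_, by omega⟩
  rw [← e]; exact Nat.mul_le_mul_left _ hmθ

/-- The neutral clumps are created independently, each within a ball of radius `spread * m` about
one of its points. The product of these operators repairs all of them at once. -/
theorem exists_drop [NeZero L] {t : ℤ} {θ : ℕ} (hu : 1 ≤ S.u) (N : Multiset (Clump D L ι)) :
    (∀ g ∈ N, S.GoodClump t g) → (∀ g ∈ N, H.Neut S.ℓ g.c) →
    (∀ g ∈ N, S.u ≤ g.m ∧ g.m ≤ θ) →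
    ∃ (O : Pauli Q) (Dr : Finset (Site D L × ℕ)), H.syn O = (N.map Clump.c).sum ∧
      Covers Dr (H.supp O) ∧ (∀ b ∈ Dr, S.u ≤ b.2 ∧ b.2 ≤ S.spread * θ) ∧
      cost S.u S.s Dr ≤ (N.map fun g => boxCost S.u S.s (S.spread * g.m)).sum ∧
      (∀ v ∈ H.supp O, |S.h v - t| ≤ S.spread * θ) ∧
      (∀ v ∈ H.supp O, ∃ w ∈ H.supp S.F, siteDist v w ≤ S.spread * θ) := by
  classical
  induction N using Multiset.induction_on with
  | empty =>
    intro _ _ _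
    exact ⟨0, ∅, by simp, by intro v hv; simp at hv, by simp, by simp [cost], by simp, by simp⟩
  | cons g N ih =>
    intro hgood hne hm
    obtain ⟨O, Dr, h1, h2, h3, h4, h5, h6⟩ := ih
      (fun g hg => hgood g (Multiset.mem_cons_of_mem hg))
      (fun g hg => hne g (Multiset.mem_cons_of_mem hg))
      (fun g hg => hm g (Multiset.mem_cons_of_mem hg))
    have hg := hgood g (Multiset.mem_cons_self _ _)
    obtain ⟨hm1, hm2⟩ := hm g (Multiset.mem_cons_self _ _)
    obtain ⟨O', hO', hO'2⟩ := S.free.create (hne g (Multiset.mem_cons_self _ _)) hg.diamLE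
    obtain ⟨x, hx⟩ := hg.nonempty
    obtain ⟨b1, b2, b3⟩ := spread_bound (S := S) (hu.trans hm1) hm2
    have hum : S.u ≤ S.spread * g.m := by
      have : g.m ≤ S.spread * g.m := by omega
      omega
    refine ⟨O' + O, insert (x, S.spread * g.m) Dr, ?_, ?_, ?_, ?_, ?_, ?_⟩
    · rw [syn_add, hO', h1, Multiset.map_cons, Multiset.sum_cons]
    · intro v hv
      rcases H.supp_add_subset _ _ hv with hv | hv
      · obtain ⟨y, hy, hvy⟩ := hO'2 v hv
        refine ⟨_, Finset.mem_insert_self _ _, ?_⟩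
        have t1 := siteDist_triangle v (H.corner y) x
        have t2 := hg.diam _ (hg.mem y hy) x hx
        show siteDist v x ≤ S.spread * g.m
        omega
      · obtain ⟨b, hb, hvb⟩ := h2 v hv
        exact ⟨b, Finset.mem_insert_of_mem hb, hvb⟩
    · intro b hb
      rcases Finset.mem_insert.1 hb with rfl | hb
      · exact ⟨hum, b2⟩
      · exact h3 b hb
    · rw [Multiset.map_cons, Multiset.sum_cons]
      have hi : cost S.u S.s (insert (x, S.spread * g.m) Dr)
          ≤ boxCost S.u S.s (S.spread * g.m) + cost S.u S.s Dr := by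
        rw [Finset.insert_eq]
        refine (cost_union_le _ _ _ _).trans (add_le_add ?_ le_rfl)
        simp [cost]
      linarith
    · intro v hv
      rcases H.supp_add_subset _ _ hv with hv | hv
      · obtain ⟨y, hy, hvy⟩ := hO'2 v hv
        have t1 := hg.height _ (hg.mem y hy)
        have t2 := Lip.abs_le S.lip hvy
        have b2' : (S.K * (g.m + 1) + g.m : ℤ) ≤ S.spread * θ := by exact_mod_cast b1.trans b2
        push_cast at t2
        generalize (S.K : ℤ) * (g.m + 1) = k at *
        generalize (S.spread : ℤ) * θ = k' at *
        rw [abs_le]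
        have t3 : |S.h (H.corner y) - t| ≤ g.m := by
          have := abs_nonneg (S.h (H.corner y) - t)
          omega
        rw [abs_le] at t3
        constructor <;> omega
      · exact h5 v hv
    · intro v hv
      rcases H.supp_add_subset _ _ hv with hv | hv
      · obtain ⟨y, hy, hvy⟩ := hO'2 v hv
        obtain ⟨w, hw, hwy⟩ := hg.near_supp y hy
        refine ⟨w, hw, ?_⟩
        have t1 := siteDist_triangle v (H.corner y) w
        rw [siteDist_comm] at hwy
        omega
      · exact h6 v hv

/-- Writing m^(1+s) = m^(1+s-σ) m^σ and bounding the first factor by its value at θ turns the cost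
of dropping a clump into a multiple of its potential. -/
theorem boxCost_spread_le {m θ : ℕ} (hu : 1 ≤ S.u) (hm : S.u ≤ m) (hmθ : m ≤ θ)
    (hs : 0 < S.s) :
    boxCost S.u S.s (S.spread * m) ≤
      costFactor * ((S.spread : ℝ) / S.u) ^ (1 + S.s) * (θ : ℝ) ^ (1 + S.s - S.σ)
        * (m : ℝ) ^ S.σ := by
  have h1 := (spread_bound (S := S) (hu.trans hm) le_rfl).1
  have hm0 : (0 : ℝ) < m := by exact_mod_cast hu.trans hm
  have hu0 : (0 : ℝ) < S.u := by exact_mod_cast hu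
  rw [boxCost_of_le hu (by omega), mul_assoc, mul_assoc]
  refine mul_le_mul_of_nonneg_left ?_ (by norm_num [costFactor])
  have e : ((S.spread * m : ℕ) : ℝ) / S.u = (S.spread : ℝ) / S.u * m := by push_cast; ring
  rw [e, Real.mul_rpow (by positivity) hm0.le]
  refine mul_le_mul_of_nonneg_left ?_ (by positivity)
  have : (m : ℝ) ^ (1 + S.s) = (m : ℝ) ^ (1 + S.s - S.σ) * (m : ℝ) ^ S.σ := by
    rw [← Real.rpow_add hm0]; congr 1; ring
  rw [this]
  refine mul_le_mul_of_nonneg_right ?_ (by positivity)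
  exact Real.rpow_le_rpow hm0.le (by exact_mod_cast hmθ) (by have := S.σ_le_one; linarith)

variable [NeZero L]

-- All bounds of a state survive a merger: the diameter is additive up to the gap, and the potential
-- does not increase.
omit [NeZero L] in
theorem State.merge {t : ℤ} {θ : ℕ} {G : Multiset (Clump D L ι)} {O : Pauli Q}
    {Dr : Finset (Site D L × ℕ)} {X Y : ℝ} (hst : S.State t θ G O Dr X Y) (hθ : 0 < θ) :
    ∃ G', S.State t θ G' O Dr X Y ∧ Clump.Sep (S.q * θ) G' := by
  refine Clump.exists_sep (S.q * θ) (fun G => S.State t θ G O Dr X Y) ?_ G hst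
  intro a b rest h hab
  have ha : a ∈ a ::ₘ b ::ₘ rest := Multiset.mem_cons_self _ _
  have hb : b ∈ a ::ₘ b ::ₘ rest := Multiset.mem_cons_of_mem (Multiset.mem_cons_self _ _)
  have hr : ∀ g ∈ rest, g ∈ a ::ₘ b ::ₘ rest := fun g hg =>
    Multiset.mem_cons_of_mem (Multiset.mem_cons_of_mem hg)
  refine ⟨?_, ?_, ?_, ?_, h.covers, h.dropped, h.cost_le, h.height, h.near_supp, ?_⟩
  · rw [← h.sum]
    simp [Clump.merge, add_assoc]
  · intro g hg
    rcases Multiset.mem_cons.1 hg with rfl | hg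
    · exact (h.good a ha).merge (h.good b hb) hab
    · exact h.good g (hr g hg)
  · intro g hg
    rcases Multiset.mem_cons.1 hg with rfl | hg
    · exact (h.le_m a ha).trans (by show a.m ≤ a.m + b.m + _; omega)
    · exact h.le_m g (hr g hg)
  · intro x hx
    rcases h.balls x hx with h1 | ⟨g, hg, h1, h2⟩
    · exact Or.inl h1
    · right
      rcases Multiset.mem_cons.1 hg with rfl | hg
      · exact ⟨_, Multiset.mem_cons_self _ _, h1.trans (by show g.m ≤ g.m + b.m + _; omega),
          fun v hv => Or.inl (h2 v hv)⟩
      · rcases Multiset.mem_cons.1 hg with rfl | hg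
        · exact ⟨_, Multiset.mem_cons_self _ _, h1.trans (by show g.m ≤ a.m + g.m + _; omega),
            fun v hv => Or.inr (h2 v hv)⟩
        · exact ⟨g, Multiset.mem_cons_of_mem hg, h1, h2⟩
  · intro z
    exact (Clump.pot_merge_le hθ S.σ_pos S.σ_mul_le z (h.le_m a ha) (h.le_m b hb) rest).trans
      (h.pot_le z)

/-- The upper bound for the number of short charged clumps. -/
noncomputable def chargedBound (S : Slab H) (t : ℤ) (θ : ℕ) (Y : ℝ) : ℝ :=
  (4 * S.u / θ) ^ (1 + S.s) * (cost S.u S.s (S.window θ t) + Y)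

/-- By the barrier at T = qθ/4, each short charged clump has in its T-neighbourhood balls of total
cost at least (T/u)^(1+s). These neighbourhoods share no ball, so the number of such clumps is at
most the available cost divided by this quantity. -/
theorem card_charged_le {t : ℤ} {θ : ℕ} {G : Multiset (Clump D L ι)} {O : Pauli Q}
    {Dr : Finset (Site D L × ℕ)} {X Y : ℝ} (hst : S.State t θ G O Dr X Y)
    (hsep : Clump.Sep (S.q * θ) G) (hθ : S.u ≤ θ)
    (hbar : H.Barrier S.ℓ S.u S.s (S.q * θ / 4)) (hE : 2 * (S.q * θ) < S.E)
    (hta : S.a + S.E ≤ t) (htN : t + S.E ≤ S.a + S.N) (C : Multiset (Clump D L ι)) (hCG : C ≤ G)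
    (hC : ∀ g ∈ C, g.m < S.q * θ ∧ ¬ H.Neut S.ℓ g.c) :
    (Multiset.card C : ℝ) ≤ S.chargedBound t (S.q * θ) Y := by
  classical
  have hu := S.le_u
  obtain ⟨q', hq'⟩ := S.dvd_q
  have hT : S.q * θ / 4 = q' * θ := by rw [hq', mul_assoc]; omega
  have hqθ : S.q * θ = 4 * (q' * θ) := by rw [hq', mul_assoc]
  have hq'pos : 0 < q' := by have := S.le_q; omega
  have hTpos : 0 < q' * θ := Nat.mul_pos hq'pos (by omega)
  set T := q' * θ with hTdef
  rw [hT] at hbar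
  have hspr : 4 * (S.spread * θ) ≤ S.q * θ := by
    rw [← mul_assoc]; exact Nat.mul_le_mul_right _ S.le_q
  let touch : Site D L × ℕ → Clump D L ι → Prop := fun b g =>
    ∃ v, siteDist v b.1 ≤ b.2 ∧ distTo g.U v ≤ T
  set Bs := S.window (S.q * θ) t ∪ Dr with hBs
  have hsmall : ∀ b ∈ Bs, 4 * b.2 ≤ S.q * θ := by
    intro b hb
    rcases Finset.mem_union.1 hb with hb | hb
    · have := (Finset.mem_filter.1 hb).2.1; omega
    · have := (hst.dropped b hb).2; omega
  have hsz : Sized S.u Bs := by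
    intro b hb
    rcases Finset.mem_union.1 hb with hb | hb
    · exact S.sized b (Finset.mem_filter.1 hb).1
    · exact Or.inr (hst.dropped b hb).1
  -- All balls have radius at most qθ/4 and the neighbourhoods have radius T = qθ/4. A ball touching
  -- two of them would put the clumps within distance qθ.
  have hsum := sum_touch_le touch (fun b => boxCost S.u S.s b.2) (fun b => boxCost_nonneg _ _ _) C
    Bs (by
      rintro g g' rest hCe b hb ⟨⟨v, hv, hvg⟩, ⟨v', hv', hvg'⟩⟩
      obtain ⟨r, hr⟩ := Multiset.le_iff_exists_add.1 hCG
      have hGe : G = g ::ₘ g' ::ₘ (rest + r) := by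
        rw [hr, hCe, Multiset.cons_add, Multiset.cons_add]
      obtain ⟨y, hy, ey⟩ := exists_distTo
        (hst.good g (by rw [hGe]; exact Multiset.mem_cons_self _ _)).nonempty v
      obtain ⟨y', hy', ey'⟩ := exists_distTo (hst.good g' (by
        rw [hGe]; exact Multiset.mem_cons_of_mem (Multiset.mem_cons_self _ _))).nonempty v'
      have h1 := hsep g g' _ hGe y hy y' hy'
      have h2 := siteDist_triangle y v y'
      have h3 := siteDist_triangle v b.1 y'
      have h4 := siteDist_triangle b.1 v' y'
      have h5 := hsmall b hb
      rw [siteDist_comm] at ey hv'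
      omega)
  have hlow : ∀ g ∈ C, ((T : ℝ) / S.u) ^ (1 + S.s) ≤
      ∑ b ∈ Bs.filter (touch · g), boxCost S.u S.s b.2 := by
    intro g hg
    obtain ⟨rest, hGe⟩ := Multiset.exists_cons_of_mem (Multiset.mem_of_le hCG hg)
    obtain ⟨hgm, hgn⟩ := hC g hg
    have hgg := hst.good g (Multiset.mem_of_le hCG hg)
    refine S.charged_cost hst.sum hGe hst.good hsep (by omega) hbar hgn hta htN (by omega)
      (fun b hb => hsz b (Finset.mem_filter.1 hb).1) ?_
    intro v hv hvg
    suffices hsuff : ∃ b ∈ Bs, siteDist v b.1 ≤ b.2 by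
      obtain ⟨b, hb, hvb⟩ := hsuff
      exact ⟨b, Finset.mem_filter.2 ⟨hb, v, hvb, hvg⟩, hvb⟩
    rcases H.supp_add_subset _ _ hv with hv | hv
    · rw [upper, supp_restr] at hv
      have hh := hgg.height_of_distTo hvg
      have habs : |S.h v - t| ≤ S.E := by omega
      rw [abs_le] at habs
      obtain ⟨b, hb, hvb⟩ := S.covers v ⟨hv.2, by omega, by omega⟩
      have hl := Lip.abs_le S.lip hvb
      have hbt : |S.h b.1 - t| ≤ |S.h v - t| + b.2 := by
        have : |S.h b.1 - t| ≤ |S.h b.1 - S.h v| + |S.h v - t| := abs_sub_le _ _ _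
        have : |S.h b.1 - S.h v| ≤ b.2 := by rw [abs_le]; constructor <;> omega
        linarith
      have hbt' : |S.h v - t| + b.2 ≥ |S.h b.1 - t| := hbt
      -- A ball near the cut is short, or lies in the present clump and is shorter than it, or lies
      -- in another clump and is too far away. A ball not near the cut satisfies 10 w + 10 < |h - t|
      -- ≤ 3qθ/4 + w, which also bounds 12 w by qθ.
      have hw : 12 * b.2 ≤ S.q * θ := by
        by_cases hbn : b ∈ S.near t
        · rcases hst.balls b hbn with h1 | ⟨g', hg', h1, h2⟩
          · unfold rad at h1
            have : θ ≤ S.q * θ := Nat.le_mul_of_pos_left _ (by omega)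
            omega
          · rw [hGe] at hg'
            rcases Multiset.mem_cons.1 hg' with rfl | hg'
            · unfold rad at h1; omega
            · obtain ⟨rest', hr'⟩ := Multiset.exists_cons_of_mem hg'
              obtain ⟨y, hy, ey⟩ := exists_distTo hgg.nonempty v
              have := hsep g g' rest' (by rw [hGe, hr']) y hy v (h2 v hvb)
              rw [siteDist_comm] at this
              omega
        · have : ¬ |S.h b.1 - t| ≤ 10 * b.2 + 10 := fun h =>
            hbn (Finset.mem_filter.2 ⟨hb, h⟩)
          omega
      refine ⟨b, Finset.mem_union_left _ (Finset.mem_filter.2 ⟨hb, hw, ?_⟩), hvb⟩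
      omega
    · obtain ⟨b, hb, hvb⟩ := hst.covers v hv
      exact ⟨b, Finset.mem_union_right _ hb, hvb⟩
  have hcount : (Multiset.card C : ℝ) * ((T : ℝ) / S.u) ^ (1 + S.s) ≤ cost S.u S.s Bs := by
    refine le_trans (card_mul_le_sum C _ _ hlow) (le_trans (le_of_eq ?_) hsum)
    congr!
  have hu0 : (0 : ℝ) < S.u := by exact_mod_cast (by omega : 0 < S.u)
  have hT0 : (0 : ℝ) < T := by exact_mod_cast hTpos
  have hcost : cost S.u S.s Bs ≤ cost S.u S.s (S.window (S.q * θ) t) + Y :=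
    (cost_union_le _ _ _ _).trans (add_le_add le_rfl hst.cost_le)
  unfold chargedBound
  have e : 4 * (S.u : ℝ) / ((S.q * θ : ℕ) : ℝ) = ((T : ℝ) / S.u)⁻¹ := by
    rw [hqθ]; push_cast; field_simp
  rw [e, Real.inv_rpow (by positivity)]
  rw [inv_mul_eq_div, le_div_iff₀ (by positivity)]
  exact hcount.trans hcost

end Slab
end PauliCode

/-! ### One full step of the coarse-graining, and its initial state. -/

namespace PauliCode
open CodeHamiltonian

variable {D L : ℕ} {Q ι : Type} [Fintype Q]

namespace Slab
variable {H : CodeHamiltonian D L Q ι} {S : Slab H}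

theorem sum_map_filter_add {γ M : Type*} [AddCommMonoid M] (G : Multiset γ) (p : γ → Prop)
    [DecidablePred p] (f : γ → M) :
    ((G.filter p).map f).sum + ((G.filter fun g => ¬ p g).map f).sum = (G.map f).sum := by
  rw [← Multiset.sum_add, ← Multiset.map_add, Multiset.filter_add_not]

theorem pot_filter_le (σ : ℝ) (z : ℕ) (G : Multiset (Clump D L ι)) (p : Clump D L ι → Prop)
    [DecidablePred p] : Clump.pot σ z (G.filter p) ≤ Clump.pot σ z G := by
  rw [← Multiset.filter_add_not p G, Clump.pot_add]
  rw [Multiset.filter_add, Multiset.filter_filter]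
  have := Clump.pot_nonneg σ z (G.filter fun g => ¬ p g)
  simp
  exact this

/-- The increment of the bound for the cost of the dropped clumps. -/
noncomputable def dropBound (S : Slab H) (t : ℤ) (θ : ℕ) (X : ℝ) : ℝ :=
  costFactor * ((S.spread : ℝ) / S.u) ^ (1 + S.s) * (θ : ℝ) ^ (1 + S.s - S.σ) * (S.vsum θ t + X)

variable [NeZero L]

/-- After merging, long clumps are kept, short neutral ones are dropped into the repairing operator,
and short charged ones are kept with their nominal diameter raised to the new scale. The last
operation raises the potential by at most (number of charged clumps) · θ'^σ, and dropping costs at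
most a multiple of the potential truncated at θ'. -/
theorem State.step {t : ℤ} {θ : ℕ} {G : Multiset (Clump D L ι)} {O : Pauli Q}
    {Dr : Finset (Site D L × ℕ)} {X Y : ℝ} (hst₀ : S.State t θ G O Dr X Y) (hθ : S.u ≤ θ)
    (hbar : H.Barrier S.ℓ S.u S.s (S.q * θ / 4)) (hE : 2 * (S.q * θ) < S.E)
    (hta : S.a + S.E ≤ t) (htN : t + S.E ≤ S.a + S.N) :
    ∃ G' O' Dr', S.State t (S.q * θ) G' O' Dr'
      (X + S.chargedBound t (S.q * θ) Y * ((S.q * θ : ℕ) : ℝ) ^ S.σ)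
      (Y + S.dropBound t (S.q * θ) X) := by
  classical
  have hu : 1 ≤ S.u := by have := S.le_u; omega
  have hq : 1 ≤ S.q := by have := S.le_q; omega
  obtain ⟨G, hst, hsep⟩ := hst₀.merge (by omega)
  set θ' := S.q * θ with hθ'
  have hθθ' : θ ≤ θ' := Nat.le_mul_of_pos_left _ (by omega)
  set A := G.filter fun g => θ' ≤ g.m with hA
  set Sh := G.filter fun g => ¬ θ' ≤ g.m with hSh
  set Ne := Sh.filter fun g => H.Neut S.ℓ g.c with hNe
  set C := Sh.filter fun g => ¬ H.Neut S.ℓ g.c with hC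
  have hCG : C ≤ G := (Multiset.filter_le _ _).trans (Multiset.filter_le _ _)
  have hmemNe : ∀ g ∈ Ne, g ∈ G ∧ g.m < θ' ∧ H.Neut S.ℓ g.c := by
    intro g hg
    obtain ⟨h1, h2⟩ := Multiset.mem_filter.1 hg
    obtain ⟨h3, h4⟩ := Multiset.mem_filter.1 h1
    exact ⟨h3, by omega, h2⟩
  have hmemC : ∀ g ∈ C, g ∈ G ∧ g.m < θ' ∧ ¬ H.Neut S.ℓ g.c := by
    intro g hg
    obtain ⟨h1, h2⟩ := Multiset.mem_filter.1 hg
    obtain ⟨h3, h4⟩ := Multiset.mem_filter.1 h1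
    exact ⟨h3, by omega, h2⟩
  have hcard := card_charged_le hst hsep hθ hbar hE hta htN C hCG fun g hg => (hmemC g hg).2
  obtain ⟨O', Dr', d1, d2, d3, d4, d5, d6⟩ := exists_drop (S := S) (t := t) (θ := θ') hu Ne
    (fun g hg => hst.good g (hmemNe g hg).1) (fun g hg => (hmemNe g hg).2.2)
    (fun g hg => ⟨hθ.trans (hst.le_m g (hmemNe g hg).1), (hmemNe g hg).2.1.le⟩)
  -- Only the bound on the diameter is enlarged; the cluster and its region are unchanged.
  let f : Clump D L ι → Clump D L ι := fun g => ⟨g.c, g.U, θ'⟩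
  have hspr : S.spread * θ ≤ S.spread * θ' := Nat.mul_le_mul_left _ hθθ'
  refine ⟨A + C.map f, O + O', Dr ∪ Dr', ?_, ?_, ?_, ?_, ?_, ?_, ?_, ?_, ?_, ?_⟩
  · rw [← hst.sum, syn_add, d1, Multiset.map_add, Multiset.sum_add, Multiset.map_map,
      ← sum_map_filter_add G (fun g => θ' ≤ g.m), ← hA, ← hSh,
      ← sum_map_filter_add Sh (fun g => H.Neut S.ℓ g.c), ← hNe, ← hC]
    have : (C.map (Clump.c ∘ f)).sum = (C.map Clump.c).sum := rfl
    rw [this]; abel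
  · intro g hg
    rcases Multiset.mem_add.1 hg with hg | hg
    · exact hst.good g (Multiset.mem_filter.1 hg).1
    · obtain ⟨g', hg', rfl⟩ := Multiset.mem_map.1 hg
      obtain ⟨h1, h2, _⟩ := hmemC g' hg'
      have h3 := hst.good g' h1
      refine ⟨h3.mem, h3.cut, fun v hv w hw => (h3.diam v hv w hw).trans h2.le,
        fun v hv => (h3.height v hv).trans ?_, h3.nonempty⟩
      exact_mod_cast h2.le
  · intro g hg
    rcases Multiset.mem_add.1 hg with hg | hg
    · exact (Multiset.mem_filter.1 hg).2
    · obtain ⟨g', hg', rfl⟩ := Multiset.mem_map.1 hg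
      exact le_rfl
  · intro b hb
    by_cases hr : S.rad b < θ'
    · exact Or.inl hr
    · rcases hst.balls b hb with h1 | ⟨g, hg, h1, h2⟩
      · omega
      · exact Or.inr ⟨g, Multiset.mem_add.2 (Or.inl (Multiset.mem_filter.2 ⟨hg, by omega⟩)),
          h1, h2⟩
  · intro v hv
    rcases H.supp_add_subset _ _ hv with hv | hv
    · obtain ⟨b, hb, h⟩ := hst.covers v hv
      exact ⟨b, Finset.mem_union_left _ hb, h⟩
    · obtain ⟨b, hb, h⟩ := d2 v hv
      exact ⟨b, Finset.mem_union_right _ hb, h⟩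
  · intro b hb
    rcases Finset.mem_union.1 hb with hb | hb
    · exact ⟨(hst.dropped b hb).1, (hst.dropped b hb).2.trans hspr⟩
    · exact d3 b hb
  · refine (cost_union_le _ _ _ _).trans (add_le_add hst.cost_le (d4.trans ?_))
    unfold dropBound
    have h1 : (Ne.map fun g => boxCost S.u S.s (S.spread * g.m)).sum ≤
        (Ne.map fun g => costFactor * ((S.spread : ℝ) / S.u) ^ (1 + S.s)
          * (θ' : ℝ) ^ (1 + S.s - S.σ) * (if g.m < θ' then (g.m : ℝ) ^ S.σ else 0)).sum := by
      refine Multiset.sum_map_le_sum_map _ _ fun g hg => ?_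
      obtain ⟨e1, e2, _⟩ := hmemNe g hg
      rw [if_pos e2]
      exact boxCost_spread_le hu (hθ.trans (hst.le_m g e1)) e2.le S.s_pos
    refine h1.trans ?_
    rw [Multiset.sum_map_mul_left]
    refine mul_le_mul_of_nonneg_left ?_ (by unfold costFactor; positivity)
    -- Only clumps shorter than θ' are dropped, so the potential truncated at θ' suffices. This is
    -- why the bound on the potential is carried for every truncation z.
    refine le_trans ?_ (hst.pot_le θ')
    exact (pot_filter_le S.σ θ' Sh _).trans (pot_filter_le S.σ θ' G _)
  · intro v hv
    rcases H.supp_add_subset _ _ hv with hv | hv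
    · have := hst.height v hv
      have h2 : (S.spread * θ : ℤ) ≤ S.spread * θ' := by exact_mod_cast hspr
      linarith
    · exact d5 v hv
  · intro v hv
    rcases H.supp_add_subset _ _ hv with hv | hv
    · obtain ⟨w, hw, h⟩ := hst.near_supp v hv
      exact ⟨w, hw, h.trans hspr⟩
    · exact d6 v hv
  · intro z
    rw [Clump.pot_add]
    have h1 : Clump.pot S.σ z A ≤ S.vsum z t + X :=
      (pot_filter_le S.σ z G _).trans (hst.pot_le z)
    have h2 : Clump.pot S.σ z (C.map f) ≤ (Multiset.card C : ℝ) * (θ' : ℝ) ^ S.σ := by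
      unfold Clump.pot
      rw [Multiset.map_map]
      have : (Multiset.card C : ℝ) * (θ' : ℝ) ^ S.σ = (C.map fun _ => (θ' : ℝ) ^ S.σ).sum := by
        simp
      rw [this]
      refine Multiset.sum_map_le_sum_map _ _ fun g _ => ?_
      show (if θ' < z then (θ' : ℝ) ^ S.σ else 0) ≤ (θ' : ℝ) ^ S.σ
      split_ifs
      · exact le_rfl
      · positivity
    have h3 : (Multiset.card C : ℝ) * (θ' : ℝ) ^ S.σ ≤ S.chargedBound t θ' Y * (θ' : ℝ) ^ S.σ :=
      mul_le_mul_of_nonneg_right hcard (by positivity)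
    linarith

/-- Every defect of the cut lies next to a ball of the cover near height t. Each ball, enlarged by
1, becomes one clump, and each defect is assigned to just one of these balls. -/
theorem exists_initial_state {t : ℤ} (ht : S.a ≤ t) (htN : t + 3 ≤ S.a + S.N) :
    ∃ G, S.State t S.u G 0 ∅ 0 0 := by
  classical
  have hu := S.le_u
  have hbox : ∀ x, S.cutClus t x ≠ 0 → ∃ b ∈ S.near t, siteDist (H.corner x) b.1 ≤ b.2 + 1 := by
    intro x hx
    obtain ⟨h1, h2, v, hv, hvt, hvx⟩ := S.cutClus_ne_zero hx
    have hl := Lip.abs_le S.lip hvx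
    push_cast at hl
    obtain ⟨b, hb, hvb⟩ := S.covers v ⟨hv, by omega, by omega⟩
    have hl2 := Lip.abs_le S.lip hvb
    refine ⟨b, Finset.mem_filter.2 ⟨hb, ?_⟩, ?_⟩
    · rw [abs_le]; constructor <;> omega
    · have := siteDist_triangle (H.corner x) v b.1
      rw [siteDist_comm] at hvx
      omega
  let sel : ι → Site D L × ℕ := fun x => if hx : S.cutClus t x ≠ 0 then (hbox x hx).choose else
    (0, 0)
  have hsel : ∀ x, S.cutClus t x ≠ 0 →
      sel x ∈ S.near t ∧ siteDist (H.corner x) (sel x).1 ≤ (sel x).2 + 1 := by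
    intro x hx
    have : sel x = (hbox x hx).choose := dif_pos hx
    rw [this]
    exact (hbox x hx).choose_spec
  let f : Site D L × ℕ → Clump D L ι := fun b =>
    ⟨fun x => if sel x = b then S.cutClus t x else 0, {v | siteDist v b.1 ≤ b.2 + 1}, S.rad b⟩
  refine ⟨(S.near t).val.map f, ?_, ?_, ?_, ?_, ?_, ?_, ?_, ?_, ?_, ?_⟩
  · rw [syn_zero, add_zero]
    funext x
    rw [sum_clusters_apply, Multiset.map_map]
    show ∑ b ∈ S.near t, (if sel x = b then S.cutClus t x else 0) = _
    rw [Finset.sum_ite_eq]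
    split_ifs with h
    · rfl
    · by_contra hc
      exact h (hsel x (Ne.symm hc)).1
  · intro g hg
    obtain ⟨b, hb, rfl⟩ := Multiset.mem_map.1 hg
    have hbn := (Finset.mem_filter.1 (show b ∈ S.near t from hb)).2
    refine ⟨?_, ?_, ?_, ?_, ⟨b.1, by simp [f]⟩⟩
    · intro x hx
      by_cases h : sel x = b
      · have hx' : S.cutClus t x ≠ 0 := by simpa [f, h] using hx
        have := (hsel x hx').2
        rw [h] at this
        exact this
      · simp [f, h] at hx
    · intro x hx
      by_cases h : sel x = b
      · have hx' : S.cutClus t x ≠ 0 := by simpa [f, h] using hx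
        exact hx'
      · simp [f, h] at hx
    · intro v hv w hw
      have hv' : siteDist v b.1 ≤ b.2 + 1 := hv
      have hw' : siteDist w b.1 ≤ b.2 + 1 := hw
      have := siteDist_triangle v b.1 w
      rw [siteDist_comm] at hw'
      show siteDist v w ≤ 30 * b.2 + S.u
      omega
    · intro v hv
      have hv' : siteDist v b.1 ≤ b.2 + 1 := hv
      have hl := Lip.abs_le S.lip hv'
      push_cast at hl
      show 2 * |S.h v - t| ≤ ((30 * b.2 + S.u : ℕ) : ℤ)
      rw [abs_le] at hbn
      -- The nearness condition 10w + 10 plus the enlarged radius w + 1; twice this is at most 30w +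
      -- u because u ≥ 100.
      have : |S.h v - t| ≤ 11 * b.2 + 11 := by rw [abs_le]; constructor <;> omega
      push_cast
      omega
  · intro g hg
    obtain ⟨b, hb, rfl⟩ := Multiset.mem_map.1 hg
    show S.u ≤ 30 * b.2 + S.u
    omega
  · intro b hb
    exact Or.inr ⟨f b, Multiset.mem_map_of_mem f hb, le_rfl, fun v hv => by
      show siteDist v b.1 ≤ b.2 + 1; omega⟩
  · intro v hv; simp at hv
  · simp
  · simp [cost]
  · simp
  · simp
  · intro z
    rw [add_zero]
    unfold Clump.pot
    rw [Multiset.map_map]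
    exact le_rfl

end Slab
end PauliCode

/-! ### Averaging the bounds over the height of the cut. -/

namespace PauliCode
open CodeHamiltonian

variable {D L : ℕ} {Q ι : Type} [Fintype Q]

theorem card_filter_abs_le (T : Finset ℤ) (c : ℤ) (n : ℕ) :
    (((T.filter fun t => |c - t| ≤ n).card : ℕ) : ℝ) ≤ 2 * n + 1 := by
  have h : (T.filter fun t => |c - t| ≤ n) ⊆ Finset.Icc (c - n) (c + n) := by
    intro t ht
    have := (Finset.mem_filter.1 ht).2
    rw [abs_le] at this
    rw [Finset.mem_Icc]
    omega
  have h2 := Finset.card_le_card h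
  rw [Int.card_Icc] at h2
  have h3 : (T.filter fun t => |c - t| ≤ n).card ≤ 2 * n + 1 := by omega
  exact_mod_cast h3

theorem sum_ite_abs_le (T : Finset ℤ) (c : ℤ) (n : ℕ) {x : ℝ} (hx : 0 ≤ x) :
    (∑ t ∈ T, if |c - t| ≤ n then x else 0) ≤ (2 * n + 1) * x := by
  rw [← Finset.sum_filter, Finset.sum_const, nsmul_eq_mul]
  exact mul_le_mul_of_nonneg_right (card_filter_abs_le T c n) hx

namespace Slab
variable {H : CodeHamiltonian D L Q ι} (S : Slab H)

/-- The sequence of length scales. -/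
def scale (n : ℕ) : ℕ := S.u * S.q ^ n

theorem scale_zero : S.scale 0 = S.u := by simp [scale]

theorem scale_succ (n : ℕ) : S.scale (n + 1) = S.q * S.scale n := by
  unfold scale; ring

theorem u_pos : (0 : ℝ) < S.u := by
  have := S.le_u
  exact_mod_cast (by omega : 0 < S.u)

theorem q_pos : (0 : ℝ) < S.q := by
  have := S.le_q
  exact_mod_cast (by omega : 0 < S.q)

theorem u_le_scale (n : ℕ) : S.u ≤ S.scale n :=
  Nat.le_mul_of_pos_right _ (Nat.pow_pos (by have := S.le_q; omega))

theorem scale_pos (n : ℕ) : (0 : ℝ) < S.scale n :=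
  S.u_pos.trans_le (by exact_mod_cast S.u_le_scale n)

theorem scale_mono {m n : ℕ} (h : m ≤ n) : S.scale m ≤ S.scale n :=
  Nat.mul_le_mul_left _ (Nat.pow_le_pow_right (by have := S.le_q; omega) h)

/-- The bounds for the excess of the potential and for the cost of the dropped clumps. -/
noncomputable def bounds (t : ℤ) : ℕ → ℝ × ℝ
  | 0 => (0, 0)
  | n + 1 => ((bounds t n).1 + S.chargedBound t (S.scale (n + 1)) (bounds t n).2
      * (S.scale (n + 1) : ℝ) ^ S.σ,
      (bounds t n).2 + S.dropBound t (S.scale (n + 1)) (bounds t n).1)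

theorem exists_state [NeZero L] {t : ℤ} (n : ℕ)
    (hbar : ∀ T, T ≤ S.scale n → H.Barrier S.ℓ S.u S.s T) (hE : 2 * S.scale n < S.E)
    (hta : S.a + S.E ≤ t) (htN : t + S.E ≤ S.a + S.N) :
    ∃ G O Dr, S.State t (S.scale n) G O Dr (S.bounds t n).1 (S.bounds t n).2 := by
  induction n with
  | zero =>
    have := S.le_u
    rw [scale_zero] at *
    obtain ⟨G, hG⟩ := exists_initial_state (S := S) (t := t) (by omega) (by omega)
    exact ⟨G, 0, ∅, hG⟩
  | succ n ih =>
    have hmono : S.scale n ≤ S.scale (n + 1) := S.scale_mono (Nat.le_succ n)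
    obtain ⟨G, O, Dr, hst⟩ := ih (fun T hT => hbar T (hT.trans hmono)) (by omega)
    have h := hst.step (S.u_le_scale n)
      (by rw [← scale_succ]; exact hbar _ (Nat.div_le_self _ _))
      (by rw [← scale_succ]; exact hE) hta htN
    rw [← scale_succ] at h
    exact h

/-- Each ball lies in the window of at most 2θ + 1 ≤ 3θ heights. -/
theorem sum_window_le (T : Finset ℤ) {θ : ℕ} (hθ : 1 ≤ θ) :
    ∑ t ∈ T, cost S.u S.s (S.window θ t) ≤ 3 * θ * cost S.u S.s S.B := by
  classical
  have h1 : ∀ t ∈ T, cost S.u S.s (S.window θ t) ≤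
      ∑ b ∈ S.B, if |S.h b.1 - t| ≤ θ then boxCost S.u S.s b.2 else 0 := by
    intro t _
    unfold cost window
    rw [Finset.sum_filter]
    refine Finset.sum_le_sum fun b _ => ?_
    have := boxCost_nonneg S.u S.s b.2
    by_cases h2 : |S.h b.1 - t| ≤ θ
    · rw [if_pos h2]; split_ifs <;> linarith
    · rw [if_neg h2, if_neg (fun h => h2 h.2)]
  refine (Finset.sum_le_sum h1).trans ?_
  rw [Finset.sum_comm, cost, Finset.mul_sum]
  refine Finset.sum_le_sum fun b _ => ?_
  have h3 := boxCost_nonneg S.u S.s b.2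
  refine (sum_ite_abs_le T _ θ h3).trans (mul_le_mul_of_nonneg_right ?_ h3)
  have : (1 : ℝ) ≤ θ := by exact_mod_cast hθ
  linarith

/-- A site has `rad` equal to u, with equality. A ball of radius w ≥ u has `rad` at most 31 w, and
31² is below `costFactor`. -/
theorem rad_rpow_le {b : Site D L × ℕ} (hb : b ∈ S.B) :
    (S.rad b : ℝ) ^ (1 + S.s) ≤ (S.u : ℝ) ^ (1 + S.s) * boxCost S.u S.s b.2 := by
  have hu := S.u_pos
  have hu1 : 1 ≤ S.u := by have := S.le_u; omega
  rcases S.sized b hb with h0 | h1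
  · simp [rad, h0, boxCost_zero]
  · rw [boxCost_of_le hu1 h1]
    have hw : (0 : ℝ) < b.2 := by exact_mod_cast (by omega : 0 < b.2)
    have h2 : (S.rad b : ℝ) ≤ 31 * b.2 := by
      unfold rad; exact_mod_cast (by omega : 30 * b.2 + S.u ≤ 31 * b.2)
    have hs := S.s_pos
    have hs1 := S.s_le
    calc (S.rad b : ℝ) ^ (1 + S.s) ≤ (31 * b.2 : ℝ) ^ (1 + S.s) :=
          Real.rpow_le_rpow (by positivity) h2 (by linarith)
      _ = (31 : ℝ) ^ (1 + S.s) * (b.2 : ℝ) ^ (1 + S.s) := Real.mul_rpow (by norm_num) hw.le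
      _ ≤ (31 : ℝ) ^ (2 : ℝ) * (b.2 : ℝ) ^ (1 + S.s) := by
          refine mul_le_mul_of_nonneg_right ?_ (by positivity)
          exact Real.rpow_le_rpow_of_exponent_le (by norm_num) (by linarith)
      _ ≤ costFactor * (b.2 : ℝ) ^ (1 + S.s) := by
          refine mul_le_mul_of_nonneg_right ?_ (by positivity)
          norm_num [costFactor]
      _ = (S.u : ℝ) ^ (1 + S.s) * (costFactor * ((b.2 : ℝ) / S.u) ^ (1 + S.s)) := by
          rw [Real.div_rpow hw.le hu.le]
          field_simp

/-- A ball of `rad` ρ is near at most ρ heights, so it contributes at most ρ^(1+σ) = ρ^(1+s)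
ρ^(σ-s). The first factor is controlled by its cost, the second by the truncation ρ < z. -/
theorem sum_vsum_le (T : Finset ℤ) (hsσ : S.s ≤ S.σ) (z : ℕ) :
    ∑ t ∈ T, S.vsum z t ≤ (S.u : ℝ) ^ (1 + S.s) * (z : ℝ) ^ (S.σ - S.s) * cost S.u S.s S.B := by
  classical
  have hu := S.u_pos
  have h1 : ∀ t ∈ T, S.vsum z t = ∑ b ∈ S.B, if |S.h b.1 - t| ≤ ((10 * b.2 + 10 : ℕ) : ℤ) then
      (if S.rad b < z then (S.rad b : ℝ) ^ S.σ else 0) else 0 := by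
    intro t _
    unfold vsum near
    rw [Finset.sum_filter]
    push_cast
    rfl
  rw [Finset.sum_congr rfl h1, Finset.sum_comm, cost, Finset.mul_sum]
  refine Finset.sum_le_sum fun b hb => ?_
  have hr0 : (0 : ℝ) < S.rad b := by
    unfold rad; push_cast; positivity
  have h3 : 0 ≤ if S.rad b < z then (S.rad b : ℝ) ^ S.σ else 0 := by
    split_ifs
    · positivity
    · exact le_rfl
  refine (sum_ite_abs_le T _ _ h3).trans ?_
  have hc := boxCost_nonneg S.u S.s b.2
  split_ifs with hz
  · have e1 : (2 * ((10 * b.2 + 10 : ℕ) : ℝ) + 1) ≤ S.rad b := by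
      have := S.le_u
      unfold rad; exact_mod_cast (by omega : 2 * (10 * b.2 + 10) + 1 ≤ 30 * b.2 + S.u)
    have hz' : (S.rad b : ℝ) ≤ z := by exact_mod_cast hz.le
    calc (2 * ((10 * b.2 + 10 : ℕ) : ℝ) + 1) * (S.rad b : ℝ) ^ S.σ
        ≤ S.rad b * (S.rad b : ℝ) ^ S.σ := mul_le_mul_of_nonneg_right e1 (by positivity)
      _ = (S.rad b : ℝ) ^ (1 + S.s) * (S.rad b : ℝ) ^ (S.σ - S.s) := by
          rw [← Real.rpow_add hr0, ← Real.rpow_one_add' hr0.le]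
          · congr 1; ring
          · have := S.σ_pos; linarith
      _ ≤ ((S.u : ℝ) ^ (1 + S.s) * boxCost S.u S.s b.2) * (z : ℝ) ^ (S.σ - S.s) := by
          refine mul_le_mul (S.rad_rpow_le hb) ?_ (by positivity) (by positivity)
          exact Real.rpow_le_rpow hr0.le hz' (by linarith)
      _ = _ := by ring
  · rw [mul_zero]; positivity

/-- The constant in the bound for the average cost of dropping. -/
noncomputable def dropConst : ℝ := costFactor * (S.spread : ℝ) ^ 2

/-- The constant in the bound for the average potential. -/
noncomputable def potConst : ℝ := 192 * S.q

/-- The constant in the bound for the average cost of the dropped clumps. -/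
noncomputable def costConst : ℝ := 2 * S.dropConst * (1 + S.potConst)

theorem dropConst_nonneg : 0 ≤ S.dropConst := by unfold dropConst costFactor; positivity

/-- From one scale to the next, the old excess relative to θ^(σ-s) shrinks by the factor q^(-(σ-s)),
which is only 1 - O(log q / q). As `potConst` is proportional to q, the gain is of order log q,
while the new contribution is bounded in terms of K alone. Taking log q large makes the gain win. -/
theorem const_ineq (hlog : 2048 * S.dropConst + 8 ≤ Real.log S.q) (hsσ : S.s ≤ S.σ / 2) :
    S.potConst * (S.q : ℝ) ^ (-(S.σ - S.s)) + 16 * (3 + S.costConst / S.q) ≤ S.potConst := by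
  have hq := S.q_pos
  have hG := S.dropConst_nonneg
  have hq4 : (4 : ℝ) ≤ S.q := by
    have := S.le_q
    exact_mod_cast (by omega : 4 ≤ S.q)
  set x := S.σ * Real.log S.q / 2 with hx
  have hlogq : Real.log S.q ≤ S.q := (Real.log_le_sub_one_of_pos hq).trans (by linarith)
  have hlogpos : 0 < Real.log S.q := by linarith
  have hσ : S.σ = 1 / (S.q + 2) := rfl
  have hx0 : 0 ≤ x := by have := S.σ_pos; positivity
  have hx1 : x ≤ 1 := by
    rw [hx, hσ, div_mul_eq_mul_div, one_mul, div_div, div_le_one (by positivity)]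
    linarith
  -- For 0 ≤ x ≤ 1: exp(-x) ≤ 1/(1 + x) ≤ 1 - x/2.
  have h1 : (S.q : ℝ) ^ (-(S.σ - S.s)) ≤ 1 - x / 2 := by
    have e1 : (S.q : ℝ) ^ (-(S.σ - S.s)) ≤ (S.q : ℝ) ^ (-(S.σ / 2)) :=
      Real.rpow_le_rpow_of_exponent_le (by linarith) (by linarith)
    have e2 : (S.q : ℝ) ^ (-(S.σ / 2)) = (Real.exp x)⁻¹ := by
      rw [Real.rpow_def_of_pos hq, ← Real.exp_neg]; congr 1; rw [hx]; ring
    have e3 : (Real.exp x)⁻¹ ≤ (1 + x)⁻¹ := by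
      have := Real.add_one_le_exp x
      gcongr; linarith
    have e4 : (1 + x)⁻¹ ≤ 1 - x / 2 := by
      rw [inv_le_iff_one_le_mul₀ (by linarith)]
      nlinarith
    rw [e2] at e1
    linarith
  have hB : 0 ≤ S.potConst := by unfold potConst; positivity
  have h2 : S.potConst * (S.q : ℝ) ^ (-(S.σ - S.s)) ≤ S.potConst - S.potConst * (x / 2) := by
    have := mul_le_mul_of_nonneg_left h1 hB
    linarith
  have h3 : 24 * Real.log S.q ≤ S.potConst * (x / 2) := by
    have e : S.potConst * (x / 2) = 48 * Real.log S.q * (S.q / (S.q + 2)) := by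
      unfold potConst; rw [hx, hσ]; field_simp; ring
    rw [e]
    have : (1 : ℝ) / 2 ≤ S.q / (S.q + 2) := by
      rw [div_le_div_iff₀ (by norm_num) (by positivity)]; linarith
    have := mul_le_mul_of_nonneg_left this (by positivity : 0 ≤ 48 * Real.log S.q)
    linarith
  have h4 : S.costConst / S.q ≤ 2 * S.dropConst * 193 := by
    rw [div_le_iff₀ hq]
    unfold costConst potConst
    have : (1 : ℝ) + 192 * S.q ≤ 193 * S.q := by linarith
    have := mul_le_mul_of_nonneg_left this (by positivity : 0 ≤ 2 * S.dropConst)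
    linarith
  linarith

/-- The two bounds feed each other, hence the simultaneous induction. The number of charged clumps
depends on the cost of what was dropped before, and the cost of dropping depends on the excess of
the potential. The first closes by `const_ineq`. -/
theorem sum_bounds_le (T : Finset ℤ) (hlog : 2048 * S.dropConst + 8 ≤ Real.log S.q)
    (hsσ : S.s ≤ S.σ / 2) (n : ℕ) :
    ∑ t ∈ T, (S.bounds t n).1 ≤ S.potConst * ((S.u : ℝ) ^ (1 + S.s)
      * (S.scale n : ℝ) ^ (S.σ - S.s) * cost S.u S.s S.B) ∧
    ∑ t ∈ T, (S.bounds t n).2 ≤ S.costConst * (S.scale n * cost S.u S.s S.B) := by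
  have hW := cost_nonneg S.u S.s S.B
  have hB : 0 ≤ S.potConst := by unfold potConst; positivity
  have hB' : 0 ≤ S.costConst := by
    have := S.dropConst_nonneg
    unfold costConst; positivity
  have hσ := S.σ_pos
  have hs := S.s_pos
  have hs1 := S.s_le
  have hu := S.u_pos
  have hq := S.q_pos
  have hq4 : (4 : ℝ) ≤ S.q := by
    have := S.le_q
    exact_mod_cast (by omega : 4 ≤ S.q)
  induction n with
  | zero =>
    simp only [bounds, Finset.sum_const_zero]
    constructor <;> positivity
  | succ n ih =>
    obtain ⟨ih1, ih2⟩ := ih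
    set W := cost S.u S.s S.B
    have hθn := S.scale_pos n
    have hθ := S.scale_pos (n + 1)
    have hθe : (S.scale (n + 1) : ℝ) = S.q * S.scale n := by rw [scale_succ]; push_cast; ring
    have hθnθ : (S.scale n : ℝ) ≤ S.scale (n + 1) := by exact_mod_cast S.scale_mono (Nat.le_succ n)
    set θ : ℝ := ((S.scale (n + 1) : ℕ) : ℝ) with hθdef
    set θ₀ : ℝ := ((S.scale n : ℕ) : ℝ)
    set U := (S.u : ℝ) ^ (1 + S.s) with hU
    have hU0 : 0 < U := by positivity
    have hv : ∑ t ∈ T, S.vsum (S.scale (n + 1)) t ≤ U * θ ^ (S.σ - S.s) * W :=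
      S.sum_vsum_le T (by linarith) (S.scale (n + 1))
    have hk : ∑ t ∈ T, cost S.u S.s (S.window (S.scale (n + 1)) t) ≤ 3 * θ * W := S.sum_window_le T (by
      have := S.u_le_scale (n + 1); have := S.le_u; omega)
    constructor
    · simp only [bounds, Finset.sum_add_distrib]
      have e1 : ∑ t ∈ T, S.chargedBound t (S.scale (n + 1)) (S.bounds t n).2 * θ ^ S.σ
          = (4 * S.u / θ) ^ (1 + S.s) * θ ^ S.σ *
            (∑ t ∈ T, cost S.u S.s (S.window (S.scale (n + 1)) t)
              + ∑ t ∈ T, (S.bounds t n).2) := by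
        unfold chargedBound
        rw [← Finset.sum_add_distrib, Finset.mul_sum]
        exact Finset.sum_congr rfl fun t _ => by ring
      rw [e1]
      have e2 : (4 * S.u / θ) ^ (1 + S.s) * θ ^ S.σ ≤ 16 * U * θ ^ (S.σ - S.s) * θ⁻¹ := by
        rw [Real.div_rpow (by positivity) hθ.le, Real.mul_rpow (by norm_num) hu.le]
        have : (4 : ℝ) ^ (1 + S.s) ≤ 16 := by
          have : (4 : ℝ) ^ (1 + S.s) ≤ (4 : ℝ) ^ (2 : ℝ) :=
            Real.rpow_le_rpow_of_exponent_le (by norm_num) (by linarith)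
          refine this.trans (by norm_num)
        have e3 : θ ^ (S.σ - S.s) * θ⁻¹ = θ ^ S.σ / θ ^ (1 + S.s) := by
          rw [← Real.rpow_neg_one, ← Real.rpow_add hθ, ← Real.rpow_sub hθ]; congr 1; ring
        rw [mul_assoc (16 * U), e3]
        have : (4 : ℝ) ^ (1 + S.s) * (S.u : ℝ) ^ (1 + S.s) / θ ^ (1 + S.s) * θ ^ S.σ
          = (4 : ℝ) ^ (1 + S.s) * (U * (θ ^ S.σ / θ ^ (1 + S.s))) := by rw [hU]; ring
        rw [this, mul_assoc]
        exact mul_le_mul_of_nonneg_right ‹_› (by positivity)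
      have e4 : ∑ t ∈ T, cost S.u S.s (S.window (S.scale (n + 1)) t) + ∑ t ∈ T, (S.bounds t n).2
          ≤ (3 + S.costConst / S.q) * (θ * W) := by
        have : S.costConst * (θ₀ * W) = S.costConst / S.q * (θ * W) := by
          rw [hθe]; field_simp
        linarith
      have e5 : (4 * S.u / θ) ^ (1 + S.s) * θ ^ S.σ *
            (∑ t ∈ T, cost S.u S.s (S.window (S.scale (n + 1)) t) + ∑ t ∈ T, (S.bounds t n).2)
          ≤ 16 * (3 + S.costConst / S.q) * (U * θ ^ (S.σ - S.s) * W) := by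
        refine (mul_le_mul_of_nonneg_left e4 (by positivity)).trans ?_
        refine (mul_le_mul_of_nonneg_right e2 (by positivity)).trans (le_of_eq ?_)
        field_simp
      have e6 : S.potConst * (U * θ₀ ^ (S.σ - S.s) * W)
          = S.potConst * (S.q : ℝ) ^ (-(S.σ - S.s)) * (U * θ ^ (S.σ - S.s) * W) := by
        have : θ₀ = (S.q : ℝ)⁻¹ * θ := by rw [hθe]; field_simp
        rw [this, Real.mul_rpow (by positivity) hθ.le, Real.inv_rpow hq.le, Real.rpow_neg hq.le]
        ring
      have e7 := mul_le_mul_of_nonneg_right (S.const_ineq hlog hsσ)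
        (by positivity : 0 ≤ U * θ ^ (S.σ - S.s) * W)
      rw [e6] at ih1
      linarith
    · simp only [bounds, Finset.sum_add_distrib]
      unfold dropBound
      rw [← Finset.mul_sum, Finset.sum_add_distrib, ← hθdef]
      have f1 : θ₀ ^ (S.σ - S.s) ≤ θ ^ (S.σ - S.s) :=
        Real.rpow_le_rpow hθn.le hθnθ (by linarith)
      have f2 : ∑ t ∈ T, S.vsum (S.scale (n + 1)) t + ∑ t ∈ T, (S.bounds t n).1
          ≤ (1 + S.potConst) * (U * θ ^ (S.σ - S.s) * W) := by
        have : S.potConst * (U * θ₀ ^ (S.σ - S.s) * W) ≤ S.potConst * (U * θ ^ (S.σ - S.s) * W) := by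
          gcongr
        linarith
      have f3 : costFactor * ((S.spread : ℝ) / S.u) ^ (1 + S.s) * θ ^ (1 + S.s - S.σ) *
          (∑ t ∈ T, S.vsum (S.scale (n + 1)) t + ∑ t ∈ T, (S.bounds t n).1)
          ≤ S.dropConst * (1 + S.potConst) * (θ * W) := by
        refine (mul_le_mul_of_nonneg_left f2 (by unfold costFactor; positivity)).trans ?_
        have g1 : θ ^ (1 + S.s - S.σ) * θ ^ (S.σ - S.s) = θ := by
          rw [← Real.rpow_add hθ]
          have : 1 + S.s - S.σ + (S.σ - S.s) = 1 := by ring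
          rw [this, Real.rpow_one]
        have hspr : (1 : ℝ) ≤ S.spread := by
          unfold spread; exact_mod_cast (by omega : 1 ≤ 2 * S.K + 1)
        have g2 : ((S.spread : ℝ) / S.u) ^ (1 + S.s) * U ≤ (S.spread : ℝ) ^ 2 := by
          rw [Real.div_rpow (by positivity) hu.le, ← hU, div_mul_cancel₀ _ hU0.ne',
            ← Real.rpow_natCast]
          exact Real.rpow_le_rpow_of_exponent_le hspr (by push_cast; linarith)
        calc _ = costFactor * (((S.spread : ℝ) / S.u) ^ (1 + S.s) * U) * (1 + S.potConst)
              * ((θ ^ (1 + S.s - S.σ) * θ ^ (S.σ - S.s)) * W) := by ring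
          _ ≤ costFactor * (S.spread : ℝ) ^ 2 * (1 + S.potConst) * (θ * W) := by
              rw [g1]
              have : (0 : ℝ) ≤ costFactor := by norm_num [costFactor]
              gcongr
      -- The dropping costs grow linearly in the scale, so all earlier scales use at most half of
      -- the allowance and the present scale uses the other half.
      have f4 : S.costConst * (θ₀ * W) ≤ S.costConst / 2 * (θ * W) := by
        have : θ₀ ≤ θ / 2 := by rw [hθe]; nlinarith
        have := mul_le_mul_of_nonneg_left (mul_le_mul_of_nonneg_right this hW) hB'
        linarith
      have f5 : S.costConst / 2 = S.dropConst * (1 + S.potConst) := by unfold costConst; ring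
      rw [f5] at f4
      have f6 : S.costConst = 2 * (S.dropConst * (1 + S.potConst)) := by unfold costConst; ring
      rw [f6]
      linarith

end Slab
end PauliCode

/-! ### The final scale and the choice of a good height. -/

namespace PauliCode
open CodeHamiltonian

variable {D L : ℕ} {Q ι : Type} [Fintype Q]

namespace Slab
variable {H : CodeHamiltonian D L Q ι} (S : Slab H)

/-- The bound for the number of clumps at the end of the coarse-graining. -/
def clumpNum : ℕ := 30 * (192 * S.q + 1)

/-- The standing assumptions on the scales at which an operator is cut: `θ = scale m` is the final
scale of the coarse-graining, `M θ` the scale of the cut. -/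
structure CutScale (m M : ℕ) : Prop where
  hm : 1 ≤ m
  hlog : 2048 * S.dropConst + 8 ≤ Real.log S.q
  hsσ : S.s ≤ S.σ / 2
  costConst_le : 15 * S.costConst ≤ M
  pow_le : S.clumpNum ^ (S.q + 2) ≤ M
  rpow_le : (31 * M : ℝ) ^ S.s ≤ 2
  hE : 300 * S.clumpNum * (M * S.scale m) < S.E
  hN : 20 * S.E ≤ S.N
  hW : 5 * cost S.u S.s S.B * (M * S.scale m : ℕ) ≤
    6 * S.N * (((M * S.scale m : ℕ) : ℝ) / S.u) ^ (1 + S.s)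

open Classical in
/-- The balls of the cover of radius at most `Θ` meeting the slice of height `100 Θ` above `t`. -/
noncomputable def slice (Θ : ℕ) (t : ℤ) : Finset (Site D L × ℕ) :=
  S.B.filter fun b => b.2 ≤ Θ ∧ t - Θ ≤ S.h b.1 ∧ S.h b.1 ≤ t + 101 * Θ + 1

/-- A ball belongs to the slices of at most 102 Θ + 2 ≤ 103 Θ heights. The slice lies on one side of
the cut only, and the argument needs this factor to stay well below 200. -/
theorem sum_slice_le (T : Finset ℤ) {Θ : ℕ} (hΘ : 2 ≤ Θ) :
    ∑ t ∈ T, cost S.u S.s (S.slice Θ t) ≤ 103 * Θ * cost S.u S.s S.B := by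
  classical
  have h1 : ∀ t ∈ T, cost S.u S.s (S.slice Θ t) ≤
      ∑ b ∈ S.B, if t ∈ Finset.Icc (S.h b.1 - 101 * Θ - 1) (S.h b.1 + Θ) then
        boxCost S.u S.s b.2 else 0 := by
    intro t _
    unfold cost slice
    rw [Finset.sum_filter]
    refine Finset.sum_le_sum fun b _ => ?_
    have := boxCost_nonneg S.u S.s b.2
    split_ifs with h2 h3 h3
    · exact le_rfl
    · exact absurd (Finset.mem_Icc.2 ⟨by omega, by omega⟩) h3
    · exact this
    · exact le_rfl
  refine (Finset.sum_le_sum h1).trans ?_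
  rw [Finset.sum_comm, cost, Finset.mul_sum]
  refine Finset.sum_le_sum fun b _ => ?_
  rw [← Finset.sum_filter, Finset.sum_const, nsmul_eq_mul]
  refine mul_le_mul_of_nonneg_right ?_ (boxCost_nonneg _ _ _)
  have h2 : (T.filter fun t => t ∈ Finset.Icc (S.h b.1 - 101 * Θ - 1) (S.h b.1 + Θ)) ⊆
      Finset.Icc (S.h b.1 - 101 * Θ - 1) (S.h b.1 + Θ) := fun t ht => (Finset.mem_filter.1 ht).2
  have h3 := Finset.card_le_card h2
  rw [Int.card_Icc] at h3
  exact_mod_cast h3.trans (by omega : _ ≤ 103 * Θ)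

theorem CutScale.unit_pos {S : Slab H} {m M : ℕ} (hc : S.CutScale m M) :
    1 ≤ M ∧ S.q ≤ M ∧ S.spread ≤ M ∧ 1 ≤ S.clumpNum ∧ 2 * S.u ≤ S.scale m := by
  have h0 := S.le_q
  have h1 : S.clumpNum ≤ S.clumpNum ^ (S.q + 2) := Nat.le_self_pow (by omega) _
  have h2 := hc.pow_le
  have h3 : S.clumpNum = 30 * (192 * S.q + 1) := rfl
  have h4 : S.spread = 2 * S.K + 1 := rfl
  have h5 : S.scale 1 ≤ S.scale m := S.scale_mono hc.hm
  rw [scale_succ, scale_zero] at h5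
  have h6 : 2 * S.u ≤ S.q * S.u := Nat.mul_le_mul_right _ (by omega)
  omega

/-- Balls with `rad` at least θ have w ≥ θ/31, so Θ/w ≤ 31 M and (31 M)^s ≤ 2: such a ball costs,
per unit of radius, nearly as much as a ball of radius Θ does. The factor `costFactor` then leaves
them room to block only a small fraction of the heights. -/
theorem CutScale.sum_big_le {S : Slab H} {m M : ℕ} (hc : S.CutScale m M) :
    ∑ b ∈ S.B.filter (fun b => S.scale m ≤ S.rad b),
      ((Finset.Icc (S.h b.1 - 200 * (b.2 : ℤ)) (S.h b.1 + 200 * b.2)).card : ℝ) ≤ S.N / 100 := by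
  classical
  obtain ⟨hM, hqM, hsM, hn, hu2⟩ := hc.unit_pos
  have hu := S.u_pos
  have hθ := S.scale_pos m
  have hs := S.s_pos
  have hM0 : (0 : ℝ) < M := by exact_mod_cast hM
  set Θ : ℝ := ((M * S.scale m : ℕ) : ℝ) with hΘd
  have hΘe : Θ = M * S.scale m := by rw [hΘd]; push_cast; ring
  have hΘ : 0 < Θ := by rw [hΘe]; positivity
  set J := (Θ / S.u) ^ (1 + S.s) with hJ
  have hJ0 : 0 < J := by positivity
  have hterm : ∀ b ∈ S.B.filter (fun b => S.scale m ≤ S.rad b),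
      ((Finset.Icc (S.h b.1 - 200 * (b.2 : ℤ)) (S.h b.1 + 200 * b.2)).card : ℝ) ≤
        802 / costFactor * Θ / J * boxCost S.u S.s b.2 := by
    intro b hb
    obtain ⟨hbB, hbr⟩ := Finset.mem_filter.1 hb
    have hw : S.u ≤ b.2 := by
      rcases S.sized b hbB with h | h
      · unfold rad at hbr; rw [h] at hbr; have := S.le_u; omega
      · exact h
    have hle := S.le_u
    have hw1 : S.scale m ≤ 31 * b.2 := by unfold rad at hbr; omega
    have hw0 : (0 : ℝ) < b.2 := by exact_mod_cast (by omega : 0 < b.2)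
    have hcard : ((Finset.Icc (S.h b.1 - 200 * (b.2 : ℤ)) (S.h b.1 + 200 * b.2)).card : ℝ)
        ≤ 401 * b.2 := by
      rw [Int.card_Icc]
      exact_mod_cast (by omega :
        (S.h b.1 + 200 * (b.2 : ℤ) + 1 - (S.h b.1 - 200 * b.2)).toNat ≤ 401 * b.2)
    refine hcard.trans ?_
    have key : b.2 * J ≤ 2 * Θ * ((b.2 : ℝ) / S.u) ^ (1 + S.s) := by
      rw [hJ, rpow_one_add (by positivity) hs, rpow_one_add (by positivity) hs]
      have h1 : (Θ / S.u) ^ S.s ≤ 2 * ((b.2 : ℝ) / S.u) ^ S.s := by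
        have h2 : Θ / S.u ≤ (31 * M) * (b.2 / S.u) := by
          rw [hΘe]
          have : (S.scale m : ℝ) ≤ 31 * b.2 := by exact_mod_cast hw1
          rw [mul_div_assoc', div_le_div_iff_of_pos_right hu]
          nlinarith
        calc (Θ / S.u) ^ S.s ≤ ((31 * M) * (b.2 / S.u)) ^ S.s :=
              Real.rpow_le_rpow (by positivity) h2 hs.le
          _ = (31 * M : ℝ) ^ S.s * (b.2 / S.u : ℝ) ^ S.s :=
              Real.mul_rpow (by positivity) (by positivity)
          _ ≤ _ := mul_le_mul_of_nonneg_right hc.rpow_le (by positivity)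
      calc b.2 * (Θ / S.u * (Θ / S.u) ^ S.s) = (b.2 * Θ / S.u) * (Θ / S.u) ^ S.s := by ring
        _ ≤ (b.2 * Θ / S.u) * (2 * ((b.2 : ℝ) / S.u) ^ S.s) :=
            mul_le_mul_of_nonneg_left h1 (by positivity)
        _ = _ := by ring
    rw [boxCost_of_le (by omega) hw]
    have hA : costFactor ≠ 0 := by norm_num [costFactor]
    have : 802 / costFactor * Θ / J * (costFactor * ((b.2 : ℝ) / S.u) ^ (1 + S.s))
        = 401 * (2 * Θ * ((b.2 : ℝ) / S.u) ^ (1 + S.s)) / J := by field_simp; ring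
    rw [this, le_div_iff₀ hJ0, mul_assoc]
    exact mul_le_mul_of_nonneg_left key (by norm_num)
  refine (Finset.sum_le_sum hterm).trans ?_
  rw [← Finset.mul_sum]
  have h1 : ∑ b ∈ S.B.filter (fun b => S.scale m ≤ S.rad b), boxCost S.u S.s b.2
      ≤ cost S.u S.s S.B := cost_mono (Finset.filter_subset _ _)
  have h2 := hc.hW
  rw [← hΘd, ← hJ] at h2
  refine (mul_le_mul_of_nonneg_left h1 (by unfold costFactor; positivity)).trans ?_
  have e : 802 / costFactor * Θ / J * cost S.u S.s S.B
      = 802 / (5 * costFactor) * (5 * cost S.u S.s S.B * Θ) / J := by ring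
  rw [e, div_le_iff₀ hJ0]
  refine (mul_le_mul_of_nonneg_left h2 (by unfold costFactor; positivity)).trans ?_
  have : (0 : ℝ) ≤ S.N * J := by positivity
  unfold costFactor
  nlinarith

/-- A union of Markov bounds: about 0.89 N heights avoid the large balls, while failures of the
three remaining requirements account for at most (0.62 + 0.01 + 0.08 + 0.08) N. -/
theorem CutScale.exists_good_level {S : Slab H} {m M : ℕ} (hc : S.CutScale m M) :
    ∃ t : ℤ, S.a + S.E ≤ t ∧ t + S.E ≤ S.a + S.N ∧
      (∀ b ∈ S.B, S.scale m ≤ S.rad b → 200 * (b.2 : ℤ) < |S.h b.1 - t|) ∧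
      cost S.u S.s (S.slice (M * S.scale m) t) + (S.bounds t m).2 <
        200 * (((M * S.scale m : ℕ) : ℝ) / S.u) ^ (1 + S.s) ∧
      (S.bounds t m).2 < (((M * S.scale m : ℕ) : ℝ) / S.u) ^ (1 + S.s) ∧
      S.vsum (S.scale m) t + (S.bounds t m).1 < S.clumpNum * (S.scale m : ℝ) ^ S.σ := by
  classical
  obtain ⟨hM, hqM, hsM, hn, hu2⟩ := hc.unit_pos
  have hu := S.u_pos
  have hθ := S.scale_pos m
  have hs := S.s_pos
  have hM0 : (0 : ℝ) < M := by exact_mod_cast hM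
  set θ : ℝ := (S.scale m : ℝ) with hθd
  set Θ : ℝ := ((M * S.scale m : ℕ) : ℝ) with hΘd
  have hΘe : Θ = M * θ := by rw [hΘd]; push_cast; ring
  have hΘ : 0 < Θ := by rw [hΘe]; positivity
  set J := (Θ / S.u) ^ (1 + S.s) with hJ
  have hJ0 : 0 < J := by positivity
  have hW := hc.hW
  rw [← hΘd, ← hJ] at hW
  have hW0 := cost_nonneg S.u S.s S.B
  set W := cost S.u S.s S.B
  have hn0 : (0 : ℝ) < S.clumpNum := by exact_mod_cast hn
  have hN0 : (0 : ℝ) < S.N := by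
    have := hc.hN; have := hc.hE
    exact_mod_cast (by omega : 0 < S.N)
  set T₀ := Finset.Icc (S.a + S.E) (S.a + S.N - S.E) with hT₀
  set bad : ℤ → Prop := fun t => ∃ b ∈ S.B, S.scale m ≤ S.rad b ∧ |S.h b.1 - t| ≤ 200 * (b.2 : ℤ)
    with hbad
  set T := T₀.filter fun t => ¬ bad t with hT
  have hcard₀ : (9 / 10 : ℝ) * S.N ≤ T₀.card := by
    rw [hT₀, Int.card_Icc]
    have h1 := hc.hN
    have h2 : 9 * S.N ≤ 10 * (S.a + S.N - S.E + 1 - (S.a + S.E)).toNat := by omega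
    have h3 : (9 : ℝ) * S.N ≤ 10 * ((S.a + S.N - S.E + 1 - (S.a + S.E)).toNat : ℝ) := by
      exact_mod_cast h2
    linarith
  have hcardbad : ((T₀.filter bad).card : ℝ) ≤ S.N / 100 := by
    refine le_trans ?_ hc.sum_big_le
    have h1 : T₀.filter bad ⊆ (S.B.filter (fun b => S.scale m ≤ S.rad b)).biUnion fun b =>
        Finset.Icc (S.h b.1 - 200 * (b.2 : ℤ)) (S.h b.1 + 200 * b.2) := by
      intro t ht
      obtain ⟨b, hb, hbr, hbt⟩ := (Finset.mem_filter.1 ht).2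
      rw [abs_le] at hbt
      exact Finset.mem_biUnion.2 ⟨b, Finset.mem_filter.2 ⟨hb, hbr⟩,
        Finset.mem_Icc.2 ⟨by omega, by omega⟩⟩
    exact_mod_cast (Finset.card_le_card h1).trans Finset.card_biUnion_le
  have hcardT : (89 / 100 : ℝ) * S.N ≤ T.card := by
    have : (T₀.filter bad).card + T.card = T₀.card := Finset.card_filter_add_card_filter_not _
    have : ((T₀.filter bad).card : ℝ) + T.card = T₀.card := by exact_mod_cast this
    linarith
  have hsum1 := S.sum_slice_le T (Θ := M * S.scale m) (by
    have := S.le_u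
    have : S.scale m ≤ M * S.scale m := Nat.le_mul_of_pos_left _ hM
    omega)
  rw [← hΘd] at hsum1
  obtain ⟨hsum2, hsum3⟩ := S.sum_bounds_le T hc.hlog hc.hsσ m
  have hσ := S.σ_pos
  have hsum4 := S.sum_vsum_le T (by linarith [hc.hsσ]) (S.scale m)
  rw [← hθd] at hsum2 hsum3 hsum4
  have hNJ : (103 : ℝ) * Θ * W ≤ 124 * (S.N * J) := by linarith [mul_pos hN0 hJ0]
  have hYb : S.costConst * (θ * W) ≤ (8 / 100) * (S.N * J) := by
    have h1 := mul_le_mul_of_nonneg_right hc.costConst_le (by positivity : 0 ≤ θ * W)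
    have h2 : (M : ℝ) * (θ * W) = W * Θ := by rw [hΘe]; ring
    linarith
  have hVb : S.potConst * ((S.u : ℝ) ^ (1 + S.s) * θ ^ (S.σ - S.s) * W)
      + (S.u : ℝ) ^ (1 + S.s) * θ ^ (S.σ - S.s) * W
        ≤ (8 / 100) * S.N * (S.clumpNum * θ ^ S.σ) := by
    have h1 : (S.u : ℝ) ^ (1 + S.s) * θ ^ (S.σ - S.s) * W ≤ 24 / 10 * S.N * θ ^ S.σ := by
      have h2 : J = Θ * Θ ^ S.s / (S.u : ℝ) ^ (1 + S.s) := by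
        rw [hJ, Real.div_rpow hΘ.le hu.le, rpow_one_add hΘ.le hs]
      have h3 : 5 * W * (S.u : ℝ) ^ (1 + S.s) ≤ 6 * S.N * Θ ^ S.s := by
        rw [h2] at hW
        have e : 6 * (S.N : ℝ) * (Θ * Θ ^ S.s / (S.u : ℝ) ^ (1 + S.s))
          = (6 * S.N * Θ ^ S.s) * Θ / (S.u : ℝ) ^ (1 + S.s) := by ring
        rw [e, le_div_iff₀ (by positivity)] at hW
        have : (5 * W * (S.u : ℝ) ^ (1 + S.s)) * Θ ≤ (6 * S.N * Θ ^ S.s) * Θ := by linarith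
        exact le_of_mul_le_mul_right this hΘ
      have h4 : Θ ^ S.s ≤ 2 * θ ^ S.s := by
        rw [hΘe, Real.mul_rpow hM0.le hθ.le]
        refine mul_le_mul_of_nonneg_right ?_ (by positivity)
        refine le_trans (Real.rpow_le_rpow hM0.le ?_ hs.le) hc.rpow_le
        linarith
      have h5 : θ ^ S.s * θ ^ (S.σ - S.s) = θ ^ S.σ := by
        rw [← Real.rpow_add hθ]; congr 1; ring
      have h6 : 5 * W * (S.u : ℝ) ^ (1 + S.s) * θ ^ (S.σ - S.s)
          ≤ 6 * S.N * (2 * θ ^ S.s) * θ ^ (S.σ - S.s) := by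
        refine mul_le_mul_of_nonneg_right (h3.trans ?_) (by positivity)
        exact mul_le_mul_of_nonneg_left h4 (by positivity)
      have h7 : 6 * (S.N : ℝ) * (2 * θ ^ S.s) * θ ^ (S.σ - S.s) = 12 * S.N * θ ^ S.σ := by
        rw [← h5]; ring
      linarith
    have hB : 0 ≤ S.potConst := by unfold potConst; positivity
    have hcl : (S.clumpNum : ℝ) = 30 * (S.potConst + 1) := by
      unfold clumpNum potConst; push_cast; ring
    have h2 := mul_le_mul_of_nonneg_left h1 (by linarith : 0 ≤ S.potConst + 1)
    rw [hcl]
    linarith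
  by_contra hcon
  push Not at hcon
  -- If one of the three requirements fails at t, the corresponding quotients already add up to at
  -- least 1.
  have hone : ∀ t ∈ T, (1 : ℝ) ≤ (cost S.u S.s (S.slice (M * S.scale m) t)) / (200 * J)
      + (S.bounds t m).2 / (200 * J) + (S.bounds t m).2 / J
      + S.vsum (S.scale m) t / (S.clumpNum * θ ^ S.σ)
      + (S.bounds t m).1 / (S.clumpNum * θ ^ S.σ) := by
    intro t ht
    obtain ⟨ht₀, htb⟩ := Finset.mem_filter.1 ht
    rw [hT₀, Finset.mem_Icc] at ht₀
    have hk := cost_nonneg S.u S.s (S.slice (M * S.scale m) t)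
    have hv : 0 ≤ S.vsum (S.scale m) t := by
      refine Finset.sum_nonneg fun b _ => ?_
      split_ifs
      · positivity
      · exact le_rfl
    have hb : 0 ≤ (S.bounds t m).1 ∧ 0 ≤ (S.bounds t m).2 := by
      clear * -
      induction m with
      | zero => simp [bounds]
      | succ n ih =>
        obtain ⟨h1, h2⟩ := ih
        have hk := cost_nonneg S.u S.s (S.window (S.scale (n + 1)) t)
        have hv : 0 ≤ S.vsum (S.scale (n + 1)) t := by
          refine Finset.sum_nonneg fun b _ => ?_
          split_ifs
          · positivity
          · exact le_rfl
        unfold bounds chargedBound dropBound costFactor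
        constructor <;> dsimp only <;> positivity
    obtain ⟨hb1, hb2⟩ := hb
    have hcon' := hcon t ht₀.1 (by linarith [ht₀.2]) (fun b hb hbr => by
      by_contra hh
      exact htb ⟨b, hb, hbr, not_lt.1 hh⟩)
    have hp1 : 0 ≤ (cost S.u S.s (S.slice (M * S.scale m) t)) / (200 * J) := by positivity
    have hp2 : 0 ≤ (S.bounds t m).2 / (200 * J) := by positivity
    have hp3 : 0 ≤ (S.bounds t m).2 / J := by positivity
    have hp4 : 0 ≤ S.vsum (S.scale m) t / (S.clumpNum * θ ^ S.σ) := by positivity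
    have hp5 : 0 ≤ (S.bounds t m).1 / (S.clumpNum * θ ^ S.σ) := by positivity
    by_cases c1 : cost S.u S.s (S.slice (M * S.scale m) t) + (S.bounds t m).2 < 200 * J
    · by_cases c2 : (S.bounds t m).2 < J
      · have c3 := hcon' c1 c2
        have : 1 ≤ (S.vsum (S.scale m) t + (S.bounds t m).1) / (S.clumpNum * θ ^ S.σ) := by
          rw [le_div_iff₀ (by positivity)]; linarith
        rw [add_div] at this
        linarith
      · have : 1 ≤ (S.bounds t m).2 / J := by
          rw [le_div_iff₀ hJ0]; linarith
        linarith
    · have : 1 ≤ (cost S.u S.s (S.slice (M * S.scale m) t) + (S.bounds t m).2) / (200 * J) := by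
        rw [le_div_iff₀ (by positivity)]; linarith
      rw [add_div] at this
      linarith
  have hfin := Finset.sum_le_sum hone
  simp only [Finset.sum_add_distrib, ← Finset.sum_div, Finset.sum_const, nsmul_eq_mul,
    mul_one] at hfin
  -- The slices total at most 103 Θ W, and the density assumption W Θ ≤ 1.2 N J turns this into at
  -- most 124 N J.
  have k1 : (∑ t ∈ T, cost S.u S.s (S.slice (M * S.scale m) t)) / (200 * J) ≤ 62 / 100 * S.N := by
    rw [div_le_iff₀ (by positivity)]; linarith
  have k2 : (∑ t ∈ T, (S.bounds t m).2) / (200 * J) ≤ 1 / 100 * S.N := by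
    rw [div_le_iff₀ (by positivity)]; linarith [mul_pos hN0 hJ0]
  have k3 : (∑ t ∈ T, (S.bounds t m).2) / J ≤ 8 / 100 * S.N := by
    rw [div_le_iff₀ (by positivity)]; linarith
  have k4 : (∑ t ∈ T, S.vsum (S.scale m) t) / (S.clumpNum * θ ^ S.σ)
      + (∑ t ∈ T, (S.bounds t m).1) / (S.clumpNum * θ ^ S.σ) ≤ 8 / 100 * S.N := by
    rw [← add_div, div_le_iff₀ (by positivity)]; linarith
  linarith

end Slab
end PauliCode

/-! ### A cut that leaves at most one charged cluster. -/

namespace PauliCode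
open CodeHamiltonian

variable {D L : ℕ} {Q ι : Type} [Fintype Q]

namespace Slab
variable {H : CodeHamiltonian D L Q ι} (S : Slab H)

/-- The ratio between the cost of the operator used to repair the cut and the cost of a ball of the
scale of the cut. -/
noncomputable def cutConst : ℝ :=
  1 + S.clumpNum * (costFactor * (203 * S.spread * S.clumpNum : ℝ) ^ 2)

/-- A cut at height `t`, up to the cluster `c` repaired by the operator `O`. -/
structure Cut (Θ : ℕ) (t : ℤ) (O : Pauli Q) (c : ι → ZMod 2) (Dr : Finset (Site D L × ℕ)) :
    Prop where
  le_t : S.a + S.E ≤ t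
  t_le : t + S.E ≤ S.a + S.N
  eq : S.cutClus t = H.syn O + c
  diam : H.DiamLE c (203 * S.clumpNum * Θ)
  mem : ∀ x, c x ≠ 0 → S.cutClus t x ≠ 0
  height : ∀ v ∈ H.supp O, |S.h v - t| ≤ S.spread * (203 * S.clumpNum * Θ : ℕ)
  near : ∀ v ∈ H.supp O, ∃ w ∈ H.supp S.F, siteDist v w ≤ S.spread * (203 * S.clumpNum * Θ)
  covers : Covers Dr (H.supp O)
  sized : Sized S.u Dr
  cost_le : cost S.u S.s Dr ≤ S.cutConst * ((Θ : ℝ) / S.u) ^ (1 + S.s)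
  eq_zero : cost S.u S.s S.B < 99 * ((Θ : ℝ) / S.u) ^ (1 + S.s) → c = 0

variable {S}

/-- At a good height no ball with `rad` at least the final scale is near the cut, so the truncation
there loses nothing. -/
theorem vsum_le_of_avoid {m : ℕ} {t : ℤ} (hu : 2 * S.u ≤ S.scale m)
    (hav : ∀ b ∈ S.B, S.scale m ≤ S.rad b → 200 * (b.2 : ℤ) < |S.h b.1 - t|) (z : ℕ) :
    S.vsum z t ≤ S.vsum (S.scale m) t := by
  unfold vsum
  refine Finset.sum_le_sum fun b hb => ?_
  obtain ⟨hbB, hbt⟩ := Finset.mem_filter.1 hb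
  have hlt : S.rad b < S.scale m := by
    by_contra hc
    have h1 := hav b hbB (not_lt.1 hc)
    have : 1 ≤ b.2 := by
      unfold rad at hc; have := S.le_u; omega
    have : (b.2 : ℤ) ≥ 1 := by exact_mod_cast this
    omega
  rw [if_pos hlt]
  split_ifs
  · exact le_rfl
  · positivity

variable [NeZero L]

-- The full potential ∑ m^σ is at most `clumpNum` · θ^σ while every m ≥ θ. This bounds the number of
-- clumps, and each m by `clumpNum`^(1/σ) θ, where 1/σ = q + 2.
omit [NeZero L] in
theorem State.clump_bounds {m M : ℕ} (hc : S.CutScale m M) {t : ℤ} {G : Multiset (Clump D L ι)}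
    {O : Pauli Q} {Dr : Finset (Site D L × ℕ)} {X Y : ℝ}
    (hst : S.State t (S.scale m) G O Dr X Y)
    (hav : ∀ b ∈ S.B, S.scale m ≤ S.rad b → 200 * (b.2 : ℤ) < |S.h b.1 - t|)
    (hV : S.vsum (S.scale m) t + X < S.clumpNum * (S.scale m : ℝ) ^ S.σ) :
    Multiset.card G ≤ S.clumpNum ∧ ∀ g ∈ G, g.m ≤ M * S.scale m := by
  obtain ⟨hM, hqM, hsM, hn, hu2⟩ := hc.unit_pos
  have hθ := S.scale_pos m
  have hσ := S.σ_pos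
  have hpot : (G.map fun g => (g.m : ℝ) ^ S.σ).sum ≤ S.clumpNum * (S.scale m : ℝ) ^ S.σ := by
    have h1 := hst.pot_le ((G.map Clump.m).sum + 1)
    have h2 : Clump.pot S.σ ((G.map Clump.m).sum + 1) G = (G.map fun g => (g.m : ℝ) ^ S.σ).sum := by
      unfold Clump.pot
      refine congrArg _ (Multiset.map_congr rfl fun g hg => if_pos ?_)
      have := Multiset.single_le_sum (fun x _ => Nat.zero_le x) _ (Multiset.mem_map_of_mem Clump.m hg)
      omega
    rw [h2] at h1
    have := vsum_le_of_avoid hu2 hav ((G.map Clump.m).sum + 1)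
    linarith
  constructor
  · have h1 := card_mul_le_sum G (fun g => (g.m : ℝ) ^ S.σ) ((S.scale m : ℝ) ^ S.σ) fun g hg =>
      Real.rpow_le_rpow hθ.le (by exact_mod_cast hst.le_m g hg) hσ.le
    have h2 := le_of_mul_le_mul_right (h1.trans hpot) (by positivity)
    exact_mod_cast h2
  · intro g hg
    have h1 : (g.m : ℝ) ^ S.σ ≤ S.clumpNum * (S.scale m : ℝ) ^ S.σ := by
      refine le_trans ?_ hpot
      refine Multiset.single_le_sum (fun x hx => ?_) _
        (Multiset.mem_map_of_mem (fun g : Clump D L ι => (g.m : ℝ) ^ S.σ) hg)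
      obtain ⟨y, _, rfl⟩ := Multiset.mem_map.1 hx
      positivity
    have h2 : (S.clumpNum : ℝ) * (S.scale m : ℝ) ^ S.σ =
        (((S.clumpNum ^ (S.q + 2) * S.scale m : ℕ)) : ℝ) ^ S.σ := by
      push_cast
      rw [Real.mul_rpow (by positivity) hθ.le]
      congr 1
      have : S.σ = ((S.q + 2 : ℕ) : ℝ)⁻¹ := by unfold σ; push_cast; rw [one_div]
      rw [this, Real.pow_rpow_inv_natCast (by positivity) (by omega)]
    rw [h2] at h1
    have h3 := (Real.rpow_le_rpow_iff (by positivity) (by positivity) hσ).1 h1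
    have h4 : g.m ≤ S.clumpNum ^ (S.q + 2) * S.scale m := by exact_mod_cast h3
    exact h4.trans (Nat.mul_le_mul_right _ hc.pow_le)

/-- Clumps at the final stage: their regions consist of defects of the cut. -/
structure FinalClumps (S : Slab H) (Θ : ℕ) (t : ℤ) (O : Pauli Q) (G : Multiset (Clump D L ι)) :
    Prop where
  sum : (G.map Clump.c).sum + H.syn O = S.cutClus t
  good : ∀ g ∈ G, S.GoodClump t g
  cut : ∀ g ∈ G, ∀ v ∈ g.U, ∃ x, S.cutClus t x ≠ 0 ∧ H.corner x = v
  le_m : ∀ g ∈ G, S.u ≤ g.m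
  m_le : (G.map fun g => g.m + 202 * Θ).sum ≤ 203 * S.clumpNum * Θ
  card_le : Multiset.card G ≤ S.clumpNum

omit [NeZero L] in
theorem FinalClumps.m_le_of_mem {Θ : ℕ} {t : ℤ} {O : Pauli Q} {G : Multiset (Clump D L ι)}
    (hG : S.FinalClumps Θ t O G) {g : Clump D L ι} (hg : g ∈ G) : g.m ≤ 203 * S.clumpNum * Θ := by
  have := Multiset.single_le_sum (fun x _ => Nat.zero_le x) _
    (Multiset.mem_map_of_mem (fun g : Clump D L ι => g.m + 202 * Θ) hg)
  have := hG.m_le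
  omega

-- Empty clusters are discarded and the regions shrunk to the corners of actual defects, which keeps
-- them within height 1 of the cut. Then clumps within 202 Θ are merged.
omit [NeZero L] in
theorem State.finalClumps {m M : ℕ} (hc : S.CutScale m M) {t : ℤ} {G : Multiset (Clump D L ι)}
    {O : Pauli Q} {Dr : Finset (Site D L × ℕ)} {X Y : ℝ}
    (hst : S.State t (S.scale m) G O Dr X Y)
    (hav : ∀ b ∈ S.B, S.scale m ≤ S.rad b → 200 * (b.2 : ℤ) < |S.h b.1 - t|)
    (hV : S.vsum (S.scale m) t + X < S.clumpNum * (S.scale m : ℝ) ^ S.σ) :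
    ∃ G, S.FinalClumps (M * S.scale m) t O G ∧ Clump.Sep (202 * (M * S.scale m)) G := by
  classical
  obtain ⟨hcard, hm⟩ := hst.clump_bounds hc hav hV
  set Θ := M * S.scale m
  let f : Clump D L ι → Clump D L ι := fun g => ⟨g.c, {v | ∃ x, g.c x ≠ 0 ∧ H.corner x = v}, g.m⟩
  refine Clump.exists_sep (202 * Θ) (S.FinalClumps Θ t O) ?_
    ((G.filter fun g => g.c ≠ 0).map f) ?_
  · intro a b rest h hab
    have ha : a ∈ a ::ₘ b ::ₘ rest := Multiset.mem_cons_self _ _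
    have hb : b ∈ a ::ₘ b ::ₘ rest := Multiset.mem_cons_of_mem (Multiset.mem_cons_self _ _)
    have hr : ∀ g ∈ rest, g ∈ a ::ₘ b ::ₘ rest := fun g hg =>
      Multiset.mem_cons_of_mem (Multiset.mem_cons_of_mem hg)
    refine ⟨?_, ?_, ?_, ?_, ?_, ?_⟩
    · rw [← h.sum]
      simp [Clump.merge, add_assoc]
    · intro g hg
      rcases Multiset.mem_cons.1 hg with rfl | hg
      · exact (h.good a ha).merge (h.good b hb) hab
      · exact h.good g (hr g hg)
    · intro g hg
      rcases Multiset.mem_cons.1 hg with rfl | hg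
      · rintro v (hv | hv)
        · exact h.cut a ha v hv
        · exact h.cut b hb v hv
      · exact h.cut g (hr g hg)
    · intro g hg
      rcases Multiset.mem_cons.1 hg with rfl | hg
      · exact (h.le_m a ha).trans (by show a.m ≤ a.m + b.m + _; omega)
      · exact h.le_m g (hr g hg)
    -- The merger adds exactly the gap 202 Θ that the lost summand carried, so the sum is invariant.
    -- It bounds every diameter by 203 `clumpNum` Θ.
    · refine le_trans (le_of_eq ?_) h.m_le
      simp only [Multiset.map_cons, Multiset.sum_cons, Clump.merge]
      ring
    · refine le_trans ?_ h.card_le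
      simp
  · refine ⟨?_, ?_, ?_, ?_, ?_, ?_⟩
    · rw [← hst.sum, Multiset.map_map, ← sum_map_filter_add G (fun g => g.c ≠ 0)]
      have : ((G.filter fun g => ¬ g.c ≠ 0).map Clump.c).sum = 0 := by
        refine Multiset.sum_eq_zero fun y hy => ?_
        obtain ⟨g, hg, rfl⟩ := Multiset.mem_map.1 hy
        exact not_not.1 (Multiset.mem_filter.1 hg).2
      rw [this, add_zero]
      rfl
    · intro g hg
      obtain ⟨g', hg', rfl⟩ := Multiset.mem_map.1 hg
      obtain ⟨h1, h2⟩ := Multiset.mem_filter.1 hg'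
      have h3 := hst.good g' h1
      have hU : ∀ v ∈ (f g').U, v ∈ g'.U := by
        rintro v ⟨x, hx, rfl⟩
        exact h3.mem x hx
      refine ⟨fun x hx => ⟨x, hx, rfl⟩, h3.cut,
        fun v hv w hw => h3.diam v (hU v hv) w (hU w hw), fun v hv => h3.height v (hU v hv), ?_⟩
      obtain ⟨x, hx⟩ := Function.ne_iff.1 h2
      exact ⟨_, x, hx, rfl⟩
    · intro g hg
      obtain ⟨g', hg', rfl⟩ := Multiset.mem_map.1 hg
      rintro v ⟨x, hx, rfl⟩
      exact ⟨x, (hst.good g' (Multiset.mem_filter.1 hg').1).cut x hx, rfl⟩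
    · intro g hg
      obtain ⟨g', hg', rfl⟩ := Multiset.mem_map.1 hg
      exact (S.u_le_scale m).trans (hst.le_m g' (Multiset.mem_filter.1 hg').1)
    · rw [Multiset.map_map]
      have h1 : ((G.filter fun g => g.c ≠ 0).map ((fun g : Clump D L ι => g.m + 202 * Θ) ∘ f)).sum
          ≤ ((G.filter fun g => g.c ≠ 0).map fun _ => 203 * Θ).sum := by
        refine Multiset.sum_map_le_sum_map _ _ fun g hg => ?_
        have := hm g (Multiset.mem_filter.1 hg).1
        show g.m + 202 * Θ ≤ 203 * Θ
        omega
      refine h1.trans ?_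
      rw [Multiset.map_const', Multiset.sum_replicate, smul_eq_mul, mul_comm 203 S.clumpNum,
        mul_assoc]
      refine Nat.mul_le_mul_right _ (le_trans ?_ hcard)
      exact Multiset.card_le_card (Multiset.filter_le _ _)
    · rw [Multiset.card_map]
      exact (Multiset.card_le_card (Multiset.filter_le _ _)).trans hcard

/-- The barrier at T = 100 Θ charges each clump. Balls of radius at most Θ cannot reach two
neighbourhoods, as 2 · 100 + 2 = 202. The upper part lies above t and the clumps within height 1 of
it, so only balls of the one-sided slice are used. -/
theorem FinalClumps.card_charged_le {m M : ℕ} (hc : S.CutScale m M) {t : ℤ}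
    {G₀ G : Multiset (Clump D L ι)} {O : Pauli Q} {Dr : Finset (Site D L × ℕ)} {X Y : ℝ}
    (hst : S.State t (S.scale m) G₀ O Dr X Y)
    (hav : ∀ b ∈ S.B, S.scale m ≤ S.rad b → 200 * (b.2 : ℤ) < |S.h b.1 - t|)
    (hG : S.FinalClumps (M * S.scale m) t O G) (hsep : Clump.Sep (202 * (M * S.scale m)) G)
    (hbar : ∀ T, T ≤ 100 * (M * S.scale m) → H.Barrier S.ℓ S.u S.s T)
    (hta : S.a + S.E ≤ t) (htN : t + S.E ≤ S.a + S.N) (C : Multiset (Clump D L ι)) (hCG : C ≤ G)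
    (hC : ∀ g ∈ C, ¬ H.Neut S.ℓ g.c) :
    (Multiset.card C : ℝ) * (100 * (((M * S.scale m : ℕ) : ℝ) / S.u) ^ (1 + S.s)) ≤
      cost S.u S.s (S.slice (M * S.scale m) t) + Y := by
  classical
  obtain ⟨hM, hqM, hsM, hn, hu2⟩ := hc.unit_pos
  have hu := S.le_u
  have hE := hc.hE
  have hθΘ : S.scale m ≤ M * S.scale m := Nat.le_mul_of_pos_left _ hM
  have hsΘ : S.spread * S.scale m ≤ M * S.scale m := Nat.mul_le_mul_right _ hsM
  have hnΘ : M * S.scale m ≤ S.clumpNum * (M * S.scale m) := Nat.le_mul_of_pos_left _ hn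
  have hnn : 30 * (M * S.scale m) ≤ S.clumpNum * (M * S.scale m) :=
    Nat.mul_le_mul_right _ (by unfold clumpNum; omega)
  rw [mul_assoc] at hE
  set Θ := M * S.scale m with hΘ
  have hmle : ∀ g ∈ G, g.m ≤ 203 * (S.clumpNum * Θ) := fun g hg => by
    have := hG.m_le_of_mem hg
    rwa [mul_assoc] at this
  let touch : Site D L × ℕ → Clump D L ι → Prop := fun b g =>
    ∃ v, siteDist v b.1 ≤ b.2 ∧ distTo g.U v ≤ 100 * Θ
  set Bs := S.slice Θ t ∪ Dr with hBs
  have hsmall : ∀ b ∈ Bs, b.2 ≤ Θ := by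
    intro b hb
    rcases Finset.mem_union.1 hb with hb | hb
    · exact (Finset.mem_filter.1 hb).2.1
    · exact (hst.dropped b hb).2.trans hsΘ
  have hsz : Sized S.u Bs := by
    intro b hb
    rcases Finset.mem_union.1 hb with hb | hb
    · exact S.sized b (Finset.mem_filter.1 hb).1
    · exact Or.inr (hst.dropped b hb).1
  have hsum := sum_touch_le touch (fun b => boxCost S.u S.s b.2) (fun b => boxCost_nonneg _ _ _) C
    Bs (by
      rintro g g' rest hCe b hb ⟨⟨v, hv, hvg⟩, ⟨v', hv', hvg'⟩⟩
      obtain ⟨r, hr⟩ := Multiset.le_iff_exists_add.1 hCG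
      have hGe : G = g ::ₘ g' ::ₘ (rest + r) := by
        rw [hr, hCe, Multiset.cons_add, Multiset.cons_add]
      obtain ⟨y, hy, ey⟩ := exists_distTo
        (hG.good g (by rw [hGe]; exact Multiset.mem_cons_self _ _)).nonempty v
      obtain ⟨y', hy', ey'⟩ := exists_distTo (hG.good g' (by
        rw [hGe]; exact Multiset.mem_cons_of_mem (Multiset.mem_cons_self _ _))).nonempty v'
      have h1 := hsep g g' _ hGe y hy y' hy'
      have h2 := siteDist_triangle y v y'
      have h3 := siteDist_triangle v b.1 y'
      have h4 := siteDist_triangle b.1 v' y'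
      have h5 := hsmall b hb
      rw [siteDist_comm] at ey hv'
      omega)
  have hlow : ∀ g ∈ C, (((100 * Θ : ℕ) : ℝ) / S.u) ^ (1 + S.s) ≤
      ∑ b ∈ Bs.filter (touch · g), boxCost S.u S.s b.2 := by
    intro g hg
    obtain ⟨rest, hGe⟩ := Multiset.exists_cons_of_mem (Multiset.mem_of_le hCG hg)
    have hgG := Multiset.mem_of_le hCG hg
    have hgg := hG.good g hgG
    have hgm := hmle g hgG
    refine S.charged_cost hG.sum hGe hG.good hsep (by omega) (hbar _ le_rfl) (hC g hg) hta htN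
      (by omega) (fun b hb => hsz b (Finset.mem_filter.1 hb).1) ?_
    intro v hv hvg
    suffices hsuff : ∃ b ∈ Bs, siteDist v b.1 ≤ b.2 by
      obtain ⟨b, hb, hvb⟩ := hsuff
      exact ⟨b, Finset.mem_filter.2 ⟨hb, v, hvb, hvg⟩, hvb⟩
    rcases H.supp_add_subset _ _ hv with hv | hv
    · rw [upper, supp_restr] at hv
      have hvt : t < S.h v := hv.1
      obtain ⟨y, hy, ey⟩ := exists_distTo hgg.nonempty v
      obtain ⟨x, hx, rfl⟩ := hG.cut g hgG y hy
      have hxh := S.cutClus_ne_zero hx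
      have hly := Lip.abs_le S.lip (ey ▸ hvg : siteDist v (H.corner x) ≤ 100 * Θ)
      push_cast at hly
      have hEΘ : (100 * (Θ : ℤ) + 1) < S.E := by omega
      obtain ⟨b, hb, hvb⟩ := S.covers v ⟨hv.2, by omega, by omega⟩
      have hl := Lip.abs_le S.lip hvb
      have hav' := hav b hb
      have hw : b.2 ≤ Θ := by
        by_contra hbig
        have h1 := hav' (by unfold rad; omega)
        have : |S.h b.1 - t| ≤ b.2 + 100 * Θ + 1 := by rw [abs_le]; constructor <;> omega
        omega
      refine ⟨b, Finset.mem_union_left _ (Finset.mem_filter.2 ⟨hb, hw, ?_, ?_⟩), hvb⟩ <;> omega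
    · obtain ⟨b, hb, hvb⟩ := hst.covers v hv
      exact ⟨b, Finset.mem_union_right _ hb, hvb⟩
  have hcount : (Multiset.card C : ℝ) * (((100 * Θ : ℕ) : ℝ) / S.u) ^ (1 + S.s)
      ≤ cost S.u S.s Bs := by
    refine le_trans (card_mul_le_sum C _ _ hlow) (le_trans (le_of_eq ?_) hsum)
    congr!
  have hcost : cost S.u S.s Bs ≤ cost S.u S.s (S.slice Θ t) + Y :=
    (cost_union_le _ _ _ _).trans (add_le_add le_rfl hst.cost_le)
  refine le_trans (mul_le_mul_of_nonneg_left ?_ (by positivity)) (hcount.trans hcost)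
  have hs := S.s_pos
  have e : ((100 * Θ : ℕ) : ℝ) / S.u = 100 * ((Θ : ℝ) / S.u) := by push_cast; ring
  rw [e, Real.mul_rpow (by norm_num) (by positivity)]
  refine mul_le_mul_of_nonneg_right ?_ (by positivity)
  calc (100 : ℝ) = 100 ^ (1 : ℝ) := by norm_num
    _ ≤ 100 ^ (1 + S.s) := Real.rpow_le_rpow_of_exponent_le (by norm_num) (by linarith)

omit [NeZero L] in
theorem boxCost_spread_mul_le {m Θ : ℕ} (hn : 1 ≤ S.clumpNum) (hm : S.u ≤ m)
    (hmΘ : m ≤ 203 * S.clumpNum * Θ) :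
    boxCost S.u S.s (S.spread * m) ≤ costFactor * (203 * S.spread * S.clumpNum : ℝ) ^ 2
      * ((Θ : ℝ) / S.u) ^ (1 + S.s) := by
  have hu := S.le_u
  have hu0 := S.u_pos
  have hs := S.s_pos
  have hs1 := S.s_le
  have hsp : 1 ≤ S.spread := by unfold spread; omega
  have h1 : m ≤ S.spread * m := Nat.le_mul_of_pos_left _ hsp
  rw [boxCost_of_le (by omega) (by omega), mul_assoc]
  refine mul_le_mul_of_nonneg_left ?_ (by norm_num [costFactor])
  have hk : (1 : ℝ) ≤ 203 * S.spread * S.clumpNum := by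
    have : 1 ≤ 203 * S.spread * S.clumpNum := Nat.mul_pos (by omega) hn
    exact_mod_cast this
  calc (((S.spread * m : ℕ) : ℝ) / S.u) ^ (1 + S.s)
      ≤ ((203 * S.spread * S.clumpNum : ℝ) * (Θ / S.u)) ^ (1 + S.s) := by
        refine Real.rpow_le_rpow (by positivity) ?_ (by linarith)
        rw [mul_div_assoc', div_le_div_iff_of_pos_right hu0]
        have : S.spread * m ≤ S.spread * (203 * S.clumpNum * Θ) := Nat.mul_le_mul_left _ hmΘ
        have : ((S.spread * m : ℕ) : ℝ) ≤ S.spread * (203 * S.clumpNum * Θ) := by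
          exact_mod_cast this
        linarith
    _ = (203 * S.spread * S.clumpNum : ℝ) ^ (1 + S.s) * (Θ / S.u : ℝ) ^ (1 + S.s) :=
        Real.mul_rpow (by positivity) (by positivity)
    _ ≤ _ := by
        refine mul_le_mul_of_nonneg_right ?_ (by positivity)
        rw [← Real.rpow_natCast]
        exact Real.rpow_le_rpow_of_exponent_le hk (by push_cast; linarith)

/-- The available cost is below 200 (Θ/u)^(1+s) and every charged clump uses 100 (Θ/u)^(1+s), so at
most one remains. The neutral ones are created locally and join the repair. -/
theorem CutScale.exists_cut {m M : ℕ} (hc : S.CutScale m M)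
    (hbar : ∀ T, T ≤ 100 * (M * S.scale m) → H.Barrier S.ℓ S.u S.s T) :
    ∃ t O c Dr, S.Cut (M * S.scale m) t O c Dr := by
  classical
  obtain ⟨hM, hqM, hsM, hn, hu2⟩ := hc.unit_pos
  have hu := S.le_u
  have hE := hc.hE
  have hθΘ : S.scale m ≤ M * S.scale m := Nat.le_mul_of_pos_left _ hM
  have hnΘ : M * S.scale m ≤ S.clumpNum * (M * S.scale m) := Nat.le_mul_of_pos_left _ hn
  rw [mul_assoc] at hE
  obtain ⟨t, hta, htN, hav, hcost, hY, hV⟩ := hc.exists_good_level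
  obtain ⟨G₀, O, Dr, hst⟩ := S.exists_state (t := t) m (fun T hT => hbar T (by omega)) (by omega)
    hta htN
  obtain ⟨G, hG, hsep⟩ := hst.finalClumps hc hav hV
  set C := G.filter fun g => ¬ H.Neut S.ℓ g.c with hC
  set Ne := G.filter fun g => H.Neut S.ℓ g.c with hNe
  have hcard := FinalClumps.card_charged_le hc hst hav hG hsep hbar hta htN C
    (Multiset.filter_le _ _) (fun g hg => (Multiset.mem_filter.1 hg).2)
  set Θ := M * S.scale m with hΘ
  have hΘ0 : (0 : ℝ) < Θ := by exact_mod_cast (by omega : 0 < Θ)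
  have hu0 := S.u_pos
  set J := ((Θ : ℝ) / S.u) ^ (1 + S.s) with hJ
  have hJ0 : 0 < J := by positivity
  have hC1 : Multiset.card C ≤ 1 := by
    have h1 : (Multiset.card C : ℝ) * (100 * J) < 2 * (100 * J) := by linarith
    have h2 := lt_of_mul_lt_mul_right h1 (by positivity)
    have : Multiset.card C < 2 := by exact_mod_cast h2
    omega
  obtain ⟨O', Dr', d1, d2, d3, d4, d5, d6⟩ := exists_drop (S := S) (t := t)
    (θ := 203 * S.clumpNum * Θ) (by omega) Ne
    (fun g hg => hG.good g (Multiset.mem_filter.1 hg).1) (fun g hg => (Multiset.mem_filter.1 hg).2)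
    (fun g hg => ⟨hG.le_m g (Multiset.mem_filter.1 hg).1,
      hG.m_le_of_mem (Multiset.mem_filter.1 hg).1⟩)
  have hspr : S.spread * S.scale m ≤ S.spread * (203 * S.clumpNum * Θ) := by
    refine Nat.mul_le_mul_left _ ?_
    rw [mul_assoc]; omega
  have hCcases : C = 0 ∨ ∃ g ∈ G, C = {g} := by
    rcases Nat.le_one_iff_eq_zero_or_eq_one.1 hC1 with h | h
    · exact Or.inl (Multiset.card_eq_zero.1 h)
    · obtain ⟨g, hg⟩ := Multiset.card_eq_one.1 h
      refine Or.inr ⟨g, ?_, hg⟩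
      have : g ∈ C := by rw [hg]; exact Multiset.mem_singleton_self _
      exact (Multiset.mem_filter.1 this).1
  have hcC : (C.map Clump.c).sum = 0 ∨ ∃ g ∈ G, (C.map Clump.c).sum = g.c := by
    rcases hCcases with h | ⟨g, hg, h⟩
    · left; rw [h]; simp
    · right; exact ⟨g, hg, by rw [h]; simp⟩
  refine ⟨t, O + O', (C.map Clump.c).sum, Dr ∪ Dr', hta, htN, ?_, ?_, ?_, ?_, ?_, ?_, ?_, ?_, ?_⟩
  · rw [← hG.sum, syn_add, d1, ← sum_map_filter_add G (fun g => H.Neut S.ℓ g.c), ← hNe, ← hC]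
    abel
  · rcases hcC with h | ⟨g, hg, h⟩
    · rw [h]; intro x y hx; exact absurd rfl hx
    · rw [h]
      intro x y hx hy
      exact ((hG.good g hg).diamLE x y hx hy).trans (hG.m_le_of_mem hg)
  · rcases hcC with h | ⟨g, hg, h⟩
    · rw [h]; intro x hx; exact absurd rfl hx
    · rw [h]; exact (hG.good g hg).cut
  · intro v hv
    rcases H.supp_add_subset _ _ hv with hv | hv
    · refine (hst.height v hv).trans ?_
      exact_mod_cast hspr
    · exact d5 v hv
  · intro v hv
    rcases H.supp_add_subset _ _ hv with hv | hv
    · obtain ⟨w, hw, h⟩ := hst.near_supp v hv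
      exact ⟨w, hw, h.trans hspr⟩
    · exact d6 v hv
  · intro v hv
    rcases H.supp_add_subset _ _ hv with hv | hv
    · obtain ⟨b, hb, h⟩ := hst.covers v hv
      exact ⟨b, Finset.mem_union_left _ hb, h⟩
    · obtain ⟨b, hb, h⟩ := d2 v hv
      exact ⟨b, Finset.mem_union_right _ hb, h⟩
  · intro b hb
    rcases Finset.mem_union.1 hb with hb | hb
    · exact Or.inr (hst.dropped b hb).1
    · exact Or.inr (d3 b hb).1
  · have h1 : (Ne.map fun g => boxCost S.u S.s (S.spread * g.m)).sum ≤
        S.clumpNum * (costFactor * (203 * S.spread * S.clumpNum : ℝ) ^ 2 * J) := by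
      have h2 : (Ne.map fun g => boxCost S.u S.s (S.spread * g.m)).sum ≤
          (Ne.map fun _ => costFactor * (203 * S.spread * S.clumpNum : ℝ) ^ 2 * J).sum := by
        refine Multiset.sum_map_le_sum_map _ _ fun g hg => ?_
        have hgG := (Multiset.mem_filter.1 hg).1
        exact boxCost_spread_mul_le hn (hG.le_m g hgG) (hG.m_le_of_mem hgG)
      refine h2.trans ?_
      rw [Multiset.map_const', Multiset.sum_replicate, nsmul_eq_mul]
      refine mul_le_mul_of_nonneg_right ?_ (by unfold costFactor; positivity)
      exact_mod_cast (Multiset.card_le_card (Multiset.filter_le _ _)).trans hG.card_le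
    have h3 := cost_union_le S.u S.s Dr Dr'
    have h4 := hst.cost_le
    have h5 : S.cutConst * J = J +
        S.clumpNum * (costFactor * (203 * S.spread * S.clumpNum : ℝ) ^ 2 * J) := by
      unfold cutConst; ring
    rw [h5]
    linarith
  -- With total cost below 99 (Θ/u)^(1+s) and dropping cost below (Θ/u)^(1+s), even a single charged
  -- clump is too expensive.
  · intro hW
    have h1 : cost S.u S.s (S.slice Θ t) ≤ cost S.u S.s S.B := cost_mono (Finset.filter_subset _ _)
    have h2 : (Multiset.card C : ℝ) * (100 * J) < 1 * (100 * J) := by linarith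
    have h3 := lt_of_mul_lt_mul_right h2 (by positivity)
    have h4 : Multiset.card C = 0 := by
      have : Multiset.card C < 1 := by exact_mod_cast h3
      omega
    rw [Multiset.card_eq_zero.1 h4]; simp

end Slab
end PauliCode

/-! ### Choice of constants, and a cut in the lower third of a range. -/

namespace PauliCode
open CodeHamiltonian

variable {D L : ℕ} {Q ι : Type} [Fintype Q]

/-- The constants of the coarse-graining: `q` is the ratio of successive scales, `M` relates the
scale of a cut to that of the coarse-graining, `1 + s` is the exponent of the cost. -/
structure Scales (K q M : ℕ) (s : ℝ) : Prop where
  le_K : 1 ≤ K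
  le_q : 4 * (2 * K + 1) ≤ q
  dvd_q : 4 ∣ q
  log_q : 2048 * (costFactor * ((2 * K + 1 : ℕ) : ℝ) ^ 2) + 8 ≤ Real.log q
  s_pos : 0 < s
  s_le : s ≤ 1 / (q + 2) / 2
  costConst_le : 15 * (2 * (costFactor * ((2 * K + 1 : ℕ) : ℝ) ^ 2) * (1 + 192 * q)) ≤ M
  pow_le : (30 * (192 * q + 1)) ^ (q + 2) ≤ M
  rpow_le : ((q * (31000 * (30 * (192 * q + 1)) * (2 * K + 1)) * M : ℕ) : ℝ) ^ s ≤ 102 / 100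

/-- The constants are chosen in the order q, M, s. The exponent s comes last and is so small that
every bounded ratio of scales has s-th power at most 1.02. -/
theorem exists_scales {K : ℕ} (hK : 1 ≤ K) : ∃ q M s, Scales K q M s := by
  obtain ⟨q', hq'⟩ := (((Real.tendsto_log_atTop.comp tendsto_natCast_atTop_atTop).eventually_ge_atTop
    (2048 * (costFactor * ((2 * K + 1 : ℕ) : ℝ) ^ 2) + 8)).and
      (Filter.eventually_ge_atTop (2 * K + 1))).exists
  set q := 4 * q' with hq
  obtain ⟨M', hM'⟩ := exists_nat_ge
    (15 * (2 * (costFactor * ((2 * K + 1 : ℕ) : ℝ) ^ 2) * (1 + 192 * (q : ℝ))))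
  set M := M' + (30 * (192 * q + 1)) ^ (q + 2) with hM
  have hpow : 1 ≤ (30 * (192 * q + 1)) ^ (q + 2) := Nat.one_le_pow _ _ (by omega)
  set x : ℝ := ((q * (31000 * (30 * (192 * q + 1)) * (2 * K + 1)) * M : ℕ) : ℝ) with hx
  have hx1 : 1 < x := by
    have h1 : 1 ≤ q * (31000 * (30 * (192 * q + 1)) * (2 * K + 1)) * M :=
      Nat.mul_pos (Nat.mul_pos (by omega) (by positivity)) (by omega)
    have h2 : 2 ≤ q * (31000 * (30 * (192 * q + 1)) * (2 * K + 1)) * M := by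
      have : q ≤ q * (31000 * (30 * (192 * q + 1)) * (2 * K + 1)) * M := by
        rw [mul_assoc]
        exact Nat.le_mul_of_pos_right _ (Nat.mul_pos (by positivity) (by omega))
      omega
    have : (2 : ℝ) ≤ x := by rw [hx]; exact_mod_cast h2
    linarith
  have hlog : 0 < Real.log x := Real.log_pos hx1
  have hlog2 : 0 < Real.log (102 / 100) := Real.log_pos (by norm_num)
  refine ⟨q, M, min (1 / (q + 2) / 2) (Real.log (102 / 100) / Real.log x), hK, by omega,
    ⟨q', rfl⟩, ?_, ?_, min_le_left _ _, ?_, by omega, ?_⟩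
  · refine hq'.1.trans ?_
    have h0 : (0 : ℝ) < q' := by exact_mod_cast (by omega : 0 < q')
    refine Real.log_le_log h0 ?_
    exact_mod_cast (by omega : q' ≤ q)
  · exact lt_min (by positivity) (by positivity)
  · refine hM'.trans ?_
    exact_mod_cast (by omega : M' ≤ M)
  · rw [← hx]
    calc x ^ _ ≤ x ^ (Real.log (102 / 100) / Real.log x) :=
          Real.rpow_le_rpow_of_exponent_le hx1.le (min_le_right _ _)
      _ = 102 / 100 := by
          rw [Real.rpow_def_of_pos (by linarith), mul_div_cancel₀ _ hlog.ne',
            Real.exp_log (by norm_num)]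

theorem Scales.s_le_one {K q M : ℕ} {s : ℝ} (hS : Scales K q M s) : s ≤ 1 := by
  refine hS.s_le.trans ?_
  rw [div_div, div_le_one (by positivity)]
  have : (0 : ℝ) ≤ q := by positivity
  linarith

/-- A ball of radius w ≥ T/1000 with w ≥ u costs 10⁶ (w/u)^(1+s) ≥ (1000 w/u)^(1+s) ≥ (T/u)^(1+s),
using s ≤ 1. This fixes the value of `costFactor`. -/
theorem thousand_mul_lt {D L : ℕ} {u T : ℕ} {s : ℝ} {B : Finset (Site D L × ℕ)} (hu : 1 ≤ u) (hs : 0 < s)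
    (hs1 : s ≤ 1) (hT : 0 < T) (hB : Sized u B) (hcost : cost u s B < ((T : ℝ) / u) ^ (1 + s))
    {b : Site D L × ℕ} (hb : b ∈ B) : 1000 * b.2 < T := by
  rcases hB b hb with h | h
  · omega
  · by_contra hc
    have h1 : boxCost u s b.2 ≤ cost u s B :=
      Finset.single_le_sum (f := fun b => boxCost u s b.2) (fun _ _ => boxCost_nonneg _ _ _) hb
    rw [boxCost_of_le hu h] at h1
    have hu0 : (0 : ℝ) < u := by exact_mod_cast hu
    have hT' : (T : ℝ) ≤ 1000 * b.2 := by exact_mod_cast not_lt.1 hc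
    have h2 : ((T : ℝ) / u) ^ (1 + s) ≤ costFactor * ((b.2 : ℝ) / u) ^ (1 + s) := by
      calc ((T : ℝ) / u) ^ (1 + s) ≤ (1000 * ((b.2 : ℝ) / u)) ^ (1 + s) := by
            refine Real.rpow_le_rpow (by positivity) ?_ (by linarith)
            rw [mul_div_assoc', div_le_div_iff_of_pos_right hu0]; exact hT'
        _ = (1000 : ℝ) ^ (1 + s) * ((b.2 : ℝ) / u) ^ (1 + s) :=
            Real.mul_rpow (by norm_num) (by positivity)
        _ ≤ costFactor * ((b.2 : ℝ) / u) ^ (1 + s) := by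
            refine mul_le_mul_of_nonneg_right ?_ (by positivity)
            calc (1000 : ℝ) ^ (1 + s) ≤ (1000 : ℝ) ^ (2 : ℝ) :=
                  Real.rpow_le_rpow_of_exponent_le (by norm_num) (by linarith)
              _ = costFactor := by norm_num [costFactor]
    linarith

/-- There is a scale of the form `M u q ^ m` comparable to a given length. -/
theorem exists_scale_le {c u q T : ℕ} (hq : 2 ≤ q) (hc : 1 ≤ c) (hu : 1 ≤ u)
    (hT : c * (u * q) ≤ T) :
    ∃ m, 1 ≤ m ∧ c * (u * q ^ m) ≤ T ∧ T < q * (c * (u * q ^ m)) := by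
  have hex : ∃ m, T < c * (u * q ^ m) := by
    obtain ⟨m, hm⟩ := pow_unbounded_of_one_lt T (by omega : 1 < q)
    refine ⟨m, hm.trans_le ?_⟩
    rw [← mul_assoc]
    exact Nat.le_mul_of_pos_left _ (Nat.mul_pos (by omega) (by omega))
  classical
  have h1 := Nat.find_spec hex
  have h2 : 2 ≤ Nat.find hex := by
    by_contra hlt
    have : q ^ Nat.find hex ≤ q := by
      calc q ^ Nat.find hex ≤ q ^ 1 := Nat.pow_le_pow_right (by omega) (by omega)
        _ = q := pow_one q
    have : c * (u * q ^ Nat.find hex) ≤ c * (u * q) :=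
      Nat.mul_le_mul_left _ (Nat.mul_le_mul_left _ this)
    omega
  obtain ⟨k, hk⟩ := Nat.exists_eq_add_of_le' h2
  refine ⟨k + 1, by omega, not_lt.1 (Nat.find_min hex (by omega)), ?_⟩
  rw [hk] at h1
  refine h1.trans_le (le_of_eq ?_)
  ring

open Classical in
/-- The balls of a family that meet a region. -/
noncomputable def meeting (B : Finset (Site D L × ℕ)) (A : Set (Site D L)) :
    Finset (Site D L × ℕ) :=
  B.filter fun b => ∃ v ∈ A, siteDist v b.1 ≤ b.2

open Classical in
theorem mem_meeting {B : Finset (Site D L × ℕ)} {A : Set (Site D L)} {b : Site D L × ℕ} :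
    b ∈ meeting B A ↔ b ∈ B ∧ ∃ v ∈ A, siteDist v b.1 ≤ b.2 := Finset.mem_filter

open Classical in
theorem meeting_subset (B : Finset (Site D L × ℕ)) (A : Set (Site D L)) : meeting B A ⊆ B :=
  Finset.filter_subset _ _

theorem Covers.meeting {B : Finset (Site D L × ℕ)} {A A' : Set (Site D L)}
    (h : Covers B A) (hA : A' ⊆ A) : Covers (PauliCode.meeting B A') A' := by
  intro v hv
  obtain ⟨b, hb, hvb⟩ := h v (hA hv)
  exact ⟨b, mem_meeting.2 ⟨hb, v, hv, hvb⟩, hvb⟩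

namespace CodeHamiltonian
variable {H : CodeHamiltonian D L Q ι} [NeZero L]

/-- A cut in the lower third of a range of heights most of whose cost is in the upper two
thirds. -/
theorem exists_lower_cut {ℓ K q M u T : ℕ} {s : ℝ} (hS : Scales K q M s) (hfree : H.StringFree ℓ K)
    (hu : 100 ≤ u) (hTu : 2 < ((T : ℝ) / u) ^ s)
    (hbar : ∀ T' < T, H.Barrier ℓ u s T') {F : Pauli Q} {B : Finset (Site D L × ℕ)}
    {h : Site D L → ℤ} (hh : Lip h) (hB : Sized u B) (henc : EnclosedBy ℓ {v | 0 ≤ h v ∧ h v ≤ T})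
    (hF : ∀ a, H.syn F a ≠ 0 → h (H.corner a) ≤ 0 ∨ T ≤ h (H.corner a))
    (hcov : Covers B {v | v ∈ H.supp F ∧ 0 ≤ h v ∧ h v ≤ T})
    (hcost : cost u s B < ((T : ℝ) / u) ^ (1 + s))
    (hhigh : (((T - (T + 2) / 3 : ℕ) : ℝ) / u) ^ (1 + s) ≤
      cost u s (meeting B {v | ((T + 2) / 3 : ℕ) ≤ h v})) :
    1000000 ≤ T ∧ ∃ (t : ℤ) (O : Pauli Q) (c : ι → ZMod 2) (δ : ℕ),
      (T / 100 : ℕ) ≤ t ∧ t + (T / 100 : ℕ) ≤ (32 * T / 100 : ℕ) ∧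
      H.below h (t + 1) (H.syn (H.restr {v | t < h v} F)) = H.syn O + c ∧
      H.DiamLE c δ ∧ K * (δ + 1) ≤ T / 100 ∧
      (∀ x, c x ≠ 0 → t ≤ h (H.corner x) ∧ h (H.corner x) ≤ t + 1) ∧
      ∀ v ∈ H.supp O, |h v - t| ≤ (T / 100 : ℕ) := by
  classical
  have hu0 : (0 : ℝ) < u := by exact_mod_cast (by omega : 0 < u)
  have hs := hS.s_pos
  have hs1 := hS.s_le_one
  have hq := hS.le_q
  have hK := hS.le_K
  set n := 30 * (192 * q + 1) with hn
  set Q₀ := 31000 * n * (2 * K + 1) with hQ₀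
  have hnn : n ≤ n ^ (q + 2) := Nat.le_self_pow (by omega) _
  have hM1 : 1 ≤ M := by have := hS.pow_le; rw [← hn] at this; omega
  have hQ1 : 31000 * 30 ≤ Q₀ := by
    have h1 : 31000 * n ≤ Q₀ := Nat.le_mul_of_pos_right _ (by omega)
    omega
  have hrp := hS.rpow_le
  rw [← hn, ← hQ₀] at hrp
  -- Otherwise T/u would be a bounded ratio, with s-th power at most 1.02 instead of more than 2.
  have hbase : Q₀ * M * (u * q) ≤ T := by
    by_contra hc
    have h1 : ((T : ℝ) / u) ≤ ((q * Q₀ * M : ℕ) : ℝ) := by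
      rw [div_le_iff₀ hu0]
      have : (T : ℝ) ≤ ((Q₀ * M * (u * q) : ℕ) : ℝ) := by exact_mod_cast (not_le.1 hc).le
      push_cast at this ⊢
      linarith
    have := Real.rpow_le_rpow (by positivity) h1 hs.le
    linarith
  obtain ⟨m, hm1, hm2, hm3⟩ := exists_scale_le (by omega : 2 ≤ q)
    (Nat.mul_pos (by omega) hM1 : 1 ≤ Q₀ * M) (by omega : 1 ≤ u) hbase
  set Θ := M * (u * q ^ m) with hΘ
  have hΘ1 : u ≤ Θ := by
    rw [hΘ, mul_left_comm]
    exact Nat.le_mul_of_pos_right _ (Nat.mul_pos hM1 (Nat.pow_pos (by omega)))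
  have hQΘ : Q₀ * Θ ≤ T := by rw [hΘ, ← mul_assoc]; exact hm2
  have hTq : T < q * Q₀ * Θ := by
    rw [mul_assoc, hΘ, ← mul_assoc Q₀]; exact hm3
  have hspn : 31000 * ((2 * K + 1) * (n * Θ)) ≤ T := by
    refine le_trans (le_of_eq ?_) hQΘ
    rw [hQ₀]; ring
  have hnΘ : Θ ≤ n * Θ := Nat.le_mul_of_pos_left _ (by omega)
  have hsp : n * Θ ≤ (2 * K + 1) * (n * Θ) := Nat.le_mul_of_pos_left _ (by omega)
  have hT6 : 1000000 ≤ T := by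
    have : 31000 * 30 * Θ ≤ Q₀ * Θ := Nat.mul_le_mul_right _ hQ1
    omega
  have hTpos : (0 : ℝ) < T := by exact_mod_cast (by omega : 0 < T)
  have hΘ0 : (0 : ℝ) < Θ := by exact_mod_cast (by omega : 0 < Θ)
  have hsmall : ∀ b ∈ B, 1000 * b.2 < T := fun b hb =>
    thousand_mul_lt (by omega) hs hs1 (by omega) hB hcost hb
  set N := 32 * T / 100 with hN
  have hNT : 319 * T ≤ 1000 * N := by
    have h1 := Nat.div_add_mod (32 * T) 100
    have h2 := Nat.mod_lt (32 * T) (by norm_num : 0 < 100)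
    linarith
  have hsp2 : 203 * ((2 * K + 1) * (n * Θ)) ≤ T / 100 := by omega
  have hKδ : K * (203 * n * Θ + 1) ≤ T / 100 := by
    refine le_trans ?_ hsp2
    calc K * (203 * n * Θ + 1) ≤ K * (203 * (n * Θ) + 203 * (n * Θ)) :=
          Nat.mul_le_mul_left _ (by rw [mul_assoc]; omega)
      _ = 203 * (2 * K * (n * Θ)) := by ring
      _ ≤ _ := Nat.mul_le_mul_left _ (Nat.mul_le_mul_right _ (by omega))
  set B₁ := meeting B {v | v ∈ H.supp F ∧ 0 ≤ h v ∧ h v ≤ N} with hB₁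
  -- Radii are below T/1000, while the heights up to 0.32 T and those from T/3 on are more than
  -- T/100 apart.
  have hdisj : Disjoint B₁ (meeting B {v | ((T + 2) / 3 : ℕ) ≤ h v}) := by
    rw [Finset.disjoint_left]
    intro b hb hb'
    obtain ⟨hbB, v, ⟨-, hv0, hvN⟩, hvb⟩ := mem_meeting.1 hb
    obtain ⟨-, w, hw, hwb⟩ := mem_meeting.1 hb'
    have h1 := Lip.abs_le hh hvb
    have h2 := Lip.abs_le hh hwb
    have h3 := hsmall b hbB
    have hw' : (((T + 2) / 3 : ℕ) : ℤ) ≤ h w := hw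
    omega
  have hcostB₁ : cost u s B₁ ≤
      ((T : ℝ) / u) ^ (1 + s) - (((T - (T + 2) / 3 : ℕ) : ℝ) / u) ^ (1 + s) := by
    have h1 : cost u s B₁ + cost u s (meeting B {v | ((T + 2) / 3 : ℕ) ≤ h v}) ≤ cost u s B := by
      unfold cost
      rw [← Finset.sum_union hdisj]
      exact Finset.sum_le_sum_of_subset_of_nonneg
        (Finset.union_subset (meeting_subset _ _) (meeting_subset _ _))
        fun _ _ _ => boxCost_nonneg _ _ _
    linarith
  let S : Slab H :=
    { F := F, B := B₁, h := h, a := 0, N := N, ℓ := ℓ, K := K, u := u, q := q, E := T / 100,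
      s := s, lip := hh, sized := fun b hb => hB b (meeting_subset _ _ hb),
      covers := by
        have h1 : {v | v ∈ H.supp F ∧ 0 ≤ h v ∧ h v ≤ 0 + (N : ℤ)} ⊆
            {v | v ∈ H.supp F ∧ 0 ≤ h v ∧ h v ≤ T} := by
          rintro v ⟨hv, h0, h1⟩
          exact ⟨hv, h0, by omega⟩
        have := Covers.meeting hcov h1
        simp only [zero_add] at this ⊢
        exact this
      nodef := fun x hx => (hF x hx).imp id fun h => by omega
      enc := fun A hA _ => by
        obtain ⟨x, hx⟩ := henc
        refine ⟨x, fun v hv => hx ?_⟩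
        have := hA v hv
        exact ⟨this.1, by have := this.2; omega⟩
      free := hfree, s_pos := hs, s_le := hs1, le_u := hu, le_q := hq,
      dvd_q := hS.dvd_q }
  have hratio : ((T : ℝ) / Θ) ^ s ≤ 102 / 100 := by
    refine le_trans (Real.rpow_le_rpow (by positivity) ?_ hs.le) hrp
    rw [div_le_iff₀ hΘ0]
    have h1 : (T : ℝ) ≤ ((q * Q₀ * Θ : ℕ) : ℝ) := by exact_mod_cast hTq.le
    have h2 : q * Q₀ * Θ ≤ q * Q₀ * M * Θ :=
      Nat.mul_le_mul_right _ (Nat.le_mul_of_pos_right _ hM1)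
    exact h1.trans (by exact_mod_cast h2)
  -- The upper part uses at least 0.98 · 0.66 of the total bound, which leaves at most 0.36
  -- (T/u)^(1+s) below. As N ≥ 0.319 T and (T/Θ)^s ≤ 1.02, the density is at most 1.2 times
  -- (Θ/u)^(1+s)/Θ.
  have hW : 5 * cost u s B₁ * Θ ≤ 6 * N * ((Θ : ℝ) / u) ^ (1 + s) := by
    set r := (66 / 100 : ℝ) with hr
    have h1 : r * T ≤ ((T - (T + 2) / 3 : ℕ) : ℝ) := by
      have : 66 * T ≤ 100 * (T - (T + 2) / 3) := by omega
      have : (66 : ℝ) * T ≤ 100 * ((T - (T + 2) / 3 : ℕ) : ℝ) := by exact_mod_cast this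
      rw [hr]; linarith
    have h2 : (98 / 100 : ℝ) * r * ((T : ℝ) / u) ^ (1 + s) ≤
        (((T - (T + 2) / 3 : ℕ) : ℝ) / u) ^ (1 + s) := by
      have h3 : (98 / 100 : ℝ) ≤ r ^ s := by
        have e1 : (100 / 66 : ℝ) ^ s ≤ 102 / 100 := by
          refine le_trans (Real.rpow_le_rpow (by norm_num) ?_ hs.le) hrp
          have : 2 ≤ q * Q₀ * M := by
            have : q ≤ q * (Q₀ * M) := Nat.le_mul_of_pos_right _ (Nat.mul_pos (by omega) hM1)
            rw [mul_assoc]; omega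
          have : (2 : ℝ) ≤ ((q * Q₀ * M : ℕ) : ℝ) := by exact_mod_cast this
          linarith
        have e2 : r ^ s = ((100 / 66 : ℝ) ^ s)⁻¹ := by
          rw [← Real.inv_rpow (by norm_num), hr]; norm_num
        rw [e2, le_inv_comm₀ (by norm_num) (by positivity)]
        refine e1.trans (by norm_num)
      calc (98 / 100 : ℝ) * r * ((T : ℝ) / u) ^ (1 + s)
          ≤ r ^ s * r * ((T : ℝ) / u) ^ (1 + s) := by
            refine mul_le_mul_of_nonneg_right ?_ (by positivity)
            exact mul_le_mul_of_nonneg_right h3 (by norm_num [hr])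
        _ = (r * (T / u)) ^ (1 + s) := by
            rw [Real.mul_rpow (by norm_num [hr]) (by positivity),
              rpow_one_add (by norm_num [hr] : 0 ≤ r) hs]; ring
        _ ≤ _ := by
            refine Real.rpow_le_rpow (by rw [hr]; positivity) ?_ (by linarith)
            rw [mul_div_assoc', div_le_div_iff_of_pos_right hu0]; exact h1
    have h4 : ((T : ℝ) / u) ^ (1 + s) * Θ ≤ 102 / 100 * T * ((Θ : ℝ) / u) ^ (1 + s) := by
      have e : ((T : ℝ) / u) ^ (1 + s) = T / Θ * (T / Θ) ^ s * ((Θ : ℝ) / u) ^ (1 + s) := by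
        rw [← rpow_one_add (by positivity) hs, ← Real.mul_rpow (by positivity) (by positivity)]
        congr 1; field_simp
      rw [e]
      have : (T : ℝ) / Θ * (T / Θ) ^ s * ((Θ : ℝ) / u) ^ (1 + s) * Θ
        = (T / Θ : ℝ) ^ s * (T * ((Θ : ℝ) / u) ^ (1 + s)) := by field_simp
      rw [this, mul_assoc]
      exact mul_le_mul_of_nonneg_right hratio (by positivity)
    have h5 : (319 / 1000 : ℝ) * T ≤ N := by
      have : (319 : ℝ) * T ≤ 1000 * N := by exact_mod_cast hNT
      linarith
    have h6 : cost u s B₁ ≤ (36 / 100 : ℝ) * ((T : ℝ) / u) ^ (1 + s) := by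
      have : (0 : ℝ) ≤ ((T : ℝ) / u) ^ (1 + s) := by positivity
      rw [hr] at h2
      linarith
    have h7 := mul_le_mul_of_nonneg_right h6 hΘ0.le
    have h8 := mul_le_mul_of_nonneg_right h5 (by positivity : 0 ≤ ((Θ : ℝ) / u) ^ (1 + s))
    have h9 : 0 ≤ (T : ℝ) * ((Θ : ℝ) / u) ^ (1 + s) := by positivity
    linarith
  have hscale : M * S.scale m = Θ := rfl
  have hcs : S.CutScale m M :=
    { hm := hm1
      hlog := hS.log_q
      hsσ := hS.s_le
      costConst_le := hS.costConst_le
      pow_le := hS.pow_le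
      rpow_le := by
        have h1 : (31 * M : ℝ) ≤ ((q * Q₀ * M : ℕ) : ℝ) := by
          have : 31 * M ≤ q * Q₀ * M := Nat.mul_le_mul_right _ (by
            have : Q₀ ≤ q * Q₀ := Nat.le_mul_of_pos_left _ (by omega)
            omega)
          exact_mod_cast this
        have := Real.rpow_le_rpow (by positivity) h1 hs.le
        show (31 * M : ℝ) ^ s ≤ 2
        linarith
      hE := by
        rw [hscale]
        show 300 * n * Θ < T / 100
        rw [mul_assoc]
        omega
      hN := by
        show 20 * (T / 100) ≤ N
        omega
      hW := hW }
  obtain ⟨t, O, c, Dr, hcut⟩ := hcs.exists_cut (fun T' hT' => hbar T' (by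
    rw [hscale] at hT'
    omega))
  rw [hscale] at hcut
  have hcn : S.clumpNum = n := rfl
  have hsn : S.spread = 2 * K + 1 := rfl
  refine ⟨hT6, t, O, c, _, ?_, ?_, hcut.eq, hcut.diam, ?_, ?_, ?_⟩
  · have := hcut.le_t
    have e : S.a = 0 := rfl
    rw [e, zero_add] at this
    exact this
  · have := hcut.t_le
    have e : S.a = 0 := rfl
    rw [e, zero_add] at this
    exact this
  · rw [hcn]; exact hKδ
  · intro x hx
    obtain ⟨h1, h2, -⟩ := S.cutClus_ne_zero (hcut.mem x hx)
    exact ⟨h1, h2⟩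
  · intro v hv
    have h1 := hcut.height v hv
    rw [hcn, hsn] at h1
    refine h1.trans ?_
    have h2 : (2 * K + 1) * (203 * n * Θ) ≤ T / 100 := by
      refine le_trans (le_of_eq ?_) hsp2; ring
    exact_mod_cast h2

end CodeHamiltonian
end PauliCode

/-! ### The induction proving the barrier at all scales. -/

namespace PauliCode
open CodeHamiltonian

variable {D L : ℕ} {Q ι : Type} [Fintype Q]

namespace CodeHamiltonian
variable {H : CodeHamiltonian D L Q ι}

theorem cost_meeting_lt_or {u T : ℕ} {s : ℝ} {B : Finset (Site D L × ℕ)} {A A' : Set (Site D L)}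
    (hA : A' ⊆ A) :
    cost u s (meeting B A') < ((T : ℝ) / u) ^ (1 + s) ∨
      ((T : ℝ) / u) ^ (1 + s) ≤ cost u s (meeting B A) := by
  rcases lt_or_ge (cost u s (meeting B A')) (((T : ℝ) / u) ^ (1 + s)) with h | h
  · exact Or.inl h
  · refine Or.inr (h.trans (cost_mono fun b hb => ?_))
    obtain ⟨hb, v, hv, hvb⟩ := mem_meeting.1 hb
    exact mem_meeting.2 ⟨hb, v, hA hv, hvb⟩

variable [NeZero L]

/-- A cheap upper or lower two thirds reduces to a smaller barrier. If both are expensive, each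
outer third is cheap enough to be cut with one leftover cluster, and string-freeness applied to the
middle piece shows that these leftovers can be created locally. -/
theorem barrier_step {ℓ K q M u T : ℕ} {s : ℝ} (hS : Scales K q M s) (hfree : H.StringFree ℓ K)
    (hu : 100 ≤ u) (hTu : 2 < ((T : ℝ) / u) ^ s) (hbar : ∀ T' < T, H.Barrier ℓ u s T') :
    H.Barrier ℓ u s T := by
  intro F B h hh hB henc hF hcov hcost
  have hs := hS.s_pos
  have hTpos : 100 < T := by
    by_contra hc
    have h1 : (T : ℝ) / u ≤ 1 := by
      refine div_le_one_of_le₀ ?_ (by positivity)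
      exact_mod_cast (by omega : T ≤ u)
    have := Real.rpow_le_one (by positivity) h1 hs.le
    linarith
  have hsub : ∀ {A : Set (Site D L)}, (∀ v ∈ A, h v ≤ T) → EnclosedBy ℓ A := fun hA => by
    obtain ⟨x, hx⟩ := henc
    exact ⟨x, fun v hv => hx (hA v hv)⟩
  rcases cost_meeting_lt_or (u := u) (T := T - (T + 2) / 3) (s := s) (B := B)
    (A := {v | ((T + 2) / 3 : ℕ) ≤ h v})
    (A' := {v | v ∈ H.supp F ∧ ((T + 2) / 3 : ℕ) ≤ h v ∧ h v ≤ T}) (fun v hv => hv.2.1)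
    with hlow | hlow
  -- The height is shifted down by ⌈T/3⌉. There are no defects in between, so the cluster at height
  -- at most 0 is unchanged.
  · obtain ⟨P, hP1, hP2⟩ := hbar (T - (T + 2) / 3) (by omega) F _ (fun v => h v - ((T + 2) / 3 : ℕ))
      (hh.sub_const _) (fun b hb => hB b (meeting_subset _ _ hb))
      (hsub fun v hv => by
        have : h v - ((T + 2) / 3 : ℕ) ≤ (T - (T + 2) / 3 : ℕ) := hv
        omega)
      (fun a ha => (hF a ha).imp (fun h => by omega) (fun h => by omega))
      (by
        rintro v ⟨hv, h0, h1⟩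
        exact Covers.meeting hcov (by rintro v ⟨hv, h0, h1⟩; exact ⟨hv, by omega, h1⟩) v
          ⟨hv, by omega, by omega⟩) hlow
    refine ⟨P, fun v hv => ?_, ?_⟩
    · have : h v - ((T + 2) / 3 : ℕ) ≤ (T - (T + 2) / 3 : ℕ) := hP1 hv
      show h v ≤ T
      omega
    · rw [hP2]
      funext a
      unfold below
      by_cases ha : H.syn F a = 0
      · simp [ha]
      · have := hF a ha
        have e : h (H.corner a) - ((T + 2) / 3 : ℕ) ≤ 0 ↔ h (H.corner a) ≤ 0 := by
          constructor <;> intro h <;> omega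
        simp only [e]
  rcases cost_meeting_lt_or (u := u) (T := T - (T + 2) / 3) (s := s) (B := B)
    (A := {v | ((T + 2) / 3 : ℕ) ≤ T - h v})
    (A' := {v | v ∈ H.supp F ∧ 0 ≤ h v ∧ ((T + 2) / 3 : ℕ) ≤ T - h v}) (fun v hv => hv.2.2)
    with hup | hup
  · obtain ⟨P, hP1, hP2⟩ := hbar (T - (T + 2) / 3) (by omega) F _ h
      hh (fun b hb => hB b (meeting_subset _ _ hb))
      (hsub fun v hv => by
        have : h v ≤ (T - (T + 2) / 3 : ℕ) := hv
        omega)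
      (fun a ha => (hF a ha).imp_right (fun h => by omega))
      (by
        rintro v ⟨hv, h0, h1⟩
        exact Covers.meeting hcov (by rintro v ⟨hv, h0, h1⟩; exact ⟨hv, h0, by omega⟩) v
          ⟨hv, h0, by omega⟩) hup
    refine ⟨P, fun v hv => ?_, hP2⟩
    have : h v ≤ (T - (T + 2) / 3 : ℕ) := hP1 hv
    show h v ≤ T
    omega
  obtain ⟨hT6, t₁, O₁, c₁, δ₁, hEt₁, htN₁, heq₁, hd₁, hK₁, hc₁, hO₁⟩ :=
    exists_lower_cut hS hfree hu hTu hbar hh hB (hsub fun v hv => hv.2) hF hcov hcost hlow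
  -- The upper third is the lower third for the reflected height.
  have hh' : Lip fun v => (T : ℤ) - h v := by
    intro v w
    have := hh v w
    rwa [abs_sub_comm, show ((T : ℤ) - h w) - (T - h v) = h v - h w by ring]
  obtain ⟨-, t₂, O₂, c₂, δ₂, hEt₂, htN₂, heq₂, hd₂, hK₂, hc₂, hO₂⟩ :=
    exists_lower_cut hS hfree hu hTu hbar hh' hB
      (hsub fun v hv => by have := hv.1; show h v ≤ T; linarith)
      (F := F) (fun a ha => (hF a ha).symm.imp (fun h => by linarith) (fun h => by linarith))
      (by
        rintro v ⟨hv, h0, h1⟩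
        exact hcov v ⟨hv, by linarith, by linarith⟩) hcost hup
  set Fm := H.restr {v | t₁ < h v ∧ t₂ < T - h v} F with hFm
  set Fl := H.restr {v | h v ≤ t₁} F with hFl
  have hloc : ∀ {q : Q} {a : ι}, siteDist (H.site q) (H.corner a) ≤ 1 →
      h (H.site q) ≤ h (H.corner a) + 1 ∧ h (H.corner a) ≤ h (H.site q) + 1 := fun hq => by
    have := Lip.abs_le hh hq; exact_mod_cast this
  have hsynF : ∀ {a : ι}, 0 < h (H.corner a) → h (H.corner a) < T → H.syn F a = 0 := by
    intro a h0 h1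
    by_contra hc
    have := hF a hc
    omega
  have hup0 : ∀ {a : ι}, t₁ + 1 < h (H.corner a) → h (H.corner a) < T →
      H.syn (H.restr {v | t₁ < h v} F) a = 0 := by
    intro a h0 h1
    rw [← hsynF (by omega : 0 < h (H.corner a)) h1]
    refine H.syn_congr fun q hq => H.restr_of_mem ?_
    have := hloc hq
    show t₁ < h (H.site q)
    omega
  have hup0' : ∀ {a : ι}, t₂ + 1 < T - h (H.corner a) → 0 < h (H.corner a) →
      H.syn (H.restr {v | t₂ < T - h v} F) a = 0 := by
    intro a h0 h1
    rw [← hsynF h1 (by omega : h (H.corner a) < T)]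
    refine H.syn_congr fun q hq => H.restr_of_mem ?_
    have := hloc hq
    show t₂ < T - h (H.site q)
    omega
  have hlow0 : ∀ {a : ι}, h (H.corner a) < t₁ → H.syn (H.restr {v | t₁ < h v} F) a = 0 := by
    intro a h0
    refine H.syn_eq_zero fun q hq => H.restr_of_notMem ?_
    have := hloc hq
    show ¬ t₁ < h (H.site q)
    omega
  have hlow0' : ∀ {a : ι}, T - h (H.corner a) < t₂ →
      H.syn (H.restr {v | t₂ < T - h v} F) a = 0 := by
    intro a h0
    refine H.syn_eq_zero fun q hq => H.restr_of_notMem ?_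
    have := hloc hq
    show ¬ t₂ < T - h (H.site q)
    omega
  -- Both cuts stay away from the height T/2, so a term below it sees only the lower cut and a term
  -- above it only the upper one.
  have hmid : H.syn Fm = H.below h (t₁ + 1) (H.syn (H.restr {v | t₁ < h v} F))
      + H.below (fun v => T - h v) (t₂ + 1) (H.syn (H.restr {v | t₂ < T - h v} F)) := by
    funext a
    rw [Pi.add_apply]
    unfold below
    dsimp only
    by_cases hcase : h (H.corner a) < T / 2
    · have e1 : H.syn Fm a = H.syn (H.restr {v | t₁ < h v} F) a := by
        refine H.syn_congr fun q hq => ?_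
        have := hloc hq
        by_cases hm : t₁ < h (H.site q)
        · rw [hFm, H.restr_of_mem (show _ ∧ _ from ⟨hm, by omega⟩), H.restr_of_mem hm]
        · rw [hFm, H.restr_of_notMem (fun hh => hm hh.1), H.restr_of_notMem hm]
      rw [e1, if_neg (by omega : ¬ (T - h (H.corner a) ≤ t₂ + 1)), add_zero]
      split_ifs with h1
      · rfl
      · exact hup0 (by omega) (by omega)
    · have e1 : H.syn Fm a = H.syn (H.restr {v | t₂ < T - h v} F) a := by
        refine H.syn_congr fun q hq => ?_
        have := hloc hq
        by_cases hm : t₂ < T - h (H.site q)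
        · rw [hFm, H.restr_of_mem (show _ ∧ _ from ⟨by omega, hm⟩), H.restr_of_mem hm]
        · rw [hFm, H.restr_of_notMem (fun hh => hm hh.2), H.restr_of_notMem hm]
      rw [e1, if_neg (by omega : ¬ (h (H.corner a) ≤ t₁ + 1)), zero_add]
      split_ifs with h1
      · rfl
      · exact hup0' (by omega) (by omega)
  have hchar : ∀ x y z w : ι → ZMod 2, (x + y) + (z + w) + x + z = y + w := by
    intro x y z w
    have h2 : ∀ a b c d : ZMod 2, (a + b) + (c + d) + a + c = b + d := by decide
    funext i; exact h2 _ _ _ _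
  have hO₁T : ∀ v ∈ H.supp O₁, h v ≤ T := fun v hv => by
    have := hO₁ v hv; rw [_root_.abs_le] at this; omega
  -- The middle piece with both repairs creates only the two leftover clusters. They are at least
  -- about T/3 apart, while K (δ + 1) is at most T/100.
  obtain ⟨Oc, hOc, hOcs⟩ := hfree (Fm + O₁ + O₂) c₁ c₂ (max δ₁ δ₂)
    (hsub fun v hv => by
      rcases H.supp_add_subset _ _ hv with hv | hv
      · rcases H.supp_add_subset _ _ hv with hv | hv
        · rw [hFm, supp_restr] at hv
          have := hv.1.2
          omega
        · exact hO₁T v hv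
      · have := hO₂ v hv; rw [_root_.abs_le] at this; omega)
    (by rw [syn_add, syn_add, hmid, heq₁, heq₂, hchar])
    (fun a b ha hb => (hd₁ a b ha hb).trans (le_max_left _ _))
    (fun a b ha hb => (hd₂ a b ha hb).trans (le_max_right _ _))
    (fun a b ha hb => by
      have h1 := hc₁ a ha
      have h2 := hc₂ b hb
      have h3 := Lip.abs_le hh (le_refl (siteDist (H.corner a) (H.corner b)))
      have h4 : K * (max δ₁ δ₂ + 1) ≤ T / 100 := by
        rcases max_choice δ₁ δ₂ with h | h <;> rw [h] <;> assumption
      omega)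
  have hOcT : ∀ v ∈ H.supp Oc, h v ≤ T := fun v hv => by
    obtain ⟨a, ha, hav⟩ := hOcs v hv
    have h1 := hc₁ a ha
    have h4 : K * (max δ₁ δ₂ + 1) ≤ T / 100 := by
      rcases max_choice δ₁ δ₂ with h | h <;> rw [h] <;> assumption
    have h3 := Lip.abs_le hh (hav.trans h4)
    omega
  -- The repair and the local creation of the leftover cluster together make up the defects of the
  -- lower cut, so adding them to the lowest piece cancels everything the cut created.
  refine ⟨Fl + O₁ + Oc, ?_, ?_⟩
  · intro v hv
    rcases H.supp_add_subset _ _ hv with hv | hv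
    · rcases H.supp_add_subset _ _ hv with hv | hv
      · rw [hFl, supp_restr] at hv
        have : h v ≤ t₁ := hv.1
        show h v ≤ T
        omega
      · exact hO₁T v hv
    · exact hOcT v hv
  · have hsplit : H.syn Fl + H.syn (H.restr {v | t₁ < h v} F) = H.syn F := by
      rw [← syn_add]
      have : {v | t₁ < h v} = {v | h v ≤ t₁}ᶜ := by ext v; simp
      rw [this, restr_add_compl]
    rw [syn_add, syn_add, hOc, add_assoc, ← heq₁]
    funext a
    rw [Pi.add_apply]
    have hsa := congrFun hsplit a
    rw [Pi.add_apply] at hsa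
    unfold below
    by_cases h1 : h (H.corner a) ≤ t₁ + 1
    · rw [if_pos h1, hsa]
      split_ifs with h0
      · rfl
      · exact hsynF (by omega) (by omega)
    · rw [if_neg h1, add_zero, if_neg (by omega)]
      refine H.syn_eq_zero fun q hq => H.restr_of_notMem ?_
      have := hloc hq
      show ¬ h (H.site q) ≤ t₁
      omega

theorem barrier {ℓ K q M u : ℕ} {s : ℝ} (hS : Scales K q M s) (hfree : H.StringFree ℓ K)
    (hu : 100 ≤ u) (T : ℕ) : H.Barrier ℓ u s T := by
  induction T using Nat.strong_induction_on with
  | _ T ih =>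
    rcases le_or_gt (((T : ℝ) / u) ^ s) 2 with h | h
    · exact H.barrier_of_small hS.s_pos (by omega) h
    · exact barrier_step hS hfree hu h ih

end CodeHamiltonian
end PauliCode

/-! ### From TQO2 and the no-strings rule to part (1). -/

namespace PauliCode
open CodeHamiltonian

section Metric
variable {D L : ℕ} [NeZero L]

omit [NeZero L] in
theorem val_lt_of_eq_intCast {z : ZMod L} {n : ℤ} {w : ℕ} (hz : z = n) (h0 : 0 ≤ n) (hn : n < w) :
    z.val < w := by
  lift n to ℕ using h0
  rw [hz, Int.cast_natCast, ZMod.val_natCast]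
  exact (Nat.mod_le _ _).trans_lt (by exact_mod_cast hn)

omit [NeZero L] in
theorem exists_eq_add_of_siteDist_le {u v : Site D L} {n : ℕ} (h : siteDist u v ≤ n) (i : Fin D) :
    ∃ e : ℤ, |e| ≤ n ∧ u i = v i + e := by
  refine ⟨(u i - v i).valMinAbs, ?_, ?_⟩
  · have := siteDist_le_iff.1 h i
    rw [Int.abs_eq_natAbs]
    exact_mod_cast this
  · rw [ZMod.coe_valMinAbs]; ring

theorem exists_eq_add_of_mem_cube {u x : Site D L} {n : ℕ} (h : u ∈ cube x n) (i : Fin D) :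
    ∃ e : ℕ, e < n ∧ u i = x i + e :=
  ⟨(u i - x i).val, h i, by rw [ZMod.natCast_zmod_val]; ring⟩

theorem siteDist_le_of_mem_cube₂ {u v x : Site D L} {w : ℕ} (hu : u ∈ cube x (w + 1))
    (hv : v ∈ cube x (w + 1)) : siteDist u v ≤ 2 * w := by
  have h1 := siteDist_triangle u x v
  have h2 := siteDist_le_of_mem_cube hu
  have h3 := siteDist_le_of_mem_cube hv
  rw [siteDist_comm] at h3
  omega

omit [NeZero L] in
/-- The lowest corner of a cube centered at a site. -/
def shift (x : Site D L) (n : ℤ) : Site D L := fun i => x i + n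

omit [NeZero L] in
theorem mem_cube_of_siteDist_le {u x : Site D L} {n w : ℕ} (h : siteDist u x ≤ n)
    (hw : 2 * n < w) : u ∈ cube (shift x (-n)) w := by
  intro i
  obtain ⟨e, he, hu⟩ := exists_eq_add_of_siteDist_le h i
  rw [abs_le] at he
  refine val_lt_of_eq_intCast (n := e + n) ?_ (by omega) (by omega)
  rw [hu, shift]; push_cast; ring

end Metric

namespace CodeHamiltonian
variable {D L : ℕ} {Q ι : Type} [Fintype Q] {H : CodeHamiltonian D L Q ι}

theorem syndrome_eq_of_syn_eq {P : Pauli Q} {S : Set ι} {c : ι → ZMod 2}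
    (h : H.syn P = c) (hc : ∀ a, c a ≠ 0 ↔ a ∈ S) : H.syndrome P = S := by
  ext a; rw [mem_syndrome, h, hc]

theorem syn_eq_of_syndrome_eq {P : Pauli Q} {S : Set ι} {c : ι → ZMod 2}
    (h : H.syndrome P = S) (hc : ∀ a, c a ≠ 0 ↔ a ∈ S) : H.syn P = c := by
  funext a
  have h1 : H.syn P a ≠ 0 ↔ c a ≠ 0 := by rw [← mem_syndrome, h, hc]
  generalize H.syn P a = y at *
  generalize c a = z at *
  revert y z; decide

variable [NeZero L]

omit [Fintype Q] [NeZero L] in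
theorem corner_mem_cell [Fintype Q] (H : CodeHamiltonian D L Q ι) (a : ι) :
    H.corner a ∈ H.cell a := fun i => by
  rw [sub_self, ZMod.val_zero]; omega

theorem cell_subset_cube {a b : ι} {δ : ℕ} (h : siteDist (H.corner a) (H.corner b) ≤ δ) :
    H.cell a ⊆ cube (shift (H.corner b) (-δ)) (2 * δ + 2) := by
  intro v hv i
  obtain ⟨e, he, hu⟩ := exists_eq_add_of_siteDist_le h i
  obtain ⟨f, hf, hv⟩ := exists_eq_add_of_mem_cube hv i
  rw [abs_le] at he
  refine val_lt_of_eq_intCast (n := e + δ + f) ?_ (by omega) (by push_cast; omega)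
  rw [hv, hu, shift]; push_cast; ring

theorem siteDist_le_of_mem_shift {v x : Site D L} {δ : ℕ}
    (h : v ∈ cube (shift x (-δ)) (2 * δ + 2)) : siteDist v x ≤ 3 * δ + 1 := by
  have h1 := siteDist_triangle v (shift x (-δ)) x
  have h2 : siteDist v (shift x (-δ)) ≤ 2 * δ + 1 := siteDist_le_of_mem_cube h
  have h3 : siteDist x (shift x (-δ)) ≤ δ := by
    refine siteDist_le_of_mem_cube fun i => ?_
    refine val_lt_of_eq_intCast (n := δ) ?_ (by omega) (by push_cast; omega)
    rw [shift]; push_cast; ring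
  rw [siteDist_comm] at h3
  omega

/-- Each cluster fits in a box of width 2δ + 2 whose sites are within 3δ + 1 of a corner of the
cluster. If the first were charged, the corners would be within α (2δ + 2) + 6δ + 2 ≤ K (δ + 1). -/
theorem neutral_of_noStrings {ℓ : ℕ} {α : ℝ} {K : ℕ} (hK : 2 * α + 6 ≤ K) (hα : 1 ≤ α)
    (hns : H.NoStrings ℓ α) {P : Pauli Q} {c₁ c₂ : ι → ZMod 2} {δ : ℕ}
    (hP : EnclosedBy ℓ (H.supp P)) (hPs : H.syn P = c₁ + c₂) (h₁ : H.DiamLE c₁ δ)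
    (h₂ : H.DiamLE c₂ δ)
    (hsep : ∀ a b, c₁ a ≠ 0 → c₂ b ≠ 0 → K * (δ + 1) < siteDist (H.corner a) (H.corner b)) :
    H.Neutral ℓ {a | c₁ a ≠ 0} := by
  by_cases hc₂ : c₂ = 0
  · exact ⟨P, hP, syndrome_eq_of_syn_eq hPs fun a => by simp [hc₂]⟩
  by_cases hc₁ : c₁ = 0
  · refine ⟨0, ⟨0, by simp⟩, syndrome_eq_of_syn_eq H.syn_zero fun a => by simp [hc₁]⟩
  obtain ⟨a₂, ha₂⟩ := Function.ne_iff.1 hc₂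
  obtain ⟨a₁, ha₁⟩ := Function.ne_iff.1 hc₁
  have hK8 : 8 ≤ K := by
    have : (8 : ℝ) ≤ K := by linarith
    exact_mod_cast this
  have hK8' : 8 * (δ + 1) ≤ K * (δ + 1) := Nat.mul_le_mul_right _ hK8
  have hdisj : ∀ a, c₁ a ≠ 0 → c₂ a = 0 := by
    intro a h1
    by_contra h2
    have := hsep a a h1 h2
    rw [siteDist_self] at this
    omega
  set x := shift (H.corner a₁) (-δ) with hx
  set y := shift (H.corner a₂) (-δ) with hy
  have hmem : ∀ a, a ∈ H.syndrome P ↔ c₁ a ≠ 0 ∨ c₂ a ≠ 0 := by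
    intro a
    rw [mem_syndrome, hPs, Pi.add_apply]
    by_cases h1 : c₁ a = 0
    · simp [h1]
    · simp [h1, hdisj a h1]
  by_contra hch
  have heq : {a | a ∈ H.syndrome P ∧ H.cell a ⊆ cube x (2 * δ + 2)} = {a | c₁ a ≠ 0} := by
    ext a
    constructor
    · rintro ⟨h1, h2⟩
      rcases (hmem a).1 h1 with h | h
      · exact h
      · have h3 := siteDist_le_of_mem_shift (h2 (H.corner_mem_cell a))
        have h4 := hsep a₁ a ha₁ h
        rw [siteDist_comm] at h4
        omega
    · intro h
      exact ⟨(hmem a).2 (Or.inl h), cell_subset_cube (h₁ a a₁ h ha₁)⟩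
  obtain ⟨u, hu, v, hv, huv⟩ := hns P (2 * δ + 2) x y hP (fun a ha => by
    rcases (hmem a).1 ha with h | h
    · exact Or.inl (cell_subset_cube (h₁ a a₁ h ha₁))
    · exact Or.inr (cell_subset_cube (h₂ a a₂ h ha₂))) (by rw [heq]; exact hch)
  have h1 := siteDist_le_of_mem_shift hu
  have h2 := siteDist_le_of_mem_shift hv
  have h3 := siteDist_triangle (H.corner a₁) u (H.corner a₂)
  have h4 := siteDist_triangle u v (H.corner a₂)
  have h5 := hsep a₁ a₂ ha₁ ha₂
  rw [siteDist_comm] at h1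
  have h6 : K * (δ + 1) < siteDist u v + 6 * δ + 2 := by omega
  have h7 : (K : ℝ) * (δ + 1) < siteDist u v + 6 * δ + 2 := by exact_mod_cast h6
  have h8 : (2 * α + 6) * (δ + 1) ≤ K * ((δ : ℝ) + 1) :=
    mul_le_mul_of_nonneg_right hK (by positivity)
  push_cast at huv
  linarith

/-- The no-strings rule makes the first cluster neutral. TQO2 then creates it next to a smallest
enclosing cube, whose width is at most 2δ + 2. -/
theorem stringFree_of_noStrings {ℓ : ℕ} {α : ℝ} {K : ℕ} (hK : 2 * α + 6 ≤ K) (hα : 1 ≤ α)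
    (htqo : H.TQO2 ℓ) (hns : H.NoStrings ℓ α) : H.StringFree ℓ K := by
  intro P c₁ c₂ δ hP hPs h₁ h₂ hsep
  by_cases hc₁ : c₁ = 0
  · exact ⟨0, by rw [syn_zero, hc₁], by simp⟩
  obtain ⟨a₁, ha₁⟩ := Function.ne_iff.1 hc₁
  have hK8 : 8 ≤ K := by
    have : (8 : ℝ) ≤ K := by linarith
    exact_mod_cast this
  have hK8' : 8 * (δ + 1) ≤ K * (δ + 1) := Nat.mul_le_mul_right _ hK8
  obtain ⟨x, w, ⟨hxw, hmin⟩, E, hE, hES⟩ :=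
    htqo _ (neutral_of_noStrings hK hα hns hP hPs h₁ h₂ hsep)
  have hw : w ≤ 2 * δ + 2 := hmin _ ⟨_, by
    rintro u ⟨a, ha, hu⟩
    exact cell_subset_cube (h₁ a a₁ ha ha₁) hu⟩
  refine ⟨E, syn_eq_of_syndrome_eq hES fun a => Iff.rfl, fun u hu => ⟨a₁, ha₁, ?_⟩⟩
  obtain ⟨v, hv, huv⟩ := hE hu
  have hmono : cube x w ⊆ cube x (2 * δ + 1 + 1) := fun z hz i => (hz i).trans_le hw
  have h1 := siteDist_le_of_mem_cube₂ (hmono hv) (hmono (hxw ⟨a₁, ha₁, H.corner_mem_cell a₁⟩))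
  have h2 := siteDist_triangle u v (H.corner a₁)
  omega

omit [NeZero L] in
theorem exists_supp_finset (H : CodeHamiltonian D L Q ι) (E : Pauli Q) :
    ∃ B : Finset (Site D L × ℕ), Covers B (H.supp E) ∧ (∀ b ∈ B, b.2 = 0) ∧
      ∀ u s, cost u s B ≤ E.weight := by
  classical
  refine ⟨(Finset.univ.filter fun q => E q ≠ 0).image fun q => (H.site q, 0), ?_, ?_, ?_⟩
  · rintro v ⟨q, rfl, hq⟩
    exact ⟨(H.site q, 0), Finset.mem_image.2 ⟨q, by simp [hq], rfl⟩, by simp⟩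
  · intro b hb
    obtain ⟨q, -, rfl⟩ := Finset.mem_image.1 hb
    rfl
  · intro u s
    unfold cost
    have h1 : ∀ b ∈ (Finset.univ.filter fun q => E q ≠ 0).image fun q => (H.site q, (0 : ℕ)),
        boxCost u s b.2 = 1 := by
      intro b hb
      obtain ⟨q, -, rfl⟩ := Finset.mem_image.1 hb
      exact boxCost_zero u s
    rw [Finset.sum_congr rfl h1, Finset.sum_const, nsmul_eq_mul, mul_one]
    exact_mod_cast Finset.card_image_le

/-- A cluster of small diameter that is part of a neutral cluster is enclosed by a small cube. -/
theorem enclosedBy_of_neutral {ℓ r T : ℕ} (hℓ : 2 * ℓ ≤ L) {S S' : Set ι} (hS : H.Neutral ℓ S)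
    (hSS : S' ⊆ S) (hne : S'.Nonempty)
    (hr : ∀ a ∈ S', ∀ b ∈ S', siteDist (H.corner a) (H.corner b) ≤ r) (hT : r + 2 * T < ℓ) :
    EnclosedBy ℓ {v | ∃ a ∈ S', siteDist v (H.corner a) ≤ T} := by
  obtain ⟨P, ⟨x, hx⟩, hP⟩ := hS
  -- Each defect shares a qubit with the enclosed operator, so relative to x - 1 its corner has
  -- coordinates between 0 and ℓ.
  have hco : ∀ a ∈ S', ∀ i, ∃ n : ℕ, n ≤ ℓ ∧ H.corner a i = x i - 1 + n := by
    intro a ha i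
    have h1 : H.syn P a ≠ 0 := by rw [← mem_syndrome, hP]; exact hSS ha
    have h2 : ∃ q, H.gen a q ≠ 0 ∧ P q ≠ 0 := by
      by_contra hc
      push Not at hc
      refine h1 (Finset.sum_eq_zero fun q _ => ?_)
      by_cases hq : H.gen a q = 0
      · simp [hq]
      · simp [hc q hq]
    obtain ⟨q, hq, hPq⟩ := h2
    obtain ⟨e, he, h3⟩ := exists_eq_add_of_mem_cube (H.gen_local a q hq) i
    obtain ⟨f, hf, h4⟩ := exists_eq_add_of_mem_cube (hx (H.mem_supp hPq)) i
    refine ⟨f + 1 - e, by omega, ?_⟩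
    rw [Nat.cast_sub (by omega)]
    push_cast
    linear_combination h4 - h3
  choose! n hn hnc using hco
  obtain ⟨a₀, ha₀⟩ := hne
  have hmin : ∀ i, ∃ a ∈ S', ∀ b ∈ S', n a i ≤ n b i := by
    intro i
    have hne' : {k | ∃ a ∈ S', n a i = k}.Nonempty := ⟨_, a₀, ha₀, rfl⟩
    obtain ⟨a, ha, hae⟩ := Nat.sInf_mem hne'
    exact ⟨a, ha, fun b hb => hae ▸ Nat.sInf_le ⟨b, hb, rfl⟩⟩
  choose m hm hmle using hmin
  refine ⟨fun i => x i - 1 + n (m i) i - T, ?_⟩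
  rintro v ⟨a, ha, hva⟩ i
  obtain ⟨e, he, hv⟩ := exists_eq_add_of_siteDist_le hva i
  rw [abs_le] at he
  have h1 := hmle i a ha
  -- The difference is at most ℓ ≤ L/2, so the periodic distance equals the difference of the
  -- coordinates.
  have h2 : n a i - n (m i) i ≤ r := by
    have h3 := siteDist_le_iff.1 (hr a ha (m i) (hm i)) i
    have h4 : H.corner a i - H.corner (m i) i = ((n a i - n (m i) i : ℕ) : ZMod L) := by
      rw [hnc a ha i, hnc (m i) (hm i) i, Nat.cast_sub h1]; ring
    rw [h4, ZMod.valMinAbs_natCast_of_le_half] at h3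
    · exact_mod_cast h3
    · have := hn a ha i
      omega
  refine val_lt_of_eq_intCast (n := (n a i - n (m i) i : ℕ) + e + T) ?_ (by omega) (by omega)
  rw [hv, hnc a ha i]
  push_cast [Nat.cast_sub h1]
  ring

/-- The barrier with u = 100, T = ⌊R⌋ and the distance to the corners of S' as height: an operator
of smaller weight, covered by single sites, would make S' neutral. -/
theorem weight_lower_bound {ℓ K q M : ℕ} {s : ℝ} (hS : Scales K q M s) (hfree : H.StringFree ℓ K)
    (hℓ : 2 * ℓ ≤ L) {S S' : Set ι} {E : Pauli Q} {r : ℕ} {R : ℝ} (hSn : H.Neutral ℓ S)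
    (hSS : S' ⊆ S) (hch : H.Charged ℓ S')
    (hr : ∀ u ∈ H.region S', ∀ v ∈ H.region S', siteDist u v ≤ r) (hR : 0 ≤ R)
    (hfar : ∀ u ∈ H.region S', ∀ v ∈ H.region (S \ S'), R < (siteDist u v : ℝ))
    (hrR : (r : ℝ) + 2 * R < ℓ) (hE : H.syndrome E = S) :
    ((1 / 200 : ℝ) ^ (1 + s)) * R ^ (1 + s) ≤ E.weight := by
  have hs := hS.s_pos
  have hne : S'.Nonempty := by
    by_contra hc
    rw [Set.not_nonempty_iff_eq_empty] at hc
    refine hch ⟨0, ⟨0, by simp⟩, syndrome_eq_of_syn_eq H.syn_zero fun a => by simp [hc]⟩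
  obtain ⟨a₀, ha₀⟩ := hne
  rw [← Real.mul_rpow (by norm_num) hR]
  -- For R ≤ 200 the bound is at most 1, and E is not the identity. For larger R, ⌊R⌋ ≥ R/2 gives
  -- T/u ≥ R/200.
  rcases le_or_gt R 200 with hsmall | hbig
  · have h1 : (1 / 200 * R) ^ (1 + s) ≤ 1 :=
      Real.rpow_le_one (by positivity) (by linarith) (by linarith)
    refine h1.trans ?_
    have h2 : E ≠ 0 := by
      rintro rfl
      have : a₀ ∈ H.syndrome (0 : Pauli Q) := hE ▸ hSS ha₀
      rw [mem_syndrome, syn_zero] at this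
      exact this rfl
    have : 0 < E.weight := hammingNorm_pos_iff.2 h2
    exact_mod_cast this
  · by_contra hlt
    push Not at hlt
    set T := ⌊R⌋₊ with hT
    have hTR : (T : ℝ) ≤ R := Nat.floor_le hR
    have hRT : R / 2 ≤ T := by
      have := Nat.lt_floor_add_one R
      rw [← hT] at this
      linarith
    have hTpos : 0 < T := by
      have : (0 : ℝ) < T := by linarith
      exact_mod_cast this
    set U : Set (Site D L) := {v | ∃ a ∈ S', H.corner a = v} with hU
    have hUne : U.Nonempty := ⟨_, a₀, ha₀, rfl⟩
    have hcor : ∀ a ∈ S', H.corner a ∈ H.region S' := fun a ha => ⟨a, ha, H.corner_mem_cell a⟩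
    obtain ⟨B, hB1, hB2, hB3⟩ := exists_supp_finset H E
    have hnear : ∀ a ∈ S', distTo U (H.corner a) = 0 := fun a ha => distTo_eq_zero ⟨a, ha, rfl⟩
    have hfar' : ∀ a ∈ S, a ∉ S' → T < distTo U (H.corner a) := by
      intro a ha ha'
      obtain ⟨v, ⟨b, hb, rfl⟩, hv⟩ := exists_distTo hUne (H.corner a)
      rw [← hv, siteDist_comm]
      have := hfar _ (hcor b hb) _ ⟨a, ⟨ha, ha'⟩, H.corner_mem_cell a⟩
      exact_mod_cast hTR.trans_lt this
    have henc : EnclosedBy ℓ {v : Site D L | (distTo U v : ℤ) ≤ T} := by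
      obtain ⟨x, hx⟩ := enclosedBy_of_neutral (T := T) hℓ hSn hSS ⟨a₀, ha₀⟩
        (fun a ha b hb => hr _ (hcor a ha) _ (hcor b hb)) (by
          have : (r : ℝ) + 2 * T < ℓ := by linarith
          exact_mod_cast this)
      refine ⟨x, fun v hv => hx ?_⟩
      obtain ⟨w, ⟨a, ha, rfl⟩, hw⟩ := exists_distTo hUne v
      have hv' : (distTo U v : ℤ) ≤ T := hv
      exact ⟨a, ha, by rw [hw]; exact_mod_cast hv'⟩
    have hmemS : ∀ a, H.syn E a ≠ 0 → a ∈ S := fun a ha => by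
      rw [← hE, mem_syndrome]; exact ha
    obtain ⟨P, hP, hPs⟩ := barrier hS hfree le_rfl T E B (fun v => (distTo U v : ℤ))
      (lip_distTo hUne) (fun b hb => Or.inl (hB2 b hb)) henc (by
        intro a ha
        by_cases h : a ∈ S'
        · left; simp [hnear a h]
        · right; exact_mod_cast (hfar' a (hmemS a ha) h).le) (fun v hv => hB1 v hv.1) (by
        refine (hB3 100 s).trans_lt (hlt.trans_le ?_)
        refine Real.rpow_le_rpow (by positivity) ?_ (by linarith)
        push_cast
        linarith)
    refine hch ⟨P, ?_, syndrome_eq_of_syn_eq hPs fun a => ?_⟩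
    · obtain ⟨x, hx⟩ := henc
      exact ⟨x, hP.trans hx⟩
    · unfold below
      constructor
      · intro h
        split_ifs at h with h0
        · by_contra ha'
          have := hfar' a (hmemS a h) ha'
          have h0' : (distTo U (H.corner a) : ℤ) ≤ 0 := h0
          omega
        · exact absurd rfl h
      · intro ha
        rw [if_pos (by simp [hnear a ha]), ← mem_syndrome, hE]
        exact hSS ha

end CodeHamiltonian

theorem weight_lower_bound_of_noStrings (D : ℕ) (α : ℝ) (hα : 1 ≤ α) :
      ∃ γ c : ℝ, 1 < γ ∧ 0 < c ∧
        ∀ (L : ℕ) [NeZero L] (Q ι : Type) [Fintype Q] [Finite ι]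
          (H : CodeHamiltonian D L Q ι) (Ltqo : ℕ), 2 * Ltqo ≤ L →
          H.TQO1 Ltqo → H.TQO2 Ltqo → H.NoStrings Ltqo α →
          ∀ (S S' : Set ι) (E : Pauli Q) (r : ℕ) (R : ℝ),
            H.Neutral Ltqo S → S' ⊆ S → H.Charged Ltqo S' →
            (∀ u ∈ H.region S', ∀ v ∈ H.region S', siteDist u v ≤ r) →
            0 ≤ R →
            (∀ u ∈ H.region S', ∀ v ∈ H.region (S \ S'), R < (siteDist u v : ℝ)) →
            (r : ℝ) + 2 * R < Ltqo →
            H.syndrome E = S →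
            c * R ^ γ ≤ (E.weight : ℝ) := by
  obtain ⟨K, hK⟩ := exists_nat_ge (2 * α + 6)
  obtain ⟨q, M, s, hS⟩ := exists_scales (K := K) (by
    have : (1 : ℝ) ≤ K := by linarith
    exact_mod_cast this)
  have hs := hS.s_pos
  refine ⟨1 + s, (1 / 200 : ℝ) ^ (1 + s), by linarith, by positivity, ?_⟩
  intro L _ Q ι _ _ H ℓ hℓ _ h2 h3 S S' E r R hSn hSS hch hr hR hfar hrR hE
  exact weight_lower_bound hS (stringFree_of_noStrings hK hα h2 h3) hℓ hSn hSS hch hr hR hfar hrR hE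

end PauliCode

/-! ### Syzygies of f and g, and reduction modulo (f, g). -/

namespace PauliCode

open MvPolynomial

/-- Polynomials in three variables over `𝔽₂`. -/
abbrev Pol : Type := MvPolynomial (Fin 3) (ZMod 2)

/-- The polynomial `1 + x + y + z`. -/
noncomputable def fPol : Pol := 1 + X 0 + X 1 + X 2

/-- The polynomial `1 + xy + yz + zx`. -/
noncomputable def gPol : Pol := 1 + X 0 * X 1 + X 1 * X 2 + X 0 * X 2

theorem pol_two : (2 : Pol) = 0 := by
  have : (2 : Pol) = C 2 := (map_ofNat C 2).symm
  rw [this, show (2 : ZMod 2) = 0 from rfl, C_0]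

/-- Elimination of `z` by means of `f`. -/
noncomputable def elimZ : Pol →ₐ[ZMod 2] Pol := aeval ![X 0, X 1, 1 + X 0 + X 1]

/-- Substituting z = 1 + x + y does not change the class modulo f, since the two maps agree on the
variables. -/
theorem fPol_dvd_sub_elimZ (P : Pol) : fPol ∣ P - elimZ P := by
  set I := Ideal.span {fPol} with hI
  have h : (Ideal.Quotient.mkₐ (ZMod 2) I).comp elimZ = Ideal.Quotient.mkₐ (ZMod 2) I := by
    refine MvPolynomial.algHom_ext fun i => ?_
    simp only [AlgHom.comp_apply, elimZ, aeval_X, Ideal.Quotient.mkₐ_eq_mk]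
    rw [Ideal.Quotient.eq, hI, Ideal.mem_span_singleton]
    fin_cases i
    · simp
    · simp
    · refine ⟨1, ?_⟩
      show (1 + X 0 + X 1 : Pol) - X 2 = _
      rw [fPol]; linear_combination -X 2 * pol_two
  have h2 := DFunLike.congr_fun h P
  simp only [AlgHom.comp_apply, Ideal.Quotient.mkₐ_eq_mk] at h2
  rw [← Ideal.mem_span_singleton, ← hI]
  exact (Ideal.Quotient.eq.1 h2.symm)

theorem elimZ_fPol : elimZ fPol = 0 := by
  simp [fPol, elimZ]
  linear_combination (1 + X 0 + X 1 : Pol) * pol_two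

theorem elimZ_gPol_ne_zero : elimZ gPol ≠ 0 := by
  intro h
  have h2 := congrArg (MvPolynomial.eval (fun _ => (0 : ZMod 2))) h
  simp [gPol, elimZ] at h2

/-- `f` and `g` have no common syzygies besides the trivial ones. -/
theorem exists_of_syzygy {A B : Pol} (h : gPol * A + fPol * B = 0) :
    ∃ P, A = fPol * P ∧ B = gPol * P := by
  have h1 : elimZ A = 0 := by
    have := congrArg elimZ h
    rw [map_add, map_mul, map_mul, elimZ_fPol, zero_mul, add_zero, map_zero] at this
    exact (mul_eq_zero.1 this).resolve_left elimZ_gPol_ne_zero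
  obtain ⟨P, hP⟩ := fPol_dvd_sub_elimZ A
  rw [h1, sub_zero] at hP
  refine ⟨P, hP, ?_⟩
  have hf : fPol ≠ 0 := by
    intro h
    have h2 := congrArg (MvPolynomial.eval (fun _ => (0 : ZMod 2))) h
    simp [fPol] at h2
  refine mul_left_cancel₀ hf ?_
  rw [hP] at h
  linear_combination h - fPol * gPol * P * pol_two

/-- A polynomial is reduced modulo `f` and `g` with coefficients of degree at most `d`. -/
def Red (d : ℕ) (S : Pol) : Prop :=
  ∃ (A B : Pol) (p q : Polynomial (ZMod 2)), A.totalDegree ≤ d ∧ B.totalDegree ≤ d ∧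
    p.natDegree ≤ d ∧ q.natDegree ≤ d ∧
    S = gPol * A + fPol * B + (Polynomial.aeval (X 0) p + X 1 * Polynomial.aeval (X 0) q)

theorem Red.mono {d d' : ℕ} {S : Pol} (h : Red d S) (hd : d ≤ d') : Red d' S := by
  obtain ⟨A, B, p, q, h1, h2, h3, h4, h5⟩ := h
  exact ⟨A, B, p, q, h1.trans hd, h2.trans hd, h3.trans hd, h4.trans hd, h5⟩

theorem Red.add {d : ℕ} {S S' : Pol} (h : Red d S) (h' : Red d S') : Red d (S + S') := by
  obtain ⟨A, B, p, q, h1, h2, h3, h4, h5⟩ := h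
  obtain ⟨A', B', p', q', h1', h2', h3', h4', h5'⟩ := h'
  refine ⟨A + A', B + B', p + p', q + q', ?_, ?_, ?_, ?_, ?_⟩
  · exact (totalDegree_add _ _).trans (max_le h1 h1')
  · exact (totalDegree_add _ _).trans (max_le h2 h2')
  · exact (Polynomial.natDegree_add_le _ _).trans (max_le h3 h3')
  · exact (Polynomial.natDegree_add_le _ _).trans (max_le h4 h4')
  · rw [h5, h5', map_add, map_add]; ring

theorem totalDegree_aeval_X_le (p : Polynomial (ZMod 2)) :
    (Polynomial.aeval (X 0 : Pol) p).totalDegree ≤ p.natDegree := by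
  rw [Polynomial.aeval_eq_sum_range]
  refine totalDegree_finsetSum_le fun i hi => ?_
  refine (totalDegree_smul_le _ _).trans ?_
  rw [totalDegree_X_pow]
  have := Finset.mem_range.1 hi
  omega

theorem totalDegree_X_mul_le (i : Fin 3) {S : Pol} {d : ℕ} (h : S.totalDegree ≤ d) :
    (X i * S).totalDegree ≤ d + 1 := by
  refine (totalDegree_mul _ _).trans ?_
  rw [totalDegree_X]; omega

/-- Modulo (f, g) the remainders have the form p(x) + y q(x): f eliminates z, and after this g
expresses y² through lower powers of y. Tracking the quotients shows that each multiplication by a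
variable raises the degrees by at most 2. -/
theorem Red.X_mul {d : ℕ} {S : Pol} (h : Red d S) (i : Fin 3) : Red (d + 2) (X i * S) := by
  have key0 : ∀ {d S}, Red d S → Red (d + 1) (X 0 * S) := by
    rintro d S ⟨A, B, p, q, h1, h2, h3, h4, h5⟩
    refine ⟨X 0 * A, X 0 * B, Polynomial.X * p, Polynomial.X * q, totalDegree_X_mul_le 0 h1,
      totalDegree_X_mul_le 0 h2, ?_, ?_, ?_⟩
    · refine Polynomial.natDegree_mul_le.trans ?_
      rw [Polynomial.natDegree_X]; omega
    · refine Polynomial.natDegree_mul_le.trans ?_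
      rw [Polynomial.natDegree_X]; omega
    · rw [h5]; simp; ring
  -- In characteristic 2, y² = g + (x + y) f + (1 + x) y + (1 + x + x²).
  have key1 : ∀ {d S}, Red d S → Red (d + 2) (X 1 * S) := by
    rintro d S ⟨A, B, p, q, h1, h2, h3, h4, h5⟩
    have hq := totalDegree_aeval_X_le q
    refine ⟨X 1 * A + Polynomial.aeval (X 0) q,
      X 1 * B + (X 0 * Polynomial.aeval (X 0) q + X 1 * Polynomial.aeval (X 0) q),
      (1 + Polynomial.X + Polynomial.X ^ 2) * q, p + (1 + Polynomial.X) * q, ?_, ?_, ?_, ?_, ?_⟩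
    · refine (totalDegree_add _ _).trans (max_le ?_ (by omega))
      exact (totalDegree_X_mul_le 1 h1).trans (by omega)
    · refine (totalDegree_add _ _).trans (max_le ?_ ?_)
      · exact (totalDegree_X_mul_le 1 h2).trans (by omega)
      · refine (totalDegree_add _ _).trans (max_le ?_ ?_)
        · exact (totalDegree_X_mul_le 0 hq).trans (by omega)
        · exact (totalDegree_X_mul_le 1 hq).trans (by omega)
    · refine Polynomial.natDegree_mul_le.trans ?_
      have : (1 + Polynomial.X + Polynomial.X ^ 2 : Polynomial (ZMod 2)).natDegree ≤ 2 := by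
        compute_degree
      omega
    · refine (Polynomial.natDegree_add_le _ _).trans (max_le (by omega) ?_)
      refine Polynomial.natDegree_mul_le.trans ?_
      have : (1 + Polynomial.X : Polynomial (ZMod 2)).natDegree ≤ 1 := by compute_degree
      omega
    · rw [h5]
      simp only [map_add, map_mul, map_pow, map_one, Polynomial.aeval_X]
      generalize Polynomial.aeval (X 0 : Pol) p = p'
      generalize Polynomial.aeval (X 0 : Pol) q = q'
      unfold gPol fPol
      linear_combination (-(1 + X 0 + X 1 + X 0 ^ 2 + X 0 * X 1 + X 0 * X 2 + X 1 * X 2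
        + X 0 * X 1) * q') * pol_two
  have key2 : ∀ {d S}, Red d S → Red (d + 2) (X 2 * S) := by
    intro d S h
    have e : X 2 * S = (S + X 0 * S + X 1 * S) + fPol * S := by
      unfold fPol; linear_combination (-(S + X 0 * S + X 1 * S)) * pol_two
    obtain ⟨A, B, p, q, h1, h2, h3, h4, h5⟩ := id h
    set R := Polynomial.aeval (X 0 : Pol) p + X 1 * Polynomial.aeval (X 0) q with hR
    have e2 : X 2 * S = (S + X 0 * S + X 1 * S) + (gPol * (fPol * A) + fPol * (fPol * B + R)) := by
      rw [e, h5]; ring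
    have hfdeg : fPol.totalDegree ≤ 1 := by
      unfold fPol
      refine (totalDegree_add _ _).trans (max_le ?_ (by rw [totalDegree_X]))
      refine (totalDegree_add _ _).trans (max_le ?_ (by rw [totalDegree_X]))
      refine (totalDegree_add _ _).trans (max_le (by simp) (by rw [totalDegree_X]))
    rw [e2]
    refine Red.add (Red.add (Red.add (h.mono (by omega)) ((key0 h).mono (by omega))) (key1 h)) ?_
    refine ⟨fPol * A, fPol * B + R, 0, 0, ?_, ?_, by simp, by simp, by simp⟩
    · exact (totalDegree_mul _ _).trans (by omega)
    · refine (totalDegree_add _ _).trans (max_le ((totalDegree_mul _ _).trans (by omega)) ?_)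
      refine (totalDegree_add _ _).trans (max_le ((totalDegree_aeval_X_le p).trans (by omega)) ?_)
      exact (totalDegree_X_mul_le 1 (totalDegree_aeval_X_le q)).trans (by omega)
  fin_cases i
  · exact (key0 h).mono (by omega)
  · exact key1 h
  · exact key2 h

theorem red_monomial (k : ℕ) : ∀ (n : Fin 3 →₀ ℕ) (c : ZMod 2), n.degree = k →
    Red (2 * k) (monomial n c) := by
  induction k with
  | zero =>
    intro n c hn
    rw [Finsupp.degree_eq_zero_iff] at hn
    subst hn
    exact ⟨0, 0, Polynomial.C c, 0, by simp, by simp, by simp, by simp, by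
      simp [MvPolynomial.algebraMap_eq]⟩
  | succ k ih =>
    intro n c hn
    have hne : n ≠ 0 := by rintro rfl; simp at hn
    obtain ⟨i, hi⟩ := Finsupp.ne_iff.1 hne
    have hle : Finsupp.single i 1 ≤ n := by
      rw [Finsupp.single_le_iff]
      exact Nat.one_le_iff_ne_zero.2 hi
    obtain ⟨m, rfl⟩ := exists_add_of_le hle
    have hm : m.degree = k := by
      rw [map_add, Finsupp.degree_single] at hn; omega
    have := (ih m c hm).X_mul i
    rw [X, monomial_mul, one_mul] at this
    exact this.mono (by omega)

theorem red_of_totalDegree_le {S : Pol} {d : ℕ} (h : S.totalDegree ≤ d) : Red (2 * d) S := by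
  rw [S.as_sum]
  have key : ∀ s : Finset (Fin 3 →₀ ℕ), s ⊆ S.support →
      Red (2 * d) (∑ n ∈ s, monomial n (coeff n S)) := by
    intro s
    induction s using Finset.induction_on with
    | empty => intro _; exact ⟨0, 0, 0, 0, by simp, by simp, by simp, by simp, by simp⟩
    | insert n s hn ih =>
      intro hs
      rw [Finset.sum_insert hn]
      refine Red.add ?_ (ih ((Finset.subset_insert _ _).trans hs))
      refine (red_monomial _ n _ rfl).mono ?_
      have h1 := le_totalDegree (hs (Finset.mem_insert_self _ _))
      have h2 : n.degree = n.sum fun _ e => e := rfl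
      rw [h2]
      omega
  exact key _ subset_rfl

end PauliCode

/-! ### The charge map: restriction to a line over 𝔽₄. -/

namespace PauliCode

open MvPolynomial

/-- A field containing the cube roots of unity. -/
abbrev Clos : Type := AlgebraicClosure (ZMod 2)

theorem exists_omega : ∃ w : Clos, w ^ 2 = w + 1 := by
  obtain ⟨w, hw⟩ := IsAlgClosed.exists_root
    (Polynomial.X ^ 2 - Polynomial.X - 1 : Polynomial Clos) (by
      have : (Polynomial.X ^ 2 - Polynomial.X - 1 : Polynomial Clos).degree = 2 := by
        compute_degree!
      rw [this]; norm_num)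
  refine ⟨w, ?_⟩
  simp only [Polynomial.IsRoot.def, Polynomial.eval_sub, Polynomial.eval_pow, Polynomial.eval_X,
    Polynomial.eval_one] at hw
  linear_combination hw

/-- A primitive cube root of unity. -/
noncomputable def om : Clos := exists_omega.choose

theorem om_sq : om ^ 2 = om + 1 := exists_omega.choose_spec

theorem clos_two : (2 : Clos) = 0 := by
  have : (2 : Clos) = algebraMap (ZMod 2) Clos 2 := (map_ofNat _ 2).symm
  rw [this, show (2 : ZMod 2) = 0 from rfl, map_zero]

/-- The slopes of the charge map. -/
noncomputable def slope : Fin 3 → Clos := ![1, om, om + 1]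

/-- The roots of the images of the variables under the charge map. -/
noncomputable def root : Fin 3 → Clos := ![0, om, om + 1]

/-- The charge map, whose kernel is the ideal generated by `f` and `g`. -/
noncomputable def charge : Pol →ₐ[ZMod 2] Polynomial Clos :=
  aeval fun i => Polynomial.C (slope i) * (Polynomial.X - Polynomial.C (root i))

theorem charge_X (i : Fin 3) :
    charge (X i) = Polynomial.C (slope i) * (Polynomial.X - Polynomial.C (root i)) := by
  rw [charge, aeval_X]

theorem polynomial_two : (2 : Polynomial Clos) = 0 := by
  have : (2 : Polynomial Clos) = Polynomial.C 2 := (map_ofNat _ 2).symm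
  rw [this, clos_two, Polynomial.C_0]

theorem C_om_sq : (Polynomial.C om) ^ 2 = Polynomial.C om + 1 := by
  rw [← Polynomial.C_pow, om_sq, Polynomial.C_add, Polynomial.C_1]

theorem charge_X0 : charge (X 0) = Polynomial.X := by
  rw [charge_X]; simp [slope, root]

theorem charge_X1 : charge (X 1) = Polynomial.C om * Polynomial.X + Polynomial.C om + 1 := by
  rw [charge_X]
  simp only [slope, root, Matrix.cons_val_one, Matrix.cons_val_zero]
  linear_combination (-1 : Polynomial Clos) * C_om_sq
    - (Polynomial.C om + 1) * polynomial_two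

theorem charge_X2 : charge (X 2) = (Polynomial.C om + 1) * Polynomial.X + Polynomial.C om := by
  rw [charge_X]
  simp only [slope, root, Matrix.cons_val, map_add, map_one]
  linear_combination (-1 : Polynomial Clos) * C_om_sq
    - (2 * Polynomial.C om + 1) * polynomial_two

theorem charge_fPol : charge fPol = 0 := by
  rw [fPol, map_add, map_add, map_add, map_one, charge_X0, charge_X1, charge_X2]
  linear_combination (1 + Polynomial.X + Polynomial.C om * Polynomial.X + Polynomial.C om)
    * polynomial_two

theorem charge_gPol : charge gPol = 0 := by
  rw [gPol, map_add, map_add, map_add, map_one, map_mul, map_mul, map_mul, charge_X0, charge_X1,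
    charge_X2]
  set w := Polynomial.C om
  set T : Polynomial Clos := Polynomial.X
  have h2 := polynomial_two
  have h : w ^ 2 = w + 1 := C_om_sq
  linear_combination (T ^ 2 + 2 * T + 1) * h + (1 + T + T ^ 2 + 2 * w * T ^ 2 + 2 * T * w
    + T + w * T + w) * h2

theorem om_ne_zero : om ≠ 0 := by
  intro h
  have := om_sq
  rw [h] at this
  simp at this

theorem om_add_one_ne_zero : om + 1 ≠ 0 := by
  rw [← om_sq]; exact pow_ne_zero 2 om_ne_zero

theorem slope_ne_zero (i : Fin 3) : slope i ≠ 0 := by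
  fin_cases i
  · exact one_ne_zero
  · exact om_ne_zero
  · exact om_add_one_ne_zero

/-- The variables vanish at three distinct points of the line, so the exponents of a monomial can be
read off as multiplicities of roots. -/
theorem root_injective : Function.Injective root := by
  have h1 : root 0 = 0 := rfl
  have h2 : root 1 = om := rfl
  have h3 : root 2 = om + 1 := rfl
  intro i j h
  fin_cases i <;> fin_cases j <;>
    simp [h1, h2, h3, om_ne_zero, om_add_one_ne_zero, om_ne_zero.symm, om_add_one_ne_zero.symm]
      at h ⊢

/-- Linear independence of 1 and ω over 𝔽₂, checked on the four pairs. -/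
theorem algebraMap_eq_zero_of_add {a b : ZMod 2}
    (h : algebraMap (ZMod 2) Clos a + om * algebraMap (ZMod 2) Clos b = 0) : a = 0 ∧ b = 0 := by
  have hb : ∀ c : ZMod 2, c = 0 ∨ c = 1 := by decide
  have h2 := clos_two
  have h3 := om_sq
  have h4 := om_ne_zero
  have h5 := om_add_one_ne_zero
  rcases hb a with rfl | rfl <;> rcases hb b with rfl | rfl
  · exact ⟨rfl, rfl⟩
  · rw [map_zero, map_one] at h
    exact absurd (by linear_combination h) h4
  · rw [map_zero, map_one] at h
    simp at h
  · rw [map_one] at h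
    exact absurd (by linear_combination h) h5

/-- A polynomial in the kernel of the charge map is in the ideal generated by `f` and `g`, with
coefficients of bounded degree. -/
theorem exists_of_charge_eq_zero {S : Pol} {d : ℕ} (hd : S.totalDegree ≤ d) (h : charge S = 0) :
    ∃ A B : Pol, A.totalDegree ≤ 2 * d ∧ B.totalDegree ≤ 2 * d ∧ gPol * A + fPol * B = S := by
  obtain ⟨A, B, p, q, h1, h2, -, -, h5⟩ := red_of_totalDegree_le hd
  have hae : ∀ r : Polynomial (ZMod 2),
      charge (Polynomial.aeval (X 0) r) = r.map (algebraMap (ZMod 2) Clos) := by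
    intro r
    have e : Polynomial.aeval (Polynomial.X : Polynomial Clos) = Polynomial.mapAlg (ZMod 2) Clos :=
      Polynomial.algHom_ext (by simp [Polynomial.mapAlg_eq_map])
    rw [← Polynomial.aeval_algHom_apply, charge_X0, e, Polynomial.mapAlg_eq_map]
  have h6 : (p + q).map (algebraMap (ZMod 2) Clos) + Polynomial.C om *
      ((Polynomial.X + 1) * q).map (algebraMap (ZMod 2) Clos) = 0 := by
    rw [h5, map_add, map_add, map_mul, map_mul, charge_fPol, charge_gPol, zero_mul, zero_mul,
      add_zero, zero_add, map_add, map_mul, hae, hae, charge_X1] at h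
    rw [Polynomial.map_add, Polynomial.map_mul, Polynomial.map_add, Polynomial.map_X,
      Polynomial.map_one]
    linear_combination h
  -- The remainder p + yq maps to (p + q) + ω (T + 1) q, where T is the parameter of the line.
  -- Independence of 1 and ω separates the two parts coefficientwise.
  have h7 : p + q = 0 ∧ (Polynomial.X + 1) * q = 0 := by
    have : ∀ k, (p + q).coeff k = 0 ∧ ((Polynomial.X + 1) * q).coeff k = 0 := by
      intro k
      have := congrArg (Polynomial.coeff · k) h6
      simp only [Polynomial.coeff_add, Polynomial.coeff_map, Polynomial.coeff_C_mul,
        Polynomial.coeff_zero] at this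
      rw [Polynomial.coeff_add]
      exact algebraMap_eq_zero_of_add this
    exact ⟨Polynomial.ext fun k => (this k).1, Polynomial.ext fun k => (this k).2⟩
  have hq : q = 0 := by
    refine (mul_eq_zero.1 h7.2).resolve_left ?_
    exact Polynomial.X_add_C_ne_zero (1 : ZMod 2)
  have hp : p = 0 := by
    have := h7.1
    rwa [hq, add_zero] at this
  refine ⟨A, B, h1, h2, ?_⟩
  rw [h5, hp, hq]
  simp

/-- The monomial with a given exponent. -/
noncomputable def mon (a : Fin 3 → ℕ) : Pol := ∏ i, X i ^ a i

theorem charge_mon (a : Fin 3 → ℕ) : charge (mon a) =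
    ∏ i, (Polynomial.C (slope i) * (Polynomial.X - Polynomial.C (root i))) ^ a i := by
  simp only [mon, map_prod, map_pow, charge_X]

theorem charge_mon_ne_zero (a : Fin 3 → ℕ) : charge (mon a) ≠ 0 := by
  rw [charge_mon]
  refine Finset.prod_ne_zero_iff.2 fun i _ => pow_ne_zero _ (mul_ne_zero ?_ ?_)
  · exact Polynomial.C_ne_zero.2 (slope_ne_zero i)
  · exact Polynomial.X_sub_C_ne_zero _

open Classical in
theorem count_roots_charge_mon (a : Fin 3 → ℕ) (i : Fin 3) :
    (charge (mon a)).roots.count (root i) = a i := by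
  have h0 := charge_mon_ne_zero a
  rw [charge_mon, Fin.prod_univ_three] at h0 ⊢
  rw [Polynomial.roots_mul h0, Polynomial.roots_mul (left_ne_zero_of_mul h0)]
  simp only [Polynomial.roots_pow, Polynomial.roots_C_mul _ (slope_ne_zero _),
    Polynomial.roots_X_sub_C, Multiset.count_add, Multiset.count_nsmul, Multiset.count_singleton,
    root_injective.eq_iff]
  fin_cases i <;> simp

theorem natDegree_charge_le {S : Pol} {d : ℕ} (hd : S.totalDegree ≤ d) :
    (charge S).natDegree ≤ d := by
  rw [S.as_sum, map_sum]
  refine Polynomial.natDegree_sum_le_of_forall_le _ _ fun n hn => ?_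
  rw [charge, aeval_monomial]
  refine Polynomial.natDegree_mul_le.trans ?_
  have h1 : (algebraMap (ZMod 2) (Polynomial Clos) (coeff n S)).natDegree = 0 := by
    rw [IsScalarTower.algebraMap_apply (ZMod 2) Clos (Polynomial Clos)]
    exact Polynomial.natDegree_C _
  have h2 := Polynomial.natDegree_prod_le n.support fun i =>
    (Polynomial.C (slope i) * (Polynomial.X - Polynomial.C (root i))) ^ n i
  have h3 : ∑ i ∈ n.support, ((Polynomial.C (slope i) *
      (Polynomial.X - Polynomial.C (root i))) ^ n i).natDegree ≤ ∑ i ∈ n.support, n i := by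
    refine Finset.sum_le_sum fun i _ => ?_
    refine Polynomial.natDegree_pow_le.trans ?_
    refine (Nat.mul_le_mul_left _ ((Polynomial.natDegree_C_mul_le _ _).trans
      (Polynomial.natDegree_X_sub_C_le _))).trans (mul_one _).le
  have h4 := le_totalDegree hn
  rw [h1, zero_add]
  exact h2.trans (h3.trans (h4.trans hd))

/-- Two charged clusters that compensate each other are close to each other. -/
theorem charge_eq_zero_of_far {S₁ S₂ : Pol} {a b : Fin 3 → ℕ} {d : ℕ} (h₁ : S₁.totalDegree ≤ d)
    (h₂ : S₂.totalDegree ≤ d) (h : charge (mon a * S₁ + mon b * S₂) = 0) {i : Fin 3}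
    (hi : b i + d < a i ∨ a i + d < b i) : charge S₁ = 0 := by
  classical
  by_contra hne
  rw [map_add, map_mul, map_mul] at h
  have ha := charge_mon_ne_zero a
  have hb := charge_mon_ne_zero b
  have heq : charge (mon a) * charge S₁ = charge (mon b) * charge S₂ := by
    linear_combination h - charge (mon b) * charge S₂ * polynomial_two
  have hne₂ : charge S₂ ≠ 0 := by
    intro h0
    rw [h0, mul_zero] at heq
    exact (mul_ne_zero ha hne) heq
  -- Multiplicities at the root of the i-th variable: a i and b i, each increased by at most d, must
  -- agree.
  have h3 := congrArg (fun p => p.roots.count (root i)) heq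
  simp only [Polynomial.roots_mul (mul_ne_zero ha hne), Polynomial.roots_mul (mul_ne_zero hb hne₂),
    Multiset.count_add, count_roots_charge_mon] at h3
  have h4 := ((Multiset.count_le_card (root i) _).trans (Polynomial.card_roots' (charge S₁))).trans
    (natDegree_charge_le h₁)
  have h5 := ((Multiset.count_le_card (root i) _).trans (Polynomial.card_roots' (charge S₂))).trans
    (natDegree_charge_le h₂)
  omega

end PauliCode

/-! ### Transfer between polynomials and the group algebra of the torus. -/

namespace PauliCode

open MvPolynomial

section Torus
variable {L : ℕ}

/-- The group algebra of the three-dimensional periodic lattice. -/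
abbrev Tor (L : ℕ) : Type := AddMonoidAlgebra (ZMod 2) (Site 3 L)

/-- The translation of the group algebra by a lattice vector. -/
noncomputable def tr (u : Site 3 L) : Tor L := AddMonoidAlgebra.single u 1

/-- Reduction of the exponents of a polynomial modulo the size of the lattice. -/
noncomputable def wrap (L : ℕ) : Pol →ₐ[ZMod 2] Tor L := aeval fun i => tr (Pi.single i 1)

theorem tr_zero : tr (0 : Site 3 L) = 1 := rfl

theorem tr_add (u v : Site 3 L) : tr (u + v) = tr u * tr v := by
  simp [tr, AddMonoidAlgebra.single_mul_single]

theorem coeff_tr_mul (u v : Site 3 L) (a : Tor L) : (tr u * a).coeff v = a.coeff (v - u) := by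
  rw [tr, AddMonoidAlgebra.coeff_single_mul_apply, one_mul, neg_add_eq_sub]

theorem tr_mul_left_cancel {u : Site 3 L} {a b : Tor L} (h : tr u * a = tr u * b) : a = b := by
  have h1 := congrArg (tr (-u) * ·) h
  simp only [← mul_assoc, ← tr_add, neg_add_cancel, tr_zero, one_mul] at h1
  exact h1

/-- The lattice site of an exponent. -/
def siteOf (L : ℕ) (n : Fin 3 →₀ ℕ) : Site 3 L := fun i => (n i : ZMod L)

theorem wrap_monomial (n : Fin 3 →₀ ℕ) (c : ZMod 2) :
    wrap L (monomial n c) = AddMonoidAlgebra.single (siteOf L n) c := by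
  have key : ∀ (u : Site 3 L) (k : ℕ), tr u ^ k = tr (k • u) := by
    intro u k
    induction k with
    | zero => simp [tr_zero]
    | succ k ih => rw [pow_succ, ih, succ_nsmul, tr_add]
  rw [wrap, aeval_monomial, Finsupp.prod_fintype _ _ (fun i => pow_zero _), Fin.prod_univ_three,
    key, key, key, ← tr_add, ← tr_add]
  have e : n 0 • (Pi.single 0 1 : Site 3 L) + n 1 • Pi.single 1 1 + n 2 • Pi.single 2 1
      = siteOf L n := by
    funext i
    fin_cases i <;> simp [siteOf]
  rw [e, tr, Algebra.algebraMap_eq_smul_one, smul_mul_assoc, one_mul]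
  simp

theorem coeff_wrap (S : Pol) (v : Site 3 L) :
    (wrap L S).coeff v = ∑ n ∈ S.support, if siteOf L n = v then coeff n S else 0 := by
  classical
  conv_lhs => rw [S.as_sum, map_sum]
  simp only [wrap_monomial]
  rw [AddMonoidAlgebra.coeff_sum, Finsupp.finsetSum_apply]
  refine Finset.sum_congr rfl fun n _ => ?_
  rw [AddMonoidAlgebra.coeff_single, Finsupp.single_apply]

theorem exists_of_coeff_tr_wrap_ne_zero {x v : Site 3 L} {S : Pol}
    (h : (tr x * wrap L S).coeff v ≠ 0) : ∃ n ∈ S.support, v = x + siteOf L n := by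
  rw [coeff_tr_mul, coeff_wrap] at h
  obtain ⟨n, hn, hne⟩ := Finset.exists_ne_zero_of_sum_ne_zero h
  refine ⟨n, hn, ?_⟩
  by_contra hc
  refine hne (if_neg fun he => hc ?_)
  rw [he]; abel

/-- All exponents of a polynomial are smaller than `w`. -/
def Bdd (w : ℕ) (S : Pol) : Prop := ∀ n ∈ S.support, ∀ i, n i < w

theorem Bdd.mono {w w' : ℕ} {S : Pol} (h : Bdd w S) (hw : w ≤ w') : Bdd w' S :=
  fun n hn i => (h n hn i).trans_le hw

theorem Bdd.add {w : ℕ} {S S' : Pol} (h : Bdd w S) (h' : Bdd w S') : Bdd w (S + S') := by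
  classical
  intro n hn i
  rcases Finset.mem_union.1 (support_add hn) with hn | hn
  · exact h n hn i
  · exact h' n hn i

theorem Bdd.mul {w : ℕ} {S S' : Pol} (h : Bdd 2 S) (h' : Bdd w S') : Bdd (w + 1) (S * S') := by
  classical
  intro n hn i
  obtain ⟨a, ha, b, hb, rfl⟩ := Finset.mem_add.1 (support_mul _ _ hn)
  have h1 := h a ha i
  have h2 := h' b hb i
  rw [Finsupp.add_apply]
  omega

theorem bdd_monomial {w : ℕ} {n : Fin 3 →₀ ℕ} {c : ZMod 2} (h : ∀ i, n i < w) :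
    Bdd w (monomial n c) := by
  classical
  intro m hm i
  rw [support_monomial] at hm
  split_ifs at hm with h0
  · simp at hm
  · rw [Finset.mem_singleton.1 hm]; exact h i

theorem bdd_one : Bdd 2 (1 : Pol) := by
  have : (1 : Pol) = monomial 0 1 := rfl
  rw [this]; exact bdd_monomial fun i => by simp

theorem bdd_X (i : Fin 3) : Bdd 2 (X i : Pol) :=
  bdd_monomial fun j => by rw [Finsupp.single_apply]; split_ifs <;> omega

theorem bdd_X_mul_X {i j : Fin 3} (h : i ≠ j) : Bdd 2 (X i * X j : Pol) := by
  rw [X, X, monomial_mul]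
  refine bdd_monomial fun k => ?_
  rw [Finsupp.add_apply, Finsupp.single_apply, Finsupp.single_apply]
  split_ifs with h1 h2
  · exact absurd (h1.trans h2.symm) h
  all_goals omega

theorem bdd_fPol : Bdd 2 fPol := ((bdd_one.add (bdd_X 0)).add (bdd_X 1)).add (bdd_X 2)

theorem bdd_gPol : Bdd 2 gPol :=
  ((bdd_one.add (bdd_X_mul_X (by decide))).add (bdd_X_mul_X (by decide))).add
    (bdd_X_mul_X (by decide))

variable [NeZero L]

omit [NeZero L] in
theorem siteOf_injOn {n m : Fin 3 →₀ ℕ} (hn : ∀ i, n i < L) (hm : ∀ i, m i < L)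
    (h : siteOf L n = siteOf L m) : n = m := by
  ext i
  have := congrFun h i
  have h2 := congrArg ZMod.val this
  simpa [siteOf, ZMod.val_natCast, Nat.mod_eq_of_lt (hn i), Nat.mod_eq_of_lt (hm i)] using h2

omit [NeZero L] in
theorem coeff_wrap_of_bdd {S : Pol} (h : Bdd L S) {n : Fin 3 →₀ ℕ} (hn : ∀ i, n i < L) :
    (wrap L S).coeff (siteOf L n) = coeff n S := by
  classical
  rw [coeff_wrap]
  by_cases hs : n ∈ S.support
  · rw [Finset.sum_eq_single n, if_pos rfl]
    · intro m hm hne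
      exact if_neg fun he => hne (siteOf_injOn (h m hm) hn he)
    · intro h'; exact absurd hs h'
  · rw [notMem_support_iff.1 hs]
    refine Finset.sum_eq_zero fun m hm => if_neg fun he => hs ?_
    rwa [siteOf_injOn (h m hm) hn he] at hm

-- Exponents below L are determined by their residues, so nothing is identified by wrapping around.
omit [NeZero L] in
theorem eq_of_wrap_eq {S S' : Pol} (h : Bdd L S) (h' : Bdd L S') (he : wrap L S = wrap L S') :
    S = S' := by
  have key : ∀ {S S' : Pol}, Bdd L S → Bdd L S' → wrap L S = wrap L S' → ∀ n ∈ S.support,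
      coeff n S = coeff n S' := by
    intro S S' h h' he n hn
    rw [← coeff_wrap_of_bdd h (h n hn), he, coeff_wrap_of_bdd h' (h n hn)]
  ext n
  by_cases hn : n ∈ S.support
  · exact key h h' he n hn
  · by_cases hn' : n ∈ S'.support
    · exact (key h' h he.symm n hn').symm
    · rw [notMem_support_iff.1 hn, notMem_support_iff.1 hn']

/-- The polynomial of an element of the group algebra, with exponents counted from the site `x`. -/
noncomputable def lift (x : Site 3 L) (a : Tor L) : Pol :=
  ∑ v, monomial (Finsupp.equivFunOnFinite.symm fun i => (v i - x i).val) (a.coeff v)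

theorem tr_mul_wrap_lift (x : Site 3 L) (a : Tor L) : tr x * wrap L (lift x a) = a := by
  classical
  rw [lift, map_sum, Finset.mul_sum]
  have : ∀ v, tr x * wrap L (monomial (Finsupp.equivFunOnFinite.symm fun i => (v i - x i).val)
      (a.coeff v)) = AddMonoidAlgebra.single v (a.coeff v) := by
    intro v
    rw [wrap_monomial, tr, AddMonoidAlgebra.single_mul_single, one_mul]
    congr 1
    funext i
    simp [siteOf]
  simp only [this]
  ext v
  rw [AddMonoidAlgebra.coeff_sum, Finsupp.finsetSum_apply]
  simp [AddMonoidAlgebra.coeff_single, Finsupp.single_apply]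

theorem bdd_lift {x : Site 3 L} {a : Tor L} {w : ℕ} (h : ∀ v, a.coeff v ≠ 0 → v ∈ cube x w) :
    Bdd w (lift x a) := by
  classical
  intro n hn i
  rw [lift] at hn
  obtain ⟨v, -, hv⟩ := Finset.mem_biUnion.1 (support_sum hn)
  rw [support_monomial] at hv
  split_ifs at hv with h0
  · simp at hv
  · rw [Finset.mem_singleton.1 hv]
    exact h v h0 i

theorem bdd_lift_self (x : Site 3 L) (a : Tor L) : Bdd L (lift x a) :=
  bdd_lift fun _ _ _ => ZMod.val_lt _

theorem coeff_lift {x : Site 3 L} {a : Tor L} {n : Fin 3 →₀ ℕ} (hn : ∀ i, n i < L) :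
    coeff n (lift x a) = a.coeff (x + siteOf L n) := by
  rw [← coeff_wrap_of_bdd (bdd_lift_self x a) hn]
  conv_rhs => rw [← tr_mul_wrap_lift x a, coeff_tr_mul, add_sub_cancel_left]

theorem coeff_ne_zero_of_mem_support_lift {x : Site 3 L} {a : Tor L} {n : Fin 3 →₀ ℕ}
    (hn : n ∈ (lift x a).support) : a.coeff (x + siteOf L n) ≠ 0 := by
  rw [← coeff_lift (bdd_lift_self x a n hn)]
  exact mem_support_iff.1 hn

/-- An operator without defects in a cube smaller than the lattice is a stabilizer. -/
theorem exists_of_tor_syzygy {a b : Tor L} {x : Site 3 L} {w : ℕ} (hw : w + 1 ≤ L)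
    (ha : ∀ v, a.coeff v ≠ 0 → v ∈ cube x w) (hb : ∀ v, b.coeff v ≠ 0 → v ∈ cube x w)
    (h : wrap L gPol * a + wrap L fPol * b = 0) :
    ∃ p, a = wrap L fPol * p ∧ b = wrap L gPol * p := by
  -- Multiplication by f or g raises the exponents by at most 1, so w + 1 ≤ L lets the identity be
  -- read among honest polynomials.
  have h1 : gPol * lift x a + fPol * lift x b = 0 := by
    refine eq_of_wrap_eq (L := L) (((bdd_gPol.mul (bdd_lift ha)).add
      (bdd_fPol.mul (bdd_lift hb))).mono hw) (fun n hn => by simp at hn) ?_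
    refine tr_mul_left_cancel (u := x) ?_
    rw [map_zero, mul_zero, map_add, map_mul, map_mul, mul_add, mul_left_comm, tr_mul_wrap_lift,
      mul_left_comm, tr_mul_wrap_lift, h]
  obtain ⟨P, hA, hB⟩ := exists_of_syzygy h1
  refine ⟨tr x * wrap L P, ?_, ?_⟩
  · rw [← tr_mul_wrap_lift x a, hA, map_mul]; ring
  · rw [← tr_mul_wrap_lift x b, hB, map_mul]; ring

omit [NeZero L] in
theorem mon_eq_monomial (α : Fin 3 → ℕ) : mon α = monomial (Finsupp.equivFunOnFinite.symm α) 1 := by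
  rw [mon, monomial_eq, C_1, one_mul, Finsupp.prod_fintype _ _ (fun i => pow_zero _)]
  rfl

-- The monomial of the coordinatewise minimal exponents is factored out. The three remaining
-- exponents are at most δ each.
omit [NeZero L] in
theorem exists_mon_mul {S : Pol} (hS : S ≠ 0) {δ : ℕ}
    (h : ∀ n ∈ S.support, ∀ m ∈ S.support, ∀ i, n i ≤ m i + δ) :
    ∃ (α : Fin 3 → ℕ) (S' : Pol), S = mon α * S' ∧ S'.totalDegree ≤ 3 * δ ∧
      ∀ n ∈ S.support, ∀ i, α i ≤ n i ∧ n i ≤ α i + δ := by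
  classical
  have hne : S.support.Nonempty := support_nonempty.2 hS
  have hmin := fun i : Fin 3 => S.support.exists_min_image (fun n => n i) hne
  choose m hm hmin using hmin
  have hα : ∀ n ∈ S.support, ∀ i, m i i ≤ n i ∧ n i ≤ m i i + δ := fun n hn i =>
    ⟨hmin i n hn, h n hn (m i) (hm i) i⟩
  set α : Fin 3 → ℕ := fun i => m i i with hαd
  set αF : Fin 3 →₀ ℕ := Finsupp.equivFunOnFinite.symm α with hαF
  refine ⟨α, ∑ n ∈ S.support, monomial (n - αF) (coeff n S), ?_, ?_, hα⟩
  · rw [mon_eq_monomial, Finset.mul_sum]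
    conv_lhs => rw [S.as_sum]
    refine Finset.sum_congr rfl fun n hn => ?_
    rw [monomial_mul, one_mul, ← hαF, add_tsub_cancel_of_le]
    exact fun i => (hα n hn i).1
  · refine totalDegree_finsetSum_le fun n hn => ?_
    refine (totalDegree_monomial_le _ _).trans ?_
    rw [Finsupp.sum_fintype _ _ (fun _ => rfl), Fin.sum_univ_three]
    have h1 : ∀ i, (n - αF) i ≤ δ := by
      intro i
      have : n i ≤ α i + δ := (hα n hn i).2
      have h2 : (n - αF) i = n i - α i := rfl
      omega
    have := h1 0
    have := h1 1
    have := h1 2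
    simp only [id_eq]
    omega

omit [NeZero L] in
theorem siteDist_add_siteOf_le {x : Site 3 L} {n m : Fin 3 →₀ ℕ} {k : ℕ}
    (h : ∀ i, n i ≤ m i + k ∧ m i ≤ n i + k) (hk : k ≤ L / 2) :
    siteDist (x + siteOf L n) (x + siteOf L m) ≤ k := by
  rw [siteDist_le_iff]
  intro i
  have e : (x + siteOf L n) i - (x + siteOf L m) i = (n i : ZMod L) - m i := by
    simp [siteOf]
  rw [e]
  have key : ∀ a b : ℕ, b ≤ a → a ≤ b + k → ((a : ZMod L) - b).valMinAbs.natAbs ≤ k := by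
    intro a b h1 h2
    rw [← Nat.cast_sub h1, ZMod.valMinAbs_natCast_of_le_half (by omega)]
    rw [Int.natAbs_natCast]
    omega
  rcases le_total (m i) (n i) with h' | h'
  · exact key _ _ h' (h i).1
  · rw [← neg_sub, ZMod.natAbs_valMinAbs_neg]
    exact key _ _ h' (h i).2

omit [NeZero L] in
theorem le_add_of_siteDist_le {x : Site 3 L} {n m : Fin 3 →₀ ℕ} {k w : ℕ} (hw : 2 * w ≤ L)
    (hn : ∀ i, n i < w + 1) (h : siteDist (x + siteOf L n) (x + siteOf L m) ≤ k) (i : Fin 3) :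
    n i ≤ m i + k := by
  rcases le_total (n i) (m i) with h' | h'
  · omega
  · have h1 := siteDist_le_iff.1 h i
    have e : (x + siteOf L n) i - (x + siteOf L m) i = ((n i - m i : ℕ) : ZMod L) := by
      rw [Nat.cast_sub h']; simp [siteOf]
    have := hn i
    rw [e, ZMod.valMinAbs_natCast_of_le_half (by omega), Int.natAbs_natCast] at h1
    omega

/-- The no-strings property of the cubic code. -/
theorem tor_stringFree {a b c₁ c₂ : Tor L} {x : Site 3 L} {ℓ δ : ℕ} (hℓ : 2 * ℓ ≤ L) (hℓ1 : ℓ < L)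
    (ha : ∀ v, a.coeff v ≠ 0 → v ∈ cube x ℓ) (hb : ∀ v, b.coeff v ≠ 0 → v ∈ cube x ℓ)
    (h : wrap L gPol * a + wrap L fPol * b = c₁ + c₂)
    (h₁ : ∀ u v, c₁.coeff u ≠ 0 → c₁.coeff v ≠ 0 → siteDist u v ≤ δ)
    (h₂ : ∀ u v, c₂.coeff u ≠ 0 → c₂.coeff v ≠ 0 → siteDist u v ≤ δ)
    (hsep : ∀ u v, c₁.coeff u ≠ 0 → c₂.coeff v ≠ 0 → 4 * δ < siteDist u v) :
    ∃ a₁ b₁ : Tor L, wrap L gPol * a₁ + wrap L fPol * b₁ = c₁ ∧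
      ∀ v, a₁.coeff v ≠ 0 ∨ b₁.coeff v ≠ 0 → ∃ u, c₁.coeff u ≠ 0 ∧ siteDist v u ≤ 6 * δ := by
  by_cases hc₁ : c₁ = 0
  · exact ⟨0, 0, by simp [hc₁], by simp⟩
  set S₁ := lift x c₁ with hS₁
  set S₂ := lift x c₂ with hS₂
  have hpol : gPol * lift x a + fPol * lift x b = S₁ + S₂ := by
    refine eq_of_wrap_eq (L := L) (((bdd_gPol.mul (bdd_lift ha)).add
      (bdd_fPol.mul (bdd_lift hb))).mono hℓ1) ((bdd_lift_self _ _).add (bdd_lift_self _ _)) ?_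
    refine tr_mul_left_cancel (u := x) ?_
    rw [map_add, map_mul, map_mul, mul_add, mul_left_comm, tr_mul_wrap_lift,
      mul_left_comm, tr_mul_wrap_lift, h, map_add, mul_add, tr_mul_wrap_lift, tr_mul_wrap_lift]
  have hbdd : Bdd (ℓ + 1) (S₁ + S₂) := by
    rw [← hpol]
    exact (bdd_gPol.mul (bdd_lift ha)).add (bdd_fPol.mul (bdd_lift hb))
  -- Separated clusters do not cancel each other, so each of them inherits the bound on the
  -- exponents of their sum.
  have hdis : ∀ n ∈ S₁.support, n ∉ S₂.support := by
    intro n hn hn'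
    have := hsep _ _ (coeff_ne_zero_of_mem_support_lift hn) (coeff_ne_zero_of_mem_support_lift hn')
    rw [siteDist_self] at this
    omega
  have hb₁ : Bdd (ℓ + 1) S₁ := fun n hn => hbdd n (by
    rw [mem_support_iff, coeff_add, notMem_support_iff.1 (hdis n hn), add_zero]
    exact mem_support_iff.1 hn)
  have hb₂ : Bdd (ℓ + 1) S₂ := fun n hn => hbdd n (by
    have : n ∉ S₁.support := fun h => hdis n h hn
    rw [mem_support_iff, coeff_add, notMem_support_iff.1 this, zero_add]
    exact mem_support_iff.1 hn)
  have hS₁0 : S₁ ≠ 0 := by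
    intro h0
    apply hc₁
    rw [← tr_mul_wrap_lift x c₁, ← hS₁, h0, map_zero, mul_zero]
  obtain ⟨α, S₁', hα, hdeg, hαn⟩ := exists_mon_mul hS₁0 (δ := δ) fun n hn m hm i =>
    le_add_of_siteDist_le hℓ (hb₁ n hn) (h₁ _ _ (coeff_ne_zero_of_mem_support_lift hn)
      (coeff_ne_zero_of_mem_support_lift hm)) i
  obtain ⟨n₁, hn₁⟩ := support_nonempty.2 hS₁0
  have hcharge : charge (S₁ + S₂) = 0 := by
    rw [← hpol, map_add, map_mul, map_mul, charge_fPol, charge_gPol, zero_mul, zero_mul, add_zero]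
  have hch : charge S₁' = 0 := by
    by_cases hS₂0 : S₂ = 0
    · rw [hS₂0, add_zero, hα, map_mul] at hcharge
      exact (mul_eq_zero.1 hcharge).resolve_left (charge_mon_ne_zero _)
    · obtain ⟨β, S₂', hβ, hdeg', hβn⟩ := exists_mon_mul hS₂0 (δ := δ) fun n hn m hm i =>
        le_add_of_siteDist_le hℓ (hb₂ n hn) (h₂ _ _ (coeff_ne_zero_of_mem_support_lift hn)
          (coeff_ne_zero_of_mem_support_lift hm)) i
      obtain ⟨n₂, hn₂⟩ := support_nonempty.2 hS₂0
      by_contra hne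
      -- A nonzero charge of degree at most 3δ forces the corner monomials within 3δ of each other,
      -- hence the clusters within 4δ, against the separation.
      have hclose : ∀ i, α i ≤ β i + 3 * δ ∧ β i ≤ α i + 3 * δ := by
        intro i
        by_contra hi
        refine hne (charge_eq_zero_of_far (i := i) hdeg hdeg' (by rw [← hα, ← hβ]; exact hcharge) ?_)
        omega
      have hs := hsep _ _ (coeff_ne_zero_of_mem_support_lift hn₁)
        (coeff_ne_zero_of_mem_support_lift hn₂)
      by_cases hk : 4 * δ ≤ L / 2
      · have := siteDist_add_siteOf_le (x := x) (n := n₁) (m := n₂) (k := 4 * δ) (fun i => by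
          have h1 := hclose i
          have h2 := hαn n₁ hn₁ i
          have h3 := hβn n₂ hn₂ i
          omega) hk
        omega
      -- If 4δ exceeds L/2, it exceeds every distance on the torus.
      · have : siteDist (x + siteOf L n₁) (x + siteOf L n₂) ≤ L / 2 := by
          rw [siteDist_le_iff]
          intro i
          exact ZMod.natAbs_valMinAbs_le _
        omega
  obtain ⟨A, B, hA, hB, hAB⟩ := exists_of_charge_eq_zero hdeg hch
  have hsupp : ∀ {P : Pol}, P.totalDegree ≤ 2 * (3 * δ) → ∀ v,
      (tr x * wrap L (mon α * P)).coeff v ≠ 0 → ∃ u, c₁.coeff u ≠ 0 ∧ siteDist v u ≤ 6 * δ := by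
    classical
    intro P hP v hv
    obtain ⟨n, hn, rfl⟩ := exists_of_coeff_tr_wrap_ne_zero hv
    refine ⟨_, coeff_ne_zero_of_mem_support_lift hn₁, ?_⟩
    by_cases hk : 6 * δ ≤ L / 2
    · refine siteDist_add_siteOf_le (fun i => ?_) hk
      obtain ⟨k, hk, m, hm, rfl⟩ := Finset.mem_add.1 (support_mul _ _ hn)
      rw [mon_eq_monomial] at hk
      have hk' : k = Finsupp.equivFunOnFinite.symm α := by
        have := support_monomial_subset hk
        exact Finset.mem_singleton.1 this
      have h1 := hαn n₁ hn₁ i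
      have h2 : m i ≤ 6 * δ := by
        have h3 := le_totalDegree hm
        rw [Finsupp.sum_fintype _ _ (fun _ => rfl)] at h3
        have h4 := Finset.single_le_sum (f := fun i => m i) (fun _ _ => Nat.zero_le _)
          (Finset.mem_univ i)
        omega
      have h5 : (k + m) i = α i + m i := by rw [hk']; rfl
      rw [h5]
      omega
    · have : siteDist (x + siteOf L n) (x + siteOf L n₁) ≤ L / 2 := by
        rw [siteDist_le_iff]
        intro i
        exact ZMod.natAbs_valMinAbs_le _
      omega
  refine ⟨tr x * wrap L (mon α * A), tr x * wrap L (mon α * B), ?_, ?_⟩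
  · rw [← tr_mul_wrap_lift x c₁, ← hS₁, hα, ← hAB]
    simp only [map_mul, map_add]
    ring
  · rintro v (hv | hv)
    · exact hsupp hA v hv
    · exact hsupp hB v hv

end Torus
end PauliCode

/-! ### The cubic code in terms of the group algebra. -/

namespace PauliCode
open CodeHamiltonian

section CubicCode
variable {L : ℕ} [NeZero L]

/-- The element of the group algebra with given coefficients. -/
noncomputable def ofFun (A : Site 3 L → ZMod 2) : Tor L :=
  AddMonoidAlgebra.ofCoeff (Finsupp.equivFunOnFinite.symm A)

@[simp] theorem coeff_ofFun (A : Site 3 L → ZMod 2) (v : Site 3 L) : (ofFun A).coeff v = A v := rfl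

theorem sum_coeffs_mul (e : Fin 4 → Site 3 L) (a : Tor L) (u : Site 3 L) :
    ∑ v, coeffs e (u - v) * a.coeff v = ((∑ k, tr (e k)) * a).coeff u := by
  rw [Finset.sum_mul, AddMonoidAlgebra.coeff_sum, Finsupp.finsetSum_apply]
  simp only [coeff_tr_mul, coeffs, Finset.sum_mul]
  rw [Finset.sum_comm]
  refine Finset.sum_congr rfl fun k _ => ?_
  rw [Finset.sum_eq_single (u - e k)]
  · simp
  · intro v _ hv
    rw [if_neg, zero_mul]
    rintro h
    exact hv (by rw [h]; abel)
  · simp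

omit [NeZero L] in
theorem wrap_fPol : wrap L fPol = ∑ k, tr (fExp L k) := by
  simp only [fPol, wrap, map_add, map_one, MvPolynomial.aeval_X, Fin.sum_univ_four]
  rw [← tr_zero]
  congr 1; congr 1; congr 1
  all_goals congr 1; funext i; fin_cases i <;> simp [fExp]

omit [NeZero L] in
theorem wrap_gPol : wrap L gPol = ∑ k, tr (gExp L k) := by
  simp only [gPol, wrap, map_add, map_one, map_mul, MvPolynomial.aeval_X, Fin.sum_univ_four,
    ← tr_add]
  rw [← tr_zero]
  congr 1; congr 1; congr 1
  all_goals congr 1; funext i; fin_cases i <;> simp [gExp]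

/-- The reflection exchanging the two types of terms of the cubic code. -/
def sgn (σ : Bool) (v : Site 3 L) : Site 3 L := if σ then v else -v

omit [NeZero L] in
@[simp] theorem sgn_sgn (σ : Bool) (v : Site 3 L) : sgn σ (sgn σ v) = v := by
  cases σ <;> simp [sgn]

/-- The first component of the `X`-part (`σ = true`) or the reflected `Z`-part. -/
noncomputable def partA (σ : Bool) (E : Pauli (Site 3 L × Fin 2)) : Tor L :=
  ofFun fun v => if σ then (E (v, 0)).1 else (E (-v, 1)).2

/-- The second component of the `X`-part (`σ = true`) or the reflected `Z`-part. -/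
noncomputable def partB (σ : Bool) (E : Pauli (Site 3 L × Fin 2)) : Tor L :=
  ofFun fun v => if σ then (E (v, 1)).1 else (E (-v, 0)).2

/-- The Pauli operator with given parts. -/
noncomputable def ofParts (a b : Bool → Tor L) : Pauli (Site 3 L × Fin 2) := fun q =>
  if q.2 = 0 then ((a true).coeff q.1, (b false).coeff (-q.1))
  else ((b true).coeff q.1, (a false).coeff (-q.1))

@[simp] theorem partA_ofParts (a b : Bool → Tor L) (σ : Bool) : partA σ (ofParts a b) = a σ := by
  ext v; cases σ <;> simp [partA, ofParts]

@[simp] theorem partB_ofParts (a b : Bool → Tor L) (σ : Bool) : partB σ (ofParts a b) = b σ := by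
  ext v; cases σ <;> simp [partB, ofParts]

theorem sgn_mem_supp {σ : Bool} {E : Pauli (Site 3 L × Fin 2)} {v : Site 3 L}
    (h : (partA σ E).coeff v ≠ 0 ∨ (partB σ E).coeff v ≠ 0) :
    sgn σ v ∈ (cubicCode L).supp E := by
  rcases h with h | h <;> cases σ <;> simp only [partA, partB, coeff_ofFun] at h
  · exact ⟨(-v, 1), rfl, fun h0 => h (by simp [h0])⟩
  · exact ⟨(v, 0), rfl, fun h0 => h (by simp [h0])⟩
  · exact ⟨(-v, 0), rfl, fun h0 => h (by simp [h0])⟩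
  · exact ⟨(v, 1), rfl, fun h0 => h (by simp [h0])⟩

theorem exists_of_mem_supp {E : Pauli (Site 3 L × Fin 2)} {u : Site 3 L}
    (h : u ∈ (cubicCode L).supp E) :
    ∃ σ, (partA σ E).coeff (sgn σ u) ≠ 0 ∨ (partB σ E).coeff (sgn σ u) ≠ 0 := by
  obtain ⟨⟨v, j⟩, rfl, hq⟩ := h
  by_contra hc
  push Not at hc
  have h1 := hc true
  have h2 := hc false
  simp only [partA, partB, coeff_ofFun, sgn, if_true, Bool.false_eq_true, if_false,
    neg_neg] at h1 h2
  refine hq ?_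
  fin_cases j
  · exact Prod.ext h1.1 h2.2
  · exact Prod.ext h1.2 h2.1

/-- Reflecting the lattice for one of the two types of terms turns both syndromes into the same
convolution, so one algebraic argument serves both. -/
theorem syn_cubicCode (σ : Bool) (E : Pauli (Site 3 L × Fin 2)) (u : Site 3 L) :
    (cubicCode L).syn E (sgn σ u, σ)
      = (wrap L gPol * partA σ E + wrap L fPol * partB σ E).coeff u := by
  rw [AddMonoidAlgebra.coeff_add, Finsupp.add_apply, wrap_fPol, wrap_gPol, ← sum_coeffs_mul,
    ← sum_coeffs_mul, ← Finset.sum_add_distrib]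
  show (cubicGen L _).comm E = _
  simp only [Pauli.comm, Fintype.sum_prod_type, Fin.sum_univ_two]
  cases σ
  · rw [← Equiv.sum_comp (Equiv.neg _)]
    refine Finset.sum_congr rfl fun v _ => ?_
    simp [cubicGen, sgn, partA, partB, neg_add_eq_sub]
    ring
  · refine Finset.sum_congr rfl fun v _ => ?_
    simp [cubicGen, sgn, partA, partB]

omit [NeZero L] in
theorem siteDist_sgn (σ : Bool) (u v : Site 3 L) : siteDist (sgn σ u) (sgn σ v) = siteDist u v := by
  cases σ
  · rw [siteDist_comm u v]
    simp only [sgn, siteDist, Bool.false_eq_true, if_false, Pi.neg_apply]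
    refine congrArg _ (funext fun i => ?_)
    congr 2; ring
  · rfl

omit [NeZero L] in
theorem siteDist_cubicCorner (σ : Bool) (u v : Site 3 L) :
    siteDist (cubicCorner L (u, σ)) (cubicCorner L (v, σ)) = siteDist u v := by
  cases σ
  · rfl
  · simp [cubicCorner, siteDist]

theorem siteDist_self_cubicCorner_le (σ : Bool) (u : Site 3 L) :
    siteDist u (cubicCorner L (u, σ)) ≤ 1 := by
  cases σ
  · simp [cubicCorner]
  · refine siteDist_le_of_mem_cube fun i => val_lt_two (Or.inr ?_)
    simp [cubicCorner]

theorem exists_sgn_mem_cube (σ : Bool) (x : Site 3 L) (w : ℕ) :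
    ∃ y : Site 3 L, ∀ v, sgn σ v ∈ cube x w → v ∈ cube y w := by
  cases σ
  · refine ⟨fun i => -x i - (w - 1 : ℤ), fun v hv i => ?_⟩
    obtain ⟨e, he, h⟩ := exists_eq_add_of_mem_cube hv i
    refine val_lt_of_eq_intCast (n := (w : ℤ) - 1 - e) ?_ (by omega) (by omega)
    have : v i = -(x i + e) := by
      rw [← h]; simp [sgn]
    rw [this]; push_cast; ring
  · exact ⟨x, fun v hv => hv⟩

/-- The clusters of one type, as elements of the group algebra. -/
noncomputable def clusPart (σ : Bool) (c : Site 3 L × Bool → ZMod 2) : Tor L :=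
  ofFun fun u => c (sgn σ u, σ)

/-- The two types of defects are treated separately. The radius 6δ of the algebraic statement plus 1
for the offset of the corner is within 10 (δ + 1). -/
theorem stringFree_cubicCode {ℓ : ℕ} (hℓ : 2 * ℓ ≤ L) : (cubicCode L).StringFree ℓ 10 := by
  have hL : 0 < L := Nat.pos_of_neZero L
  rintro P c₁ c₂ δ ⟨x, hx⟩ hP h₁ h₂ hsep
  have hd : ∀ (σ : Bool) (u v : Site 3 L), siteDist ((cubicCode L).corner (sgn σ u, σ))
      ((cubicCode L).corner (sgn σ v, σ)) = siteDist u v := fun σ u v =>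
    (siteDist_cubicCorner σ _ _).trans (siteDist_sgn σ u v)
  have key : ∀ σ : Bool, ∃ a b : Tor L, wrap L gPol * a + wrap L fPol * b = clusPart σ c₁ ∧
      ∀ v, a.coeff v ≠ 0 ∨ b.coeff v ≠ 0 →
        ∃ u, (clusPart σ c₁).coeff u ≠ 0 ∧ siteDist v u ≤ 6 * δ := by
    intro σ
    obtain ⟨y, hy⟩ := exists_sgn_mem_cube σ x ℓ
    refine tor_stringFree (a := partA σ P) (b := partB σ P) (c₂ := clusPart σ c₂) hℓ (by omega)
      (fun v hv => hy v (hx (sgn_mem_supp (Or.inl hv))))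
      (fun v hv => hy v (hx (sgn_mem_supp (Or.inr hv)))) ?_ ?_ ?_ ?_
    · ext u
      rw [← syn_cubicCode, hP]
      rfl
    · intro u v hu hv
      rw [← hd σ]
      exact h₁ _ _ hu hv
    · intro u v hu hv
      rw [← hd σ]
      exact h₂ _ _ hu hv
    · intro u v hu hv
      rw [← hd σ]
      have := hsep _ _ hu hv
      omega
  choose a b hab hsupp using key
  refine ⟨ofParts a b, ?_, ?_⟩
  · funext ⟨u, σ⟩
    rw [← sgn_sgn σ u, syn_cubicCode, partA_ofParts, partB_ofParts, hab]
    rfl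
  · intro u hu
    obtain ⟨σ, hσ⟩ := exists_of_mem_supp hu
    rw [partA_ofParts, partB_ofParts] at hσ
    obtain ⟨v, hv, hd'⟩ := hsupp σ _ hσ
    refine ⟨(sgn σ v, σ), hv, ?_⟩
    have h3 := siteDist_triangle u (sgn σ v) ((cubicCode L).corner (sgn σ v, σ))
    have h4 : siteDist (sgn σ v) ((cubicCode L).corner (sgn σ v, σ)) ≤ 1 :=
      siteDist_self_cubicCorner_le σ _
    rw [← siteDist_sgn σ, sgn_sgn] at hd'
    omega

theorem isStabilizer_of_parts {E : Pauli (Site 3 L × Fin 2)}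
    (h : ∀ σ, ∃ p : Tor L, partA σ E = wrap L fPol * p ∧ partB σ E = wrap L gPol * p) :
    (cubicCode L).IsStabilizer E := by
  choose p hA hB using h
  have hE : E = ∑ u, (p true).coeff u • cubicGen L (u, false)
      + ∑ u, (p false).coeff (-u) • cubicGen L (u, true) := by
    have hA' : ∀ σ v, (partA σ E).coeff v = ∑ u, coeffs (fExp L) (v - u) * (p σ).coeff u := by
      intro σ v; rw [hA, wrap_fPol, sum_coeffs_mul]
    have hB' : ∀ σ v, (partB σ E).coeff v = ∑ u, coeffs (gExp L) (v - u) * (p σ).coeff u := by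
      intro σ v; rw [hB, wrap_gPol, sum_coeffs_mul]
    have hneg : ∀ (e : Fin 4 → Site 3 L) (v : Site 3 L),
        ∑ u, coeffs e (-v - u) * (p false).coeff u
          = ∑ u, coeffs e (u - v) * (p false).coeff (-u) := by
      intro e v
      rw [← Equiv.sum_comp (Equiv.neg _)]
      refine Finset.sum_congr rfl fun u _ => ?_
      simp [neg_add_eq_sub]
    funext ⟨v, j⟩
    rw [Pi.add_apply, Finset.sum_apply, Finset.sum_apply]
    fin_cases j
    · have h1 := hA' true v
      have h2 := hB' false (-v)
      rw [hneg] at h2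
      simp only [partA, partB, coeff_ofFun, if_true, Bool.false_eq_true, if_false, neg_neg]
        at h1 h2
      refine Prod.ext ?_ ?_
      · simp [h1, Prod.fst_sum, cubicGen, mul_comm]
      · simp [h2, Prod.snd_sum, cubicGen, mul_comm]
    · have h1 := hB' true v
      have h2 := hA' false (-v)
      rw [hneg] at h2
      simp only [partA, partB, coeff_ofFun, if_true, Bool.false_eq_true, if_false, neg_neg]
        at h1 h2
      refine Prod.ext ?_ ?_
      · simp [h1, Prod.fst_sum, cubicGen, mul_comm]
      · simp [h2, Prod.snd_sum, cubicGen, mul_comm]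
  rw [hE, IsStabilizer]
  exact Submodule.add_mem _
    (Submodule.sum_mem _ fun u _ => Submodule.smul_mem _ _ (Submodule.subset_span ⟨_, rfl⟩))
    (Submodule.sum_mem _ fun u _ => Submodule.smul_mem _ _ (Submodule.subset_span ⟨_, rfl⟩))

/-- An operator of the cubic code that creates no defects and is enclosed by a cube smaller than
the lattice is a stabilizer. -/
theorem isStabilizer_of_enclosedBy {E : Pauli (Site 3 L × Fin 2)} {w : ℕ} (hw : w + 1 ≤ L)
    (hE : (cubicCode L).syn E = 0) (hs : EnclosedBy w ((cubicCode L).supp E)) :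
    (cubicCode L).IsStabilizer E := by
  obtain ⟨x, hx⟩ := hs
  refine isStabilizer_of_parts fun σ => ?_
  obtain ⟨y, hy⟩ := exists_sgn_mem_cube σ x w
  refine exists_of_tor_syzygy hw (fun v hv => hy v (hx (sgn_mem_supp (Or.inl hv))))
    (fun v hv => hy v (hx (sgn_mem_supp (Or.inr hv)))) ?_
  ext u
  rw [← syn_cubicCode, hE]
  rfl

theorem partA_add (σ : Bool) (E F : Pauli (Site 3 L × Fin 2)) :
    partA σ (E + F) = partA σ E + partA σ F := by
  ext v; cases σ <;> rfl

theorem partB_add (σ : Bool) (E F : Pauli (Site 3 L × Fin 2)) :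
    partB σ (E + F) = partB σ E + partB σ F := by
  ext v; cases σ <;> rfl

theorem exists_of_isStabilizer {E : Pauli (Site 3 L × Fin 2)} (h : (cubicCode L).IsStabilizer E) :
    ∃ p : Tor L, partA true E = wrap L fPol * p ∧ partB true E = wrap L gPol * p := by
  have hz : ∀ q : Pauli (Site 3 L × Fin 2), (∀ v j, (q (v, j)).1 = 0) →
      ∃ p : Tor L, partA true q = wrap L fPol * p ∧ partB true q = wrap L gPol * p := by
    intro q hq
    refine ⟨0, ?_, ?_⟩ <;> ext v <;> simp [partA, partB, hq]
  refine Submodule.span_induction ?_ (hz _ fun v j => rfl) ?_ ?_ h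
  · rintro _ ⟨⟨u, σ⟩, rfl⟩
    cases σ
    · refine ⟨tr u, ?_, ?_⟩
      · ext v
        rw [mul_comm, coeff_tr_mul, wrap_fPol, ← mul_one (∑ k, tr (fExp L k)), ← sum_coeffs_mul,
          Finset.sum_eq_single 0]
        · simp [partA, cubicCode, cubicGen, ← tr_zero, tr, AddMonoidAlgebra.coeff_single]
        · intro w _ hw
          simp [← tr_zero, tr, AddMonoidAlgebra.coeff_single, hw.symm]
        · simp
      · ext v
        rw [mul_comm, coeff_tr_mul, wrap_gPol, ← mul_one (∑ k, tr (gExp L k)), ← sum_coeffs_mul,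
          Finset.sum_eq_single 0]
        · simp [partB, cubicCode, cubicGen, ← tr_zero, tr, AddMonoidAlgebra.coeff_single]
        · intro w _ hw
          simp [← tr_zero, tr, AddMonoidAlgebra.coeff_single, hw.symm]
        · simp
    · refine hz _ fun v j => ?_
      fin_cases j <;> rfl
  · rintro E F - - ⟨p, hp, hp'⟩ ⟨r, hr, hr'⟩
    exact ⟨p + r, by rw [partA_add, hp, hr, mul_add], by rw [partB_add, hp', hr', mul_add]⟩
  · rintro z E - ⟨p, hp, hp'⟩
    obtain rfl | rfl : z = 0 ∨ z = 1 := by revert z; decide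
    · exact hz _ fun v j => by rw [zero_smul]; rfl
    · exact ⟨p, by rwa [one_smul], by rwa [one_smul]⟩

/-- The cubic code has logical operators. -/
theorem exists_isLogical_cubicCode (L : ℕ) [NeZero L] : ∃ E, (cubicCode L).IsLogical E := by
  have : Module.Finite (ZMod 2) (Tor L) :=
    Module.Finite.equiv (AddMonoidAlgebra.coeffLinearEquiv (ZMod 2)).symm
  set f := wrap L fPol with hf
  set g := wrap L gPol with hg
  let ψ : Tor L →ₗ[ZMod 2] Tor L × Tor L := (LinearMap.mulLeft _ f).prod (LinearMap.mulLeft _ g)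
  let φ : Tor L × Tor L →ₗ[ZMod 2] Tor L :=
    (LinearMap.mulLeft _ g).coprod (LinearMap.mulLeft _ f)
  let aug : Tor L →ₐ[ZMod 2] ZMod 2 := AddMonoidAlgebra.lift _ _ _ 1
  have haug : ∀ u : Site 3 L, aug (tr u) = 1 := by
    intro u; simp [aug, tr]
  have hfa : aug f = 0 := by
    rw [hf, wrap_fPol, map_sum]; simp only [haug]; decide
  have hga : aug g = 0 := by
    rw [hg, wrap_gPol, map_sum]; simp only [haug]; decide
  have hφ : LinearMap.range φ < ⊤ := by
    refine lt_of_le_of_ne le_top fun h => ?_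
    have h1 : (1 : Tor L) ∈ LinearMap.range φ := h ▸ Submodule.mem_top
    obtain ⟨⟨a, b⟩, hab⟩ := h1
    have h2 := congrArg aug hab
    simp [φ, hfa, hga] at h2
  -- The syndrome map is not onto, because f and g have augmentation 0. Its kernel is thus larger
  -- than the group algebra, hence larger than the image of the stabilizer map.
  have h1 := Submodule.finrank_lt hφ.ne
  have h2 := LinearMap.finrank_range_add_finrank_ker φ
  have h3 := LinearMap.finrank_range_le ψ
  rw [Module.finrank_prod] at h2
  have h4 : ¬ LinearMap.ker φ ≤ LinearMap.range ψ := fun h => by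
    have := Submodule.finrank_mono h
    omega
  obtain ⟨⟨a, b⟩, hk, hr⟩ := SetLike.not_le_iff_exists.1 h4
  have hk' : g * a + f * b = 0 := by simpa [φ] using hk
  refine ⟨ofParts (fun σ => if σ then a else 0) (fun σ => if σ then b else 0), ?_, fun hst => ?_⟩
  · refine Set.eq_empty_iff_forall_notMem.2 ?_
    rintro ⟨u, σ⟩ hu
    rw [mem_syndrome, ← sgn_sgn σ u, syn_cubicCode, partA_ofParts, partB_ofParts] at hu
    refine hu ?_
    cases σ
    · simp
    · rw [if_pos rfl, if_pos rfl, hk']; rfl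
  · obtain ⟨p, hp, hp'⟩ := exists_of_isStabilizer hst
    rw [partA_ofParts, if_pos rfl] at hp
    rw [partB_ofParts, if_pos rfl] at hp'
    exact hr ⟨p, by rw [hp, hp']; rfl⟩

end CubicCode
end PauliCode

/-! ### Splitting cheap operators along coordinates; the code distance. -/

namespace PauliCode
open CodeHamiltonian

section Coordinate
variable {D L : ℕ}

/-- The absolute value of a coordinate. -/
def coord (i : Fin D) (v : Site D L) : ℤ := ((v i).valMinAbs.natAbs : ℤ)

theorem lip_coord (i : Fin D) : Lip (coord (L := L) i) := by
  have key : ∀ u v : Site D L, coord i u ≤ coord i v + siteDist u v := by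
    intro u v
    have h1 := siteDist_le_iff.1 (le_refl (siteDist u v)) i
    have h2 := ZMod.natAbs_valMinAbs_add_le (u i - v i) (v i)
    rw [sub_add_cancel] at h2
    have h3 := h2.trans (Int.natAbs_add_le _ _)
    unfold coord
    omega
  intro u v
  have h1 := key u v
  have h2 := key v u
  rw [siteDist_comm v u] at h2
  rw [abs_le]
  constructor <;> omega

variable [NeZero L]

omit [NeZero L] in
theorem enclosedBy_of_siteDist_le {A : Set (Site D L)} {E ℓ : ℕ} (hE : 2 * E < ℓ)
    (h : ∀ v ∈ A, ∀ w ∈ A, siteDist v w ≤ E) : EnclosedBy ℓ A := by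
  rcases A.eq_empty_or_nonempty with rfl | ⟨w, hw⟩
  · exact ⟨0, by simp⟩
  · exact ⟨_, fun v hv => mem_cube_of_siteDist_le (h v hv w hw) hE⟩

/-- A region avoids, up to a margin `k`, one of two opposite sides of the lattice. -/
def Confined (i : Fin D) (k : ℕ) (A : Set (Site D L)) : Prop :=
  (∀ v ∈ A, ((L / 8 : ℕ) : ℤ) ≤ coord i v + k) ∨ ∀ v ∈ A, coord i v ≤ (L / 4 : ℕ) + k

omit [NeZero L] in
theorem Confined.of_near {i : Fin D} {k e : ℕ} {A A' : Set (Site D L)} (h : Confined i k A)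
    (hA : ∀ v ∈ A', ∃ w ∈ A, siteDist v w ≤ e) : Confined i (k + e) A' := by
  have key : ∀ v ∈ A', ∃ w ∈ A, coord i v ≤ coord i w + e ∧ coord i w ≤ coord i v + e := by
    intro v hv
    obtain ⟨w, hw, hd⟩ := hA v hv
    have := Lip.abs_le (lip_coord i) hd
    exact ⟨w, hw, by omega, by omega⟩
  refine h.imp (fun h v hv => ?_) fun h v hv => ?_ <;> obtain ⟨w, hw, h1, h2⟩ := key v hv <;>
    have := h w hw <;> push_cast <;> omega

/-- Avoiding either the arc around 0 or the opposite arc leaves a proper interval of the coordinate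
circle, with room for the margin k. -/
theorem Confined.exists_val_lt {i : Fin D} {k : ℕ} {A : Set (Site D L)} (h : Confined i k A)
    (hk : k ≤ 3 * (L / 100)) (hL : 1000 ≤ L) : ∃ y : ZMod L, ∀ v ∈ A, (v i - y).val < L - 1 := by
  rcases h with h | h
  · refine ⟨((L / 16 : ℕ) : ZMod L), fun v hv => ?_⟩
    have h1 := h v hv
    unfold coord at h1
    rw [ZMod.valMinAbs_natAbs_eq_min] at h1
    have h2 := ZMod.val_lt (v i)
    refine val_lt_of_eq_intCast (n := ((v i).val : ℤ) - (L / 16 : ℕ)) ?_ (by omega) (by omega)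
    rw [Int.cast_sub, Int.cast_natCast, Int.cast_natCast, ZMod.natCast_zmod_val]
  · refine ⟨-((3 * L / 8 : ℕ) : ZMod L), fun v hv => ?_⟩
    have h1 := h v hv
    unfold coord at h1
    refine val_lt_of_eq_intCast (n := (v i).valMinAbs + (3 * L / 8 : ℕ)) ?_ (by omega) (by omega)
    rw [Int.cast_add, Int.cast_natCast, ZMod.coe_valMinAbs, sub_neg_eq_add]

theorem enclosedBy_of_confined {k : ℕ} {A : Set (Site D L)} (h : ∀ i, Confined i k A)
    (hk : k ≤ 3 * (L / 100)) (hL : 1000 ≤ L) : EnclosedBy (L - 1) A := by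
  choose y hy using fun i => (h i).exists_val_lt hk hL
  exact ⟨y, fun v hv i => hy i v hv⟩

end Coordinate

/-- The ratio between the cost of repairing a cut and the cost of a ball of the scale of the
cut. -/
noncomputable def repairConst (K q : ℕ) : ℝ :=
  1 + (30 * (192 * q + 1) : ℕ) *
    (costFactor * (203 * (2 * K + 1 : ℕ) * (30 * (192 * q + 1) : ℕ) : ℝ) ^ 2)

theorem repairConst_nonneg (K q : ℕ) : 0 ≤ repairConst K q := by
  unfold repairConst costFactor; positivity

namespace CodeHamiltonian
variable {D L : ℕ} [NeZero L] {Q ι : Type} [Fintype Q] {H : CodeHamiltonian D L Q ι}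

/-- An operator without defects and of low cost splits along a coordinate into two operators without
defects. -/
theorem exists_split {K q M m Θ : ℕ} {s : ℝ} (hS : Scales K q M s) (hfree : H.StringFree (L / 2) K)
    (hm : 1 ≤ m) (hΘ : Θ = M * (100 * q ^ m))
    (hL : 10 ^ 6 * ((2 * K + 1) * (30 * (192 * q + 1))) * Θ ≤ L)
    {F : Pauli Q} {B : Finset (Site D L × ℕ)} (hF : H.syn F = 0) (hB : Sized 100 B)
    (hcov : Covers B (H.supp F)) (hcost : cost 100 s B < 99 * ((Θ : ℝ) / 100) ^ (1 + s))
    (i : Fin D) :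
    ∃ F₁ F₂ : Pauli Q, F₁ + F₂ = F ∧ ∀ G, G = F₁ ∨ G = F₂ → H.syn G = 0 ∧
      Confined i (L / 100) (H.supp G) ∧
      (∀ v ∈ H.supp G, ∃ w ∈ H.supp F, siteDist v w ≤ L / 100) ∧
      ∃ B', Sized 100 B' ∧ Covers B' (H.supp G) ∧
        cost 100 s B' ≤ cost 100 s B + repairConst K q * ((Θ : ℝ) / 100) ^ (1 + s) := by
  classical
  have hs := hS.s_pos
  have hq := hS.le_q
  have hK := hS.le_K
  set n := 30 * (192 * q + 1) with hn
  have hnn : n ≤ n ^ (q + 2) := Nat.le_self_pow (by omega) _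
  have hM1 : 1 ≤ M := by have := hS.pow_le; rw [← hn] at this; omega
  have hΘ1 : 100 ≤ Θ := by
    rw [hΘ, mul_left_comm]
    exact Nat.le_mul_of_pos_right _ (Nat.mul_pos hM1 (Nat.pow_pos (by omega)))
  have hnΘ : Θ ≤ n * Θ := Nat.le_mul_of_pos_left _ (by omega)
  have hsp : n * Θ ≤ (2 * K + 1) * (n * Θ) := Nat.le_mul_of_pos_left _ (by omega)
  have hL' : 10 ^ 6 * ((2 * K + 1) * (n * Θ)) ≤ L := by
    refine le_trans (le_of_eq ?_) hL; ring
  have hη : (2 * K + 1) * (203 * n * Θ) ≤ L / 100 := by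
    have : (2 * K + 1) * (203 * n * Θ) = 203 * ((2 * K + 1) * (n * Θ)) := by ring
    omega
  -- The height is the absolute value of the coordinate between L/8 and L/4, so one cut severs the
  -- circle in two opposite places at once.
  let S : Slab H :=
    { F := F, B := B, h := coord i, a := (L / 8 : ℕ), N := L / 8, ℓ := L / 2, K := K, u := 100,
      q := q, E := 300 * (n * Θ) + 1, s := s, lip := lip_coord i, sized := hB,
      covers := fun v hv => hcov v hv.1
      nodef := fun x hx => absurd (congrFun hF x) hx
      enc := fun A _ hA => enclosedBy_of_siteDist_le (by omega) hA
      free := hfree, s_pos := hs, s_le := hS.s_le_one, le_u := le_rfl, le_q := hq,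
      dvd_q := hS.dvd_q }
  have hSΘ : M * S.scale m = Θ := hΘ.symm
  have hcut : S.CutScale m M :=
    { hm := hm, hlog := hS.log_q, hsσ := hS.s_le, costConst_le := hS.costConst_le,
      pow_le := hS.pow_le,
      rpow_le := by
        refine (Real.rpow_le_rpow (by positivity) ?_ hs.le).trans
          (hS.rpow_le.trans (by norm_num))
        have h1 : 1 * (31 * 1 * 1) * M ≤ (q * (31000 * n * (2 * K + 1)) * M) := by
          gcongr <;> omega
        have h2 : 31 * M ≤ (q * (31000 * n * (2 * K + 1)) * M) := by omega
        exact_mod_cast h2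
      hE := by
        rw [hSΘ]
        show 300 * n * Θ < 300 * (n * Θ) + 1
        rw [mul_assoc]; omega
      hN := by
        show 20 * (300 * (n * Θ) + 1) ≤ L / 8
        omega
      hW := by
        rw [hSΘ]
        show 5 * cost 100 s B * Θ ≤ 6 * (L / 8 : ℕ) * ((Θ : ℝ) / (100 : ℕ)) ^ (1 + s)
        have h1 : (495 * Θ : ℝ) ≤ 6 * (L / 8 : ℕ) := by
          exact_mod_cast (by omega : 495 * Θ ≤ 6 * (L / 8))
        have h2 : (0 : ℝ) ≤ ((Θ : ℝ) / 100) ^ (1 + s) := by positivity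
        push_cast at h1 ⊢
        calc 5 * cost 100 s B * Θ ≤ 5 * (99 * ((Θ : ℝ) / 100) ^ (1 + s)) * Θ := by gcongr
          _ = 495 * Θ * ((Θ : ℝ) / 100) ^ (1 + s) := by ring
          _ ≤ _ := mul_le_mul_of_nonneg_right h1 h2 }
  obtain ⟨t, O, c, Dr, hC⟩ := hcut.exists_cut fun T _ => barrier hS hfree le_rfl T
  rw [hSΘ] at hC
  -- The low total cost excludes even a single charged clump, so the cut is repaired completely.
  have hc0 : c = 0 := hC.eq_zero (by
    show cost 100 s B < 99 * ((Θ : ℝ) / (100 : ℕ)) ^ (1 + s)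
    exact_mod_cast hcost)
  have heq : S.cutClus t = H.syn O := by rw [hC.eq, hc0, add_zero]
  have hlt : ((L / 8 : ℕ) : ℤ) + (300 * (n * Θ) + 1 : ℕ) ≤ t := hC.le_t
  have htl : t + (300 * (n * Θ) + 1 : ℕ) ≤ ((L / 8 : ℕ) : ℤ) + (L / 8 : ℕ) := hC.t_le
  have hup : H.syn (S.upper t) = H.syn O := by
    rw [← heq]
    funext x
    unfold Slab.cutClus below
    split_ifs with hx
    · rfl
    · refine Eq.trans ?_ (congrFun hF x)
      refine H.syn_congr fun p hp => H.restr_of_mem ?_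
      have h1 := Lip.abs_le (lip_coord i) hp
      have hx' : ¬ coord i (H.corner x) ≤ t + 1 := hx
      show t < coord i (H.site p)
      omega
  set U := S.upper t with hU
  set V := H.restr {v | t < coord i v}ᶜ F with hV
  have hUV : U + V = F := H.restr_add_compl _ _
  have hsU : H.supp U = {v | t < coord i v} ∩ H.supp F := H.supp_restr _ _
  have hsV : H.supp V = {v | t < coord i v}ᶜ ∩ H.supp F := H.supp_restr _ _
  -- The same repair is added to both pieces: it closes each of them and cancels in their product.
  have hUO : H.syn (U + O) = 0 := by rw [syn_add, hup, clus_add_self]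
  have hadd : (U + O) + (V + O) = F := by
    rw [add_add_add_comm, hUV, pauli_add_self, add_zero]
  have hVO : H.syn (V + O) = 0 := by
    have := congrArg H.syn hadd
    rwa [syn_add, hUO, zero_add, hF] at this
  have hOh : ∀ v ∈ H.supp O, t - (L / 100 : ℕ) ≤ coord i v ∧ coord i v ≤ t + (L / 100 : ℕ) := by
    intro v hv
    have h1 : |coord i v - t| ≤ ((2 * K + 1 : ℕ) : ℤ) * (203 * n * Θ : ℕ) := hC.height v hv
    have h2 : ((2 * K + 1 : ℕ) : ℤ) * (203 * n * Θ : ℕ) ≤ (L / 100 : ℕ) := by exact_mod_cast hη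
    rw [abs_le] at h1
    omega
  have hOn : ∀ v ∈ H.supp O, ∃ w ∈ H.supp F, siteDist v w ≤ L / 100 := by
    intro v hv
    obtain ⟨w, hw, hd⟩ := hC.near v hv
    exact ⟨w, hw, hd.trans hη⟩
  have hfin : ∀ W : Pauli Q, H.supp W ⊆ H.supp F →
      (∀ v ∈ H.supp (W + O), ∃ w ∈ H.supp F, siteDist v w ≤ L / 100) ∧
      ∃ B', Sized 100 B' ∧ Covers B' (H.supp (W + O)) ∧
        cost 100 s B' ≤ cost 100 s B + repairConst K q * ((Θ : ℝ) / 100) ^ (1 + s) := by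
    intro W hW
    refine ⟨fun v hv => ?_, B ∪ Dr, fun b hb => ?_, fun v hv => ?_, ?_⟩
    · rcases H.supp_add_subset _ _ hv with hv | hv
      · exact ⟨v, hW hv, by simp⟩
      · exact hOn v hv
    · rcases Finset.mem_union.1 hb with hb | hb
      · exact hB b hb
      · exact hC.sized b hb
    · rcases H.supp_add_subset _ _ hv with hv | hv
      · obtain ⟨b, hb, h⟩ := hcov v (hW hv)
        exact ⟨b, Finset.mem_union_left _ hb, h⟩
      · obtain ⟨b, hb, h⟩ := hC.covers v hv
        exact ⟨b, Finset.mem_union_right _ hb, h⟩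
    · refine (cost_union_le _ _ _ _).trans (add_le_add_right ?_ _)
      have h1 : cost 100 s Dr ≤ repairConst K q * ((Θ : ℝ) / (100 : ℕ)) ^ (1 + s) := hC.cost_le
      exact_mod_cast h1
  refine ⟨U + O, V + O, hadd, ?_⟩
  rintro G (rfl | rfl)
  · refine ⟨hUO, Or.inl fun v hv => ?_, hfin U (by rw [hsU]; exact Set.inter_subset_right)⟩
    rcases H.supp_add_subset _ _ hv with hv | hv
    · rw [hsU] at hv
      have : t < coord i v := hv.1
      omega
    · have := hOh v hv
      omega
  · refine ⟨hVO, Or.inr fun v hv => ?_, hfin V (by rw [hsV]; exact Set.inter_subset_right)⟩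
    rcases H.supp_add_subset _ _ hv with hv | hv
    · rw [hsV] at hv
      have : ¬ t < coord i v := hv.1
      omega
    · have := hOh v hv
      omega

/-- In three dimensions, if operators without defects that are enclosed by a cube smaller than the
lattice are stabilizers, then so are operators without defects of low cost. -/
theorem isStabilizer_of_cost_lt {H : CodeHamiltonian 3 L Q ι} {K q M m k : ℕ} {s : ℝ}
    (hS : Scales K q M s) (hfree : H.StringFree (L / 2) K)
    (hstab : ∀ E, H.syn E = 0 → EnclosedBy (L - 1) (H.supp E) → H.IsStabilizer E)
    (hm : 1 ≤ m) (hk : 1 + repairConst K q ≤ (q : ℝ) ^ k)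
    (hL : 10 ^ 6 * ((2 * K + 1) * (30 * (192 * q + 1))) * (M * (100 * q ^ (m + 2 * k))) ≤ L) :
    ∀ (r p : ℕ), p + r = 3 → ∀ (F : Pauli Q) (B : Finset (Site 3 L × ℕ)), H.syn F = 0 →
      Sized 100 B → Covers B (H.supp F) →
      cost 100 s B < 99 * (((M * (100 * q ^ (m + p * k)) : ℕ) : ℝ) / 100) ^ (1 + s) →
      (∀ i : Fin 3, i.val < p → Confined i (p * (L / 100)) (H.supp F)) → H.IsStabilizer F := by
  have hq := hS.le_q
  have hM1 : 1 ≤ M := by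
    have := hS.pow_le
    have h2 : 1 ≤ (30 * (192 * q + 1)) ^ (q + 2) := Nat.one_le_pow _ _ (by omega)
    omega
  have hLL : 1000 ≤ L := by
    have h1 : 1 ≤ (2 * K + 1) * (30 * (192 * q + 1)) := Nat.mul_pos (by omega) (by omega)
    have h2 : 1 ≤ M * (100 * q ^ (m + 2 * k)) :=
      Nat.mul_pos hM1 (Nat.mul_pos (by omega) (Nat.pow_pos (by omega)))
    have := Nat.mul_le_mul (Nat.mul_le_mul (le_refl (10 ^ 6)) h1) h2
    omega
  intro r
  induction r with
  | zero =>
    intro p hp F B hF _ _ _ hconf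
    obtain rfl : p = 3 := by omega
    exact hstab F hF (enclosedBy_of_confined (fun i => hconf i i.2) le_rfl hLL)
  | succ r ih =>
    intro p hp F B hF hB hcov hcost hconf
    set Θ := M * (100 * q ^ (m + p * k)) with hΘ
    obtain ⟨F₁, F₂, hadd, hG⟩ := exists_split hS hfree (m := m + p * k) (by omega) hΘ (by
      refine le_trans (Nat.mul_le_mul_left _ (Nat.mul_le_mul_left _ (Nat.mul_le_mul_left _
        (Nat.pow_le_pow_right (by omega) ?_)))) hL
      have : p * k ≤ 2 * k := Nat.mul_le_mul_right _ (by omega)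
      omega) hF hB hcov hcost ⟨p, by omega⟩
    have key : ∀ G, G = F₁ ∨ G = F₂ → H.IsStabilizer G := by
      intro G hGF
      obtain ⟨h0, hc, hn, B', hB', hcov', hcost'⟩ := hG G hGF
      refine ih (p + 1) (by omega) G B' h0 hB' hcov' ?_ fun i hi => ?_
      -- A split adds at most `repairConst` (Θ/100)^(1+s) to the cost. Raising the scale by q^k ≥ 1
      -- + `repairConst` keeps it below the threshold for the next coordinate.
      · have hΘ0 : (0 : ℝ) ≤ (Θ : ℝ) / 100 := by positivity
        have e : ((M * (100 * q ^ (m + (p + 1) * k)) : ℕ) : ℝ) / 100 = q ^ k * ((Θ : ℝ) / 100) := by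
          rw [hΘ]; push_cast; ring
        have hR := repairConst_nonneg K q
        have h1 : (q : ℝ) ^ k ≤ ((q : ℝ) ^ k) ^ (1 + s) :=
          Real.self_le_rpow_of_one_le (by linarith) (by linarith [hS.s_pos])
        rw [e, Real.mul_rpow (by positivity) hΘ0]
        have h2 : (0 : ℝ) ≤ ((Θ : ℝ) / 100) ^ (1 + s) := by positivity
        have h3 : (1 + repairConst K q) * ((Θ : ℝ) / 100) ^ (1 + s) ≤
            ((q : ℝ) ^ k) ^ (1 + s) * ((Θ : ℝ) / 100) ^ (1 + s) :=
          mul_le_mul_of_nonneg_right (hk.trans h1) h2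
        have h4 := mul_nonneg hR h2
        linarith
      · have e : (p + 1) * (L / 100) = p * (L / 100) + L / 100 := by ring
        rw [e]
        rcases Nat.lt_succ_iff_lt_or_eq.1 hi with hi | hi
        · exact (hconf i hi).of_near hn
        · subst hi
          rw [add_comm]
          exact hc.of_near fun v hv => ⟨v, hv, by simp⟩
    rw [← hadd]
    exact Submodule.add_mem _ (key F₁ (Or.inl rfl)) (key F₂ (Or.inr rfl))

end CodeHamiltonian

/-- For small L the bound is at most 1. Otherwise a scale comparable to L leaves room for the
enlargements between the three splits, and an operator of small weight would be a product of
stabilizers. -/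
theorem weight_lower_bound_cubicCode {q M k : ℕ} {s : ℝ} (hS : Scales 10 q M s)
    (hk : 1 + repairConst 10 q ≤ (q : ℝ) ^ k) {L C : ℕ} [NeZero L]
    (hC : C = 10 ^ 6 * ((2 * 10 + 1) * (30 * (192 * q + 1))) * (M * q ^ (2 * k)))
    {E : Pauli (Site 3 L × Fin 2)} (hE : (cubicCode L).IsLogical E) :
    ((1 : ℝ) / (100 * q * C : ℕ)) ^ (1 + s) * (L : ℝ) ^ (1 + s) ≤ E.weight := by
  have hs := hS.s_pos
  have hq := hS.le_q
  have hM1 : 1 ≤ M := by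
    have := hS.pow_le
    have h2 : 1 ≤ (30 * (192 * q + 1)) ^ (q + 2) := Nat.one_le_pow _ _ (by omega)
    omega
  have hC1 : 1 ≤ C := by
    rw [hC]
    exact Nat.mul_pos (by positivity) (Nat.mul_pos hM1 (Nat.pow_pos (by omega)))
  have hd : (0 : ℝ) < (100 * q * C : ℕ) := by
    exact_mod_cast Nat.mul_pos (by omega : 0 < 100 * q) hC1
  rw [← Real.mul_rpow (by positivity) (by positivity), one_div_mul_eq_div]
  rcases le_or_gt (C * (100 * q)) L with hbig | hsmall
  · obtain ⟨m, hm1, hm2, hm3⟩ := exists_scale_le (by omega : 2 ≤ q) hC1 (by omega : 1 ≤ 100) hbig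
    by_contra hlt
    push Not at hlt
    obtain ⟨B, hB1, hB2, hB3⟩ := exists_supp_finset (cubicCode L) E
    have hsyn : (cubicCode L).syn E = 0 := by
      funext a
      by_contra ha
      have := ((cubicCode L).mem_syndrome (E := E)).2 ha
      rw [hE.1] at this
      exact this
    have hL1 := Nat.pos_of_neZero L
    refine hE.2 (isStabilizer_of_cost_lt hS (stringFree_cubicCode (by omega))
      (fun F hF hFe => isStabilizer_of_enclosedBy (by omega) hF hFe) hm1 hk ?_ 3 0 rfl E B hsyn
      (fun b hb => Or.inl (hB2 b hb)) hB1 ((hB3 100 s).trans_lt (hlt.trans_le ?_))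
      fun i hi => absurd hi (Nat.not_lt_zero _))
    · refine le_trans (le_of_eq ?_) hm2
      rw [hC, pow_add]; ring
    · have h1 : ((L : ℝ) / (100 * q * C : ℕ)) ≤
          ((M * (100 * q ^ (m + 0 * k)) : ℕ) : ℝ) / 100 := by
        rw [div_le_iff₀ hd]
        have h2 : L ≤ q ^ m * (100 * q * C) := by
          refine hm3.le.trans (le_of_eq ?_); ring
        have h3 : q ^ m * (100 * q * C) ≤ M * q ^ m * (100 * q * C) :=
          Nat.mul_le_mul_right _ (Nat.le_mul_of_pos_left _ hM1)
        have h4 : (L : ℝ) ≤ ((M * q ^ m * (100 * q * C) : ℕ) : ℝ) := by exact_mod_cast h2.trans h3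
        refine h4.trans (le_of_eq ?_)
        push_cast
        rw [zero_mul, add_zero]
        ring
      have h5 := Real.rpow_le_rpow (by positivity) h1 (by linarith : 0 ≤ 1 + s)
      have h6 : (0 : ℝ) ≤ (((M * (100 * q ^ (m + 0 * k)) : ℕ) : ℝ) / 100) ^ (1 + s) := by
        positivity
      linarith
  · have h1 : ((L : ℝ) / (100 * q * C : ℕ)) ^ (1 + s) ≤ 1 := by
      refine Real.rpow_le_one (by positivity) ?_ (by linarith)
      rw [div_le_one hd]
      have : L ≤ 100 * q * C := by
        refine hsmall.le.trans (le_of_eq ?_); ring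
      exact_mod_cast this
    refine h1.trans ?_
    have h2 : E ≠ 0 := by
      rintro rfl
      exact hE.2 (Submodule.zero_mem _)
    have : 0 < E.weight := hammingNorm_pos_iff.2 h2
    exact_mod_cast this

theorem codeDistance_cubicCode_lower_bound :
    ∃ γ c : ℝ, 1 < γ ∧ 0 < c ∧
      ∀ (L : ℕ) [NeZero L], c * (L : ℝ) ^ γ ≤ ((cubicCode L).codeDistance : ℝ) := by
  obtain ⟨q, M, s, hS⟩ := exists_scales (K := 10) (by norm_num)
  have hs := hS.s_pos
  have hq := hS.le_q
  obtain ⟨k, hk⟩ := pow_unbounded_of_one_lt (1 + repairConst 10 q)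
    (by exact_mod_cast (by omega : 1 < q) : (1 : ℝ) < q)
  have hM1 : 1 ≤ M := by
    have := hS.pow_le
    have h2 : 1 ≤ (30 * (192 * q + 1)) ^ (q + 2) := Nat.one_le_pow _ _ (by omega)
    omega
  set C := 10 ^ 6 * ((2 * 10 + 1) * (30 * (192 * q + 1))) * (M * q ^ (2 * k)) with hC
  have hC1 : 0 < 100 * q * C := Nat.mul_pos (by omega) (Nat.mul_pos (by positivity)
    (Nat.mul_pos hM1 (Nat.pow_pos (by omega))))
  have hd : (0 : ℝ) < (100 * q * C : ℕ) := by exact_mod_cast hC1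
  refine ⟨1 + s, ((1 : ℝ) / (100 * q * C : ℕ)) ^ (1 + s), by linarith, by positivity,
    fun L _ => ?_⟩
  -- Existence of a logical operator matters, since the infimum of the empty set would be 0.
  · obtain ⟨E, hE⟩ := exists_isLogical_cubicCode L
    obtain ⟨E', hE', hw⟩ := Nat.sInf_mem
      (s := {n | ∃ E, (cubicCode L).IsLogical E ∧ E.weight = n}) ⟨_, E, hE, rfl⟩
    rw [codeDistance, ← hw]
    exact weight_lower_bound_cubicCode hS hk.le hC hE'

end PauliCode

theorem mainTheorem10 :
    (∀ (D : ℕ) (α : ℝ), 1 ≤ α →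
      ∃ γ c : ℝ, 1 < γ ∧ 0 < c ∧
        ∀ (L : ℕ) [NeZero L] (Q ι : Type) [Fintype Q] [Finite ι]
          (H : CodeHamiltonian D L Q ι) (Ltqo : ℕ), 2 * Ltqo ≤ L →
          H.TQO1 Ltqo → H.TQO2 Ltqo → H.NoStrings Ltqo α →
          ∀ (S S' : Set ι) (E : Pauli Q) (r : ℕ) (R : ℝ),
            H.Neutral Ltqo S → S' ⊆ S → H.Charged Ltqo S' →
            (∀ u ∈ H.region S', ∀ v ∈ H.region S', siteDist u v ≤ r) →
            0 ≤ R →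
            (∀ u ∈ H.region S', ∀ v ∈ H.region (S \ S'), R < (siteDist u v : ℝ)) →
            (r : ℝ) + 2 * R < Ltqo →
            H.syndrome E = S →
            c * R ^ γ ≤ (E.weight : ℝ)) ∧
    (∃ γ c : ℝ, 1 < γ ∧ 0 < c ∧
      ∀ (L : ℕ) [NeZero L], c * (L : ℝ) ^ γ ≤ ((cubicCode L).codeDistance : ℝ)) := by
  exact ⟨weight_lower_bound_of_noStrings, codeDistance_cubicCode_lower_bound⟩
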